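/- Let $k$ be a field, $R$ a (left and right) noetherian $k$-algebra and $S=R[x;\tau,\delta]$ an Ore extension, where $\tau$ is a $k$-algebra automorphism of $R$, $\delta$ is a $k$-linear $\tau$-derivation ($\delta(rs)=\tau(r)\delta(s)+\delta(r)s$), and $xr=\tau(r)x+\delta(r)$ for $r\in R$. Let $H$ be an abelian group acting on $S$ by $k$-algebra automorphisms. An $H$-prime ideal of an algebra with $H$-action is a proper $H$-stable two-sided ideal $P$ such that, for all $H$-stable ideals $I,J$, $IJ\subseteq P$ implies $I\subseteq P$ or $J\subseteq P$; $\operatorname{Spec}_H$ denotes the set of $H$-prime ideals, ordered by inclusion. Assume that $S$ is a Cauchon extension of $R$: (i) $\delta$ is locally nilpotent; (ii) $\delta\tau=q\tau\delta$ for some $q\in k^\times$ that is not a root of unity; (iii) $R$ is $H$-stable and $x$ is an $H$-eigenvector; (iv) there is $h_0\in H$ with $h_0|_R=\tau$ and such that the $h_0$-eigenvalue of $x$ is not a root of unity; (v) every $H$-prime ideal of $R$ is completely prime. Assume moreover that $\tau$ acts diagonalizably on $R$, i.e. $R$ is spanned over $k$ by $\tau$-eigenvectors. Let $L=S[x^{-1}]$,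 let $C:R\to L$ be the derivation-deleting homomorphism $$C(r)=\sum_{l\ge 0} q_l\,\delta^l\tau^{-l}(r)\,x^{-l},\qquad q_l=\frac{q^{l(l+1)/2}(q-1)^{-l}}{(l)!_q},\qquad (l)!_q=\prod_{j=1}^{l}(1+q+\cdots+q^{j-1}),$$ and for an ideal $P$ of $R$ put $\widetilde C(P)=\langle C(P)\rangle_L\cap S$ and $P_x=\langle P\cup\{x\}\rangle_S$. Let $W$ be a Coxeter group with a fixed set of simple generators, $\le$ the Bruhat order, $W^{\le w}=\{v\in W: v\le w\}$, $a$ a simple generator, and $\overline w\in W$ with $\overline w\le\overline wa$. Put $$W_1=\{w\le\overline wa: wa\le w\le\overline w\},\quad W_2=\{w\le\overline wa: w\le wa\le\overline w\},\quad W_3=\{w\le\overline wa: wa\not\le\overline w\},$$ (so that $W_1\cup W_2\cup W_3=W^{\le\overline w}$), and let $\Phi(w)=w$ if $w\le wa$ and $\Phi(w)=wa$ otherwise. **Theorem.** Let $\nabla:W^{\le\overline w}\to\operatorname{Spec}_H R$ be a poset isomorphism such that (H1) $\nabla(W_3)=\{P\in\operatorname{Spec}_H R:\delta(R)\subseteq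 P\}$; (H2) $\widetilde C(\nabla(w))\cap R=\nabla(\Phi(w))$ for all $w\in W_1\cup W_2$. Then there is a poset isomorphism $\widetilde\nabla:W^{\le\overline wa}\to\operatorname{Spec}_H S$ given by $$\widetilde\nabla(w)=\begin{cases}\widetilde C(\nabla(w)), & w\le\overline w,\\ \nabla(wa)_x, & \text{otherwise}\end{cases}$$ (where in the second case $wa\le\overline w$). -/

import Mathlib

/-! ## The Bruhat order on a Coxeter group -/

section Bruhat

variable {B W : Type*} [Group W] {M : CoxeterMatrix B}

/-- One step up in the Bruhat order: `v = u * t` for a reflection `t`, and `v` is longer than `u`. -/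
def BruhatStep (cs : CoxeterSystem M W) (u v : W) : Prop :=
  ∃ t : W, cs.IsReflection t ∧ v = u * t ∧ cs.length u < cs.length v

/-- The Bruhat order: the reflexive and transitive closure of `BruhatStep`. -/
def BruhatLE (cs : CoxeterSystem M W) (u v : W) : Prop :=
  Relation.ReflTransGen (BruhatStep cs) u v

theorem BruhatLE.eq_or_length_lt {cs : CoxeterSystem M W} {u v : W} (h : BruhatLE cs u v) :
    u = v ∨ cs.length u < cs.length v := by
  induction h with
  | refl => exact Or.inl rfl
  | tail _ hs ih =>
    obtain ⟨t, -, -, hl⟩ := hs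
    rcases ih with rfl | ih
    · exact Or.inr hl
    · exact Or.inr (ih.trans hl)

theorem BruhatLE.antisymm {cs : CoxeterSystem M W} {u v : W} (h : BruhatLE cs u v)
    (h' : BruhatLE cs v u) : u = v := by
  rcases h.eq_or_length_lt with h1 | h1
  · exact h1
  · rcases h'.eq_or_length_lt with h2 | h2
    · exact h2.symm
    · omega

/-- The Bruhat interval `W^{≤ u} = {w : w ≤ u}`. -/
@[ext]
structure BruhatInterval (cs : CoxeterSystem M W) (u : W) where
  /-- the underlying group element -/
  val : W
  le : BruhatLE cs val u

instance (cs : CoxeterSystem M W) (u : W) : PartialOrder (BruhatInterval cs u) where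
  le w w' := BruhatLE cs w.val w'.val
  le_refl _ := Relation.ReflTransGen.refl
  le_trans _ _ _ h h' := Relation.ReflTransGen.trans h h'
  le_antisymm _ _ h h' := BruhatInterval.ext (BruhatLE.antisymm h h')

/-- `W₁ = {w ≤ u a : w a ≤ w ≤ u}`, where `a` is the simple reflection with index `i`. -/
def bruhatW1 (cs : CoxeterSystem M W) (u : W) (i : B) : Set W :=
  {w | BruhatLE cs w (u * cs.simple i) ∧ BruhatLE cs (w * cs.simple i) w ∧ BruhatLE cs w u}

/-- `W₂ = {w ≤ u a : w ≤ w a ≤ u}`. -/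
def bruhatW2 (cs : CoxeterSystem M W) (u : W) (i : B) : Set W :=
  {w | BruhatLE cs w (u * cs.simple i) ∧ BruhatLE cs w (w * cs.simple i) ∧
    BruhatLE cs (w * cs.simple i) u}

/-- `W₃ = {w ≤ u a : w a ≰ u}`. -/
def bruhatW3 (cs : CoxeterSystem M W) (u : W) (i : B) : Set W :=
  {w | BruhatLE cs w (u * cs.simple i) ∧ ¬ BruhatLE cs (w * cs.simple i) u}

open Classical in
/-- The projection `Φ`: it fixes `w` if `w ≤ w a`, and sends `w` to `w a` otherwise. -/
noncomputable def bruhatPhi (cs : CoxeterSystem M W) (i : B) (w : W) : W :=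
  if BruhatLE cs w (w * cs.simple i) then w else w * cs.simple i

theorem bruhatLE_of_mem {cs : CoxeterSystem M W} {u w : W} {i : B}
    (h : w ∈ bruhatW1 cs u i ∪ bruhatW2 cs u i) : BruhatLE cs w u := by
  rcases h with h | h
  · exact h.2.2
  · exact Relation.ReflTransGen.trans h.2.1 h.2.2

theorem bruhatPhi_le_of_mem {cs : CoxeterSystem M W} {u w : W} {i : B}
    (h : w ∈ bruhatW1 cs u i ∪ bruhatW2 cs u i) : BruhatLE cs (bruhatPhi cs i w) u := by
  unfold bruhatPhi
  split_ifs with hw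
  · exact bruhatLE_of_mem h
  · rcases h with h | h
    · exact Relation.ReflTransGen.trans h.2.1 h.2.2
    · exact h.2.2

end Bruhat

/-! ## `H`-prime ideals -/

section HPrime

/-- A two-sided ideal is `H`-stable if every element of `H` maps it into itself (equivalently,
onto itself, as `H` is a group). -/
def IsHStable (H : Type*) {A : Type*} [Group H] [Ring A] [MulSemiringAction H A]
    (I : TwoSidedIdeal A) : Prop :=
  ∀ (h : H) (a : A), a ∈ I → h • a ∈ I

/-- An `H`-prime ideal: a proper `H`-stable ideal `P` such that, whenever `P` contains the product
of two `H`-stable ideals, it contains one of them. -/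
structure IsHPrime (H : Type*) {A : Type*} [Group H] [Ring A] [MulSemiringAction H A]
    (P : TwoSidedIdeal A) : Prop where
  ne_top : P ≠ ⊤
  stable : IsHStable H P
  le_or_le : ∀ I J : TwoSidedIdeal A, IsHStable H I → IsHStable H J →
    (∀ a ∈ I, ∀ b ∈ J, a * b ∈ P) → I ≤ P ∨ J ≤ P

/-- A completely prime ideal: the quotient is a domain. -/
def IsCompletelyPrimeIdeal {A : Type*} [Ring A] (P : TwoSidedIdeal A) : Prop :=
  P ≠ ⊤ ∧ ∀ a b : A, a * b ∈ P → a ∈ P ∨ b ∈ P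

/-- The poset `Spec_H A` of `H`-prime ideals, ordered by inclusion. -/
abbrev HSpec (H A : Type*) [Group H] [Ring A] [MulSemiringAction H A] : Type _ :=
  {P : TwoSidedIdeal A // IsHPrime H P}

end HPrime

/-! ## Cauchon extensions -/

/-- A Cauchon extension `S = R[x; τ, δ]` of `k`-algebras, with respect to a group `H` acting on `S`
and on its `H`-stable subalgebra `R`. -/
structure CauchonExtension (k H R S : Type*) [Field k] [CommGroup H] [Ring R] [Algebra k R]
    [Ring S] [Algebra k S] [MulSemiringAction H R] [MulSemiringAction H S] where
  /-- the inclusion of `R` in `S` (injective by `bijective_sum`) -/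
  incl : R →ₐ[k] S
  /-- the Ore variable -/
  x : S
  /-- the automorphism `τ` of `R` -/
  τ : R ≃ₐ[k] R
  /-- the `τ`-derivation `δ` of `R` -/
  δ : R →ₗ[k] R
  /-- the scalar `q` -/
  q : k
  /-- `R` is left noetherian -/
  noetherian_left : IsNoetherianRing R
  /-- `R` is right noetherian -/
  noetherian_right : IsNoetherianRing Rᵐᵒᵖ
  δ_mul : ∀ r s : R, δ (r * s) = τ r * δ s + δ r * s
  /-- the commutation rule of the Ore extension -/
  x_mul : ∀ r : R, x * incl r = incl (τ r) * x + incl (δ r)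
  /-- `S` is a free left `R`-module with basis `1, x, x², …` -/
  bijective_sum : Function.Bijective (fun p : ℕ →₀ R => p.sum fun n r => incl r * x ^ n)
  δ_locally_nilpotent : ∀ r : R, ∃ n : ℕ, (δ^[n]) r = 0
  q_ne_zero : q ≠ 0
  q_not_root : ∀ n : ℕ, 0 < n → q ^ n ≠ 1
  δ_τ : ∀ r : R, δ (τ r) = q • τ (δ r)
  /-- `H` acts on `S` by `k`-algebra automorphisms -/
  smul_algebra : ∀ (h : H) (c : k) (s : S), h • (c • s) = c • (h • s)
  /-- `R` is `H`-stable, and the action of `H` on `R` is the restricted one -/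
  incl_smul : ∀ (h : H) (r : R), incl (h • r) = h • incl r
  /-- `x` is an `H`-eigenvector -/
  x_eigen : ∀ h : H, ∃ c : k, h • x = c • x
  exists_h₀ : ∃ h₀ : H, (∀ r : R, h₀ • r = τ r) ∧
    ∃ μ : k, h₀ • x = μ • x ∧ ∀ n : ℕ, 0 < n → μ ^ n ≠ 1
  completelyPrime : ∀ P : TwoSidedIdeal R, IsHPrime H P → IsCompletelyPrimeIdeal P

namespace CauchonExtension

variable {k H R S : Type*} [Field k] [CommGroup H] [Ring R] [Algebra k R]
    [Ring S] [Algebra k S] [MulSemiringAction H R] [MulSemiringAction H S]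

theorem mul_x_cancel (E : CauchonExtension k H R S) {f g : S} (h : f * E.x = g * E.x) :
    f = g := by
  obtain ⟨p, rfl⟩ := E.bijective_sum.2 f
  obtain ⟨p', rfl⟩ := E.bijective_sum.2 g
  have key : ∀ p : ℕ →₀ R, (p.sum fun n r => E.incl r * E.x ^ n) * E.x =
      (p.mapDomain Nat.succ).sum fun n r => E.incl r * E.x ^ n := by
    intro p
    rw [Finsupp.sum_mapDomain_index (by simp) (by intros; rw [map_add, add_mul]),
      Finsupp.sum, Finset.sum_mul, Finsupp.sum]
    exact Finset.sum_congr rfl fun n _ => by rw [mul_assoc, pow_succ]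
  simp only [key] at h
  have h' := Finsupp.mapDomain_injective Nat.succ_injective (E.bijective_sum.1 h)
  rw [h']

theorem mul_pow_cancel (E : CauchonExtension k H R S) (m : ℕ) {f g : S}
    (h : f * E.x ^ m = g * E.x ^ m) : f = g := by
  induction m with
  | zero => simpa using h
  | succ m ih =>
    rw [pow_succ, ← mul_assoc, ← mul_assoc] at h
    exact ih (E.mul_x_cancel h)

theorem iterate_δ_τ (E : CauchonExtension k H R S) (n : ℕ) (r : R) (h : (E.δ^[n]) r = 0) :
    (E.δ^[n]) (E.τ r) = 0 := by
  have key : ∀ (n : ℕ) (r : R), (E.δ^[n]) (E.τ r) = E.q ^ n • E.τ ((E.δ^[n]) r) := by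
    intro n
    induction n with
    | zero => intro r; simp
    | succ n ih =>
      intro r
      rw [Function.iterate_succ_apply', ih, map_smul, E.δ_τ, smul_smul,
        Function.iterate_succ_apply', pow_succ]
  rw [key, h, map_zero, smul_zero]

theorem exists_pow_mul_incl (E : CauchonExtension k H R S) (n : ℕ) : ∀ (m : ℕ) (r : R),
    (E.δ^[n]) r = 0 → ∃ (N : ℕ) (g : S), E.x ^ N * E.incl r = g * E.x ^ m := by
  induction n with
  | zero =>
    intro m r h
    have h0 : r = 0 := h
    exact ⟨0, 0, by simp [h0]⟩
  | succ n ihn =>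
    intro m
    induction m with
    | zero => intro r _; exact ⟨0, E.incl r, by simp⟩
    | succ m ihm =>
      intro r h
      obtain ⟨N₁, g₁, h₁⟩ := ihm (E.τ r) (E.iterate_δ_τ _ _ h)
      obtain ⟨N₂, g₂, h₂⟩ := ihn (m + 1) (E.δ r) h
      refine ⟨N₁ + N₂ + 1, E.x ^ N₂ * g₁ + E.x ^ N₁ * g₂, ?_⟩
      calc E.x ^ (N₁ + N₂ + 1) * E.incl r
          = E.x ^ (N₁ + N₂) * (E.x * E.incl r) := by rw [pow_succ, mul_assoc]
        _ = E.x ^ (N₂ + N₁) * (E.incl (E.τ r) * E.x)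
            + E.x ^ (N₁ + N₂) * E.incl (E.δ r) := by
              rw [E.x_mul, mul_add, add_comm N₂ N₁]
        _ = E.x ^ N₂ * (E.x ^ N₁ * E.incl (E.τ r)) * E.x
            + E.x ^ N₁ * (E.x ^ N₂ * E.incl (E.δ r)) := by
              rw [pow_add, pow_add]; simp only [mul_assoc]
        _ = _ := by
              rw [h₁, h₂, add_mul, pow_succ]; simp only [mul_assoc]

theorem exists_pow_mul (E : CauchonExtension k H R S) (f : S) (m : ℕ) :
    ∃ (N : ℕ) (g : S), E.x ^ N * f = g * E.x ^ m := by
  obtain ⟨p, rfl⟩ := E.bijective_sum.2 f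
  dsimp only
  induction p using Finsupp.induction_linear with
  | zero => exact ⟨0, 0, by simp⟩
  | add p p' ih ih' =>
    obtain ⟨N, g, h⟩ := ih
    obtain ⟨N', g', h'⟩ := ih'
    rw [Finsupp.sum_add_index' (by simp) (by intros; rw [map_add, add_mul])]
    refine ⟨N + N', E.x ^ N' * g + E.x ^ N * g', ?_⟩
    rw [mul_add, add_mul, mul_assoc, mul_assoc, ← h, ← h', ← mul_assoc, ← mul_assoc, ← pow_add,
      ← pow_add, add_comm N' N]
  | single n r =>
    obtain ⟨d, hd⟩ := E.δ_locally_nilpotent r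
    obtain ⟨N, g, h⟩ := E.exists_pow_mul_incl d m r hd
    refine ⟨N, g * E.x ^ n, ?_⟩
    rw [Finsupp.sum_single_index (by simp), ← mul_assoc, h, mul_assoc, mul_assoc, ← pow_add,
      ← pow_add, add_comm]

/-- The powers of `x` form an Ore set in `S`. -/
noncomputable instance (E : CauchonExtension k H R S) :
    OreLocalization.OreSet (Submonoid.powers E.x) where
  ore_right_cancel f g s h := by
    obtain ⟨_, m, rfl⟩ := s
    exact ⟨1, by rw [E.mul_pow_cancel m h]⟩
  oreNum f s := (E.exists_pow_mul f s.2.choose).choose_spec.choose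
  oreDenom f s := ⟨E.x ^ (E.exists_pow_mul f s.2.choose).choose, _, rfl⟩
  ore_eq f s := by
    have h := (E.exists_pow_mul f s.2.choose).choose_spec.choose_spec
    have hs : E.x ^ s.2.choose = (s : S) := s.2.choose_spec
    exact h.trans (congrArg _ hs)

/-- The localization `L = S[x⁻¹]`. -/
abbrev Loc (E : CauchonExtension k H R S) : Type _ :=
  OreLocalization (Submonoid.powers E.x) S

/-- The canonical map `S → L`. -/
noncomputable def toLoc (E : CauchonExtension k H R S) : S →+* E.Loc :=
  OreLocalization.numeratorRingHom

/-- The element `x⁻¹` of `L`. -/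
noncomputable def xInv (E : CauchonExtension k H R S) : E.Loc :=
  ((OreLocalization.numeratorUnit (⟨E.x, 1, pow_one _⟩ : Submonoid.powers E.x))⁻¹ :
    (E.Loc)ˣ)

/-- The scalar `q_l = q^{l(l+1)/2} (q-1)^{-l} / (l)!_q`, where
`(l)!_q = ∏_{j=1}^{l} (1 + q + ⋯ + q^{j-1})`. -/
noncomputable def qCoeff (E : CauchonExtension k H R S) (l : ℕ) : k :=
  E.q ^ (l * (l + 1) / 2) * ((E.q - 1)⁻¹) ^ l /
    ∏ j ∈ Finset.Icc 1 l, ∑ i ∈ Finset.range j, E.q ^ i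

/-- Cauchon's derivation-deleting map `C : R → L`, `C(r) = ∑_l q_l δ^l τ^{-l}(r) x^{-l}`;
the sum is finite because `δ` is locally nilpotent and commutes with `τ` up to a scalar. -/
noncomputable def derivationDeleting (E : CauchonExtension k H R S) (r : R) : E.Loc :=
  ∑ᶠ l : ℕ, E.toLoc (E.incl (E.qCoeff l • (E.δ^[l]) ((E.τ.symm^[l]) r))) * E.xInv ^ l

/-- `C̃(P) = ⟨C(P)⟩_L ∩ S`. -/
noncomputable def tildeC (E : CauchonExtension k H R S) (P : TwoSidedIdeal R) :
    TwoSidedIdeal S :=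
  TwoSidedIdeal.comap E.toLoc (TwoSidedIdeal.span (E.derivationDeleting '' (P : Set R)))

/-- `P_x = ⟨P ∪ {x}⟩_S`. -/
def adjoinX (E : CauchonExtension k H R S) (P : TwoSidedIdeal R) : TwoSidedIdeal S :=
  TwoSidedIdeal.span (E.incl '' (P : Set R) ∪ {E.x})

/-- The contraction `Q ∩ R` of an ideal `Q` of `S`. -/
def contract (E : CauchonExtension k H R S) (Q : TwoSidedIdeal S) : TwoSidedIdeal R :=
  TwoSidedIdeal.comap E.incl Q

/-- `τ` acts diagonalizably on `R`: the algebra `R` is spanned by `τ`-eigenvectors. -/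
def TauDiagonalizable (E : CauchonExtension k H R S) : Prop :=
  Submodule.span k {r : R | ∃ c : k, E.τ r = c • r} = ⊤

end CauchonExtension

/-! The `H`-primes `P` of `S` are of two kinds. If `x ∈ P`, then `P` is generated by `x` and `P ∩
R`, and `P ∩ R` is an `H`-prime of `R` containing `δ(R)` (`isHPrime_contract`, `adjoinX_contract`);
by (H1) these contractions are the `∇(w)` with `w ∈ W₃`, and right multiplication by `a` carries
`W₃` onto the elements below `ua` but not below `u`.

If `x ∉ P`, then left multiplication by `x` is injective modulo `P` (`mem_of_x_mul_mem`), so `P` is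
recovered from its extension to `L`. Since `x C(r) = C(τ r) x`, the ring `L` is the direct sum of
the `C(R) x^i`, a skew Laurent ring over a copy of `R`. The map `y ↦ x⁻¹ h₀(y) x` is multiplication
by `μ^i` on `C(R) x^i`, where `μ` is the `h₀`-eigenvalue of `x`. The `μ^i` are distinct, so the
extension of `P` is graded and `P = C̃(Q)` for an `H`-prime `Q` of `R` (`exists_tildeC_eq`).
Conversely `C̃(Q)` is completely prime because `Q` is.

For the order, `C̃` and `Q ↦ Q_x` preserve and reflect inclusions, and no `C̃(Q)` contains `x`. The
remaining comparison is `tildeC_le_adjoinX_iff`: if `δ(R) ⊆ Q`, then `C̃(I) ⊆ Q_x` if and only if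
`C̃(I) ∩ R ⊆ Q`. For `I = ∇(w)` and `Q = ∇(va)`, (H2) turns this into `Φ(w) ≤ va`, which the lifting
property of the Bruhat order identifies with `w ≤ v` (`le_iff_bruhatPhi_le`). -/

section BruhatLifting

variable {B W : Type*} [Group W] {M : CoxeterMatrix B} (cs : CoxeterSystem M W)

/-! ### Reflections, inversions and the strong exchange property -/

namespace CoxeterSystem

open Classical in
/-- The signed conjugation by a simple reflection: `(t, e) ↦ (s t s, e + [t = s])`. -/
noncomputable def signedConj (i : B) : Equiv.Perm (W × ZMod 2) where
  toFun p := (cs.simple i * p.1 * cs.simple i, p.2 + if p.1 = cs.simple i then 1 else 0)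
  invFun p := (cs.simple i * p.1 * cs.simple i, p.2 + if p.1 = cs.simple i then 1 else 0)
  left_inv p := by
    have h : cs.simple i * p.1 * cs.simple i = cs.simple i ↔ p.1 = cs.simple i := by
      rw [mul_eq_right, ← cs.simple_mul_simple_self i, mul_right_inj]
    ext
    · simp [mul_assoc]
    · simp only [h, add_assoc, CharTwo.add_self_eq_zero, add_zero]
  right_inv p := by
    have h : cs.simple i * p.1 * cs.simple i = cs.simple i ↔ p.1 = cs.simple i := by
      rw [mul_eq_right, ← cs.simple_mul_simple_self i, mul_right_inj]
    ext
    · simp [mul_assoc]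
    · simp only [h, add_assoc, CharTwo.add_self_eq_zero, add_zero]

-- Conjugation by `s_j` inverts `c = s_i s_j`, so the conditions for a sign change become `t =
-- c^{-k} s_j`, one for each of the `2n` factors.
open Classical in
theorem signedConj_mul_pow_apply (i j : B) (n : ℕ) (t : W) (e : ZMod 2) :
    ((cs.signedConj i * cs.signedConj j) ^ n) (t, e) =
      ((cs.simple i * cs.simple j) ^ n * t * ((cs.simple i * cs.simple j) ^ n)⁻¹,
        e + ∑ k ∈ Finset.range (2 * n),
          if t = ((cs.simple i * cs.simple j) ^ k)⁻¹ * cs.simple j then 1 else 0) := by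
  generalize hc : cs.simple i * cs.simple j = c
  have hjc : cs.simple j * c = c⁻¹ * cs.simple j := by simp [← hc, mul_assoc]
  have hcj : ∀ k : ℕ, cs.simple j * c ^ k = (c ^ k)⁻¹ * cs.simple j := by
    intro k
    induction k with
    | zero => simp
    | succ k ih =>
      rw [pow_succ, ← mul_assoc, ih, mul_assoc, hjc, ← mul_assoc, ← mul_inv_rev, ← pow_succ',
        pow_succ]
  induction n with
  | zero => simp
  | succ n ih =>
    rw [pow_succ', Equiv.Perm.mul_apply, ih]
    have h1 : (c ^ n * t * (c ^ n)⁻¹ = cs.simple j) ↔ t = (c ^ (2 * n))⁻¹ * cs.simple j := by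
      rw [mul_inv_eq_iff_eq_mul, hcj, ← eq_inv_mul_iff_mul_eq, ← mul_assoc, ← mul_inv_rev,
        ← pow_add, two_mul]
    have h2 : (cs.simple j * (c ^ n * t * (c ^ n)⁻¹) * cs.simple j = cs.simple i) ↔
        t = (c ^ (2 * n + 1))⁻¹ * cs.simple j := by
      have : ∀ z, cs.simple j * z * cs.simple j = cs.simple i ↔ z = c⁻¹ * cs.simple j := by
        intro z
        rw [← hc, mul_inv_rev, inv_simple, inv_simple]
        constructor
        · intro h; rw [← h]; simp [mul_assoc]
        · intro h; rw [h]; simp [mul_assoc]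
      rw [this, mul_inv_eq_iff_eq_mul, mul_assoc, hcj, ← eq_inv_mul_iff_mul_eq]
      have e : c ^ (2 * n + 1) = c ^ n * c * c ^ n := by
        rw [← pow_succ, ← pow_add]; congr 1; ring
      rw [e, mul_inv_rev, mul_inv_rev]; simp only [mul_assoc]
    rw [show 2 * (n + 1) = 2 * n + 1 + 1 by ring, Finset.sum_range_succ, Finset.sum_range_succ]
    ext
    · simp only [signedConj, Equiv.Perm.mul_apply, Equiv.coe_fn_mk]
      rw [pow_succ', mul_inv_rev, ← hc, mul_inv_rev, inv_simple, inv_simple]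
      simp only [mul_assoc]
    · simp only [signedConj, Equiv.Perm.mul_apply, Equiv.coe_fn_mk, h1, h2, add_assoc]

/-- If `c ^ m = 1`, the sign changes number `k` and `k + m` have the same condition and cancel
modulo 2. -/
theorem isLiftable_signedConj : M.IsLiftable cs.signedConj := by
  classical
  intro i j
  ext1 ⟨t, e⟩
  rw [signedConj_mul_pow_apply, cs.simple_mul_simple_pow, two_mul, Finset.sum_range_add]
  simp only [pow_add, cs.simple_mul_simple_pow, one_mul, inv_one, mul_one,
    CharTwo.add_self_eq_zero, add_zero, Equiv.Perm.coe_one, id]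

/-- The parity of the number of occurrences of `t` in the inversion sequence of a word for `w`. -/
noncomputable def invParity (w t : W) : ZMod 2 :=
  (cs.lift ⟨cs.signedConj, cs.isLiftable_signedConj⟩ w (t, 0)).2

theorem lift_signedConj_apply (w t : W) (e : ZMod 2) :
    cs.lift ⟨cs.signedConj, cs.isLiftable_signedConj⟩ w (t, e) =
      (w * t * w⁻¹, e + cs.invParity w t) := by
  induction w using cs.simple_induction_left generalizing t e with
  | one => simp [invParity]
  | mul_simple_left w i ih =>
    have h0 : cs.invParity (cs.simple i * w) t = cs.invParity w t +
        (cs.signedConj i (w * t * w⁻¹, 0)).2 := by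
      rw [invParity, map_mul, Equiv.Perm.mul_apply, ih, lift_apply_simple]
      simp [signedConj]
    rw [map_mul, Equiv.Perm.mul_apply, ih, lift_apply_simple, h0]
    ext
    · simp [signedConj, mul_assoc]
    · simp [signedConj, add_assoc]

theorem invParity_mul (v w t : W) :
    cs.invParity (v * w) t = cs.invParity w t + cs.invParity v (w * t * w⁻¹) := by
  conv_lhs => rw [invParity, map_mul, Equiv.Perm.mul_apply, lift_signedConj_apply,
    lift_signedConj_apply]
  simp

open Classical in
theorem invParity_simple (i : B) (t : W) :
    cs.invParity (cs.simple i) t = if t = cs.simple i then 1 else 0 := by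
  simp [invParity, lift_apply_simple, signedConj]

theorem invParity_one (t : W) : cs.invParity 1 t = 0 := by simp [invParity]

/-- Write `t = g s g⁻¹`. The cocycle relation for `g g⁻¹ = 1` cancels the contributions of `g` and
`g⁻¹`, leaving that of `s`, which is 1. -/
theorem IsReflection.invParity_self {t : W} (ht : cs.IsReflection t) : cs.invParity t t = 1 := by
  obtain ⟨g, i, rfl⟩ := ht
  have h := cs.invParity_one (g * cs.simple i * g⁻¹)
  rw [← mul_inv_cancel g, invParity_mul] at h
  have e : g⁻¹ * (g * cs.simple i * g⁻¹) * g⁻¹⁻¹ = cs.simple i := by simp [mul_assoc]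
  rw [e] at h
  rw [invParity_mul, e, invParity_mul, invParity_simple, if_pos rfl]
  simp only [mul_assoc, mul_inv_cancel, mul_one]
  simp only [mul_assoc] at h
  rw [add_comm 1, ← add_assoc]
  simp [h]

theorem mem_rightInvSeq_of_invParity_ne_zero (ω : List B) (t : W)
    (h : cs.invParity (cs.wordProd ω) t ≠ 0) : t ∈ cs.rightInvSeq ω := by
  classical
  induction ω with
  | nil => simp [invParity_one] at h
  | cons i ω ih =>
    rw [wordProd_cons, invParity_mul, invParity_simple] at h
    rw [rightInvSeq, List.mem_cons]
    by_cases h' : cs.invParity (cs.wordProd ω) t = 0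
    · left
      by_contra hne
      rw [h', zero_add, if_neg] at h
      · exact h rfl
      · intro h2
        apply hne
        rw [← h2]
        simp [mul_assoc]
    · exact Or.inr (ih h')

/-- Odd parity puts `t` in the inversion sequence of a reduced word of `w`, so `wt` is shorter.
Passing from `w` to `wt` changes the parity at `t`; hence even parity makes `w = (wt)t` shorter than
`wt`. -/
theorem IsReflection.length_mul_lt_iff {t : W} (ht : cs.IsReflection t) (w : W) :
    cs.length (w * t) < cs.length w ↔ cs.invParity w t ≠ 0 := by
  have key : ∀ w, cs.invParity w t ≠ 0 → cs.length (w * t) < cs.length w := by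
    intro w h
    obtain ⟨ω, hω, rfl⟩ := cs.exists_isReduced w
    exact (cs.isRightInversion_of_mem_rightInvSeq hω
      (cs.mem_rightInvSeq_of_invParity_ne_zero ω t h)).2
  refine ⟨fun h h0 => ?_, key w⟩
  have := key (w * t) (by
    rw [invParity_mul, mul_inv_cancel_right, h0, ht.invParity_self]; decide)
  rw [mul_assoc, ht.mul_self, mul_one] at this
  omega

/-- For `s = cs.simple i` one has `wts = (ws)(sts)`, and since `sts ≠ s` the parity of `ws` at `sts`
is that of `w` at `t`. -/
theorem IsReflection.length_mul_simple_lt {t : W} (ht : cs.IsReflection t) {w : W} {i : B}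
    (hne : t ≠ cs.simple i) (h : cs.length w < cs.length (w * t)) :
    cs.length (w * cs.simple i) < cs.length (w * t * cs.simple i) := by
  classical
  have hr : cs.IsReflection (cs.simple i * t * cs.simple i) := by
    simpa using ht.conj (cs.simple i)
  have hi : cs.simple i * (cs.simple i * t * cs.simple i) * (cs.simple i)⁻¹ = t := by
    simp [mul_assoc]
  have h0 : cs.invParity w t = 0 := by
    by_contra h0
    have := (IsReflection.length_mul_lt_iff cs ht w).2 h0
    omega
  have h1 : cs.invParity (w * cs.simple i) (cs.simple i * t * cs.simple i) = 0 := by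
    rw [invParity_mul, hi, h0, add_zero, invParity_simple, if_neg]
    intro h2
    apply hne
    rw [← hi, h2]
    simp
  have h2 := mt (IsReflection.length_mul_lt_iff cs hr (w * cs.simple i)).1 (not_not.2 h1)
  have h3 := hr.length_mul_left_ne (w * cs.simple i)
  have h4 : w * cs.simple i * (cs.simple i * t * cs.simple i) = w * t * cs.simple i := by
    simp [mul_assoc]
  rw [h4] at h2 h3
  omega

end CoxeterSystem

/-! ### The lifting property of the Bruhat order -/

theorem bruhatLE_mul_simple_or (w : W) (i : B) :
    BruhatLE cs w (w * cs.simple i) ∨ BruhatLE cs (w * cs.simple i) w := by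
  rcases lt_or_gt_of_ne (cs.length_mul_simple_ne w i) with h | h
  · exact Or.inr (.single ⟨cs.simple i, cs.isReflection_simple i, by simp, h⟩)
  · exact Or.inl (.single ⟨cs.simple i, cs.isReflection_simple i, rfl, h⟩)

variable {cs}

theorem bruhatPhi_of_le {w : W} {i : B} (h : BruhatLE cs w (w * cs.simple i)) :
    bruhatPhi cs i w = w := if_pos h

theorem bruhatPhi_of_ge {w : W} {i : B} (h : BruhatLE cs (w * cs.simple i) w) :
    bruhatPhi cs i w = w * cs.simple i := by
  refine if_neg fun h' => cs.length_mul_simple_ne w i ?_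
  rw [h.antisymm h']

theorem bruhatPhi_cases (w : W) (i : B) :
    (bruhatPhi cs i w = w ∧ BruhatLE cs w (w * cs.simple i)) ∨
      (bruhatPhi cs i w = w * cs.simple i ∧ BruhatLE cs (w * cs.simple i) w) :=
  (bruhatLE_mul_simple_or cs w i).imp (fun h => ⟨bruhatPhi_of_le h, h⟩)
    fun h => ⟨bruhatPhi_of_ge h, h⟩

theorem bruhatPhi_le (w : W) (i : B) : BruhatLE cs (bruhatPhi cs i w) w := by
  rcases bruhatPhi_cases (cs := cs) w i with ⟨h, -⟩ | ⟨h, h'⟩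
  · rw [h]; exact .refl
  · rwa [h]

theorem bruhatPhi_mul_simple (w : W) (i : B) :
    bruhatPhi cs i (w * cs.simple i) = bruhatPhi cs i w := by
  rcases bruhatPhi_cases (cs := cs) w i with ⟨h, h'⟩ | ⟨h, h'⟩
  · rw [h, bruhatPhi_of_ge (by simpa using h')]
    simp
  · rw [h, bruhatPhi_of_le]
    rwa [CoxeterSystem.simple_mul_simple_cancel_right]

theorem le_bruhatPhi_mul_simple (w : W) (i : B) :
    BruhatLE cs w (bruhatPhi cs i w * cs.simple i) := by
  rcases bruhatPhi_cases (cs := cs) w i with ⟨h, h'⟩ | ⟨h, -⟩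
  · rwa [h]
  · rw [h, CoxeterSystem.simple_mul_simple_cancel_right]; exact .refl

theorem BruhatStep.mul_simple {v w : W} (i : B) (h : BruhatStep cs v w) :
    w = v * cs.simple i ∨ BruhatStep cs (v * cs.simple i) (w * cs.simple i) := by
  obtain ⟨t, ht, rfl, hl⟩ := h
  by_cases hne : t = cs.simple i
  · exact Or.inl (by rw [hne])
  · exact Or.inr ⟨cs.simple i * t * cs.simple i, by simpa using ht.conj (cs.simple i),
      by simp [mul_assoc], CoxeterSystem.IsReflection.length_mul_simple_lt cs ht hne hl⟩

/-- `Φ(w)` is the smaller and `Φ(w)a` the larger element of `{w, wa}`. Unless `w = va`, both `v < w`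
and `va < wa` are steps, so minima and maxima compare. -/
theorem bruhatPhi_mono_step {v w : W} (i : B) (h : BruhatStep cs v w) :
    BruhatLE cs (bruhatPhi cs i v) (bruhatPhi cs i w) ∧
      BruhatLE cs (bruhatPhi cs i v * cs.simple i) (bruhatPhi cs i w * cs.simple i) := by
  rcases h.mul_simple i with rfl | h'
  · rw [bruhatPhi_mul_simple]
    exact ⟨.refl, .refl⟩
  constructor
  · rcases bruhatPhi_cases (cs := cs) w i with ⟨hw, -⟩ | ⟨hw, -⟩
    · rw [hw]; exact (bruhatPhi_le v i).tail h
    · rw [hw, ← bruhatPhi_mul_simple]; exact (bruhatPhi_le _ i).tail h'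
  · have h1 := le_bruhatPhi_mul_simple (cs := cs) w i
    have h2 := le_bruhatPhi_mul_simple (cs := cs) (w * cs.simple i) i
    rw [bruhatPhi_mul_simple] at h2
    rcases bruhatPhi_cases (cs := cs) v i with ⟨hv, -⟩ | ⟨hv, -⟩
    · rw [hv]; exact h2.head h'
    · rw [hv, CoxeterSystem.simple_mul_simple_cancel_right]; exact h1.head h

theorem bruhatPhi_mono {v w : W} (i : B) (h : BruhatLE cs v w) :
    BruhatLE cs (bruhatPhi cs i v) (bruhatPhi cs i w) ∧
      BruhatLE cs (bruhatPhi cs i v * cs.simple i) (bruhatPhi cs i w * cs.simple i) := by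
  induction h with
  | refl => exact ⟨.refl, .refl⟩
  | tail _ h ih =>
    exact ⟨ih.1.trans (bruhatPhi_mono_step i h).1, ih.2.trans (bruhatPhi_mono_step i h).2⟩

/-! ### The intervals below `u` and below `ua` -/

section Interval

variable {u : W} {i : B}

theorem bruhatPhi_le_of_le_mul_simple (hu : BruhatLE cs u (u * cs.simple i)) {v : W}
    (hv : BruhatLE cs v (u * cs.simple i)) : BruhatLE cs (bruhatPhi cs i v) u := by
  have := (bruhatPhi_mono i hv).1
  rwa [bruhatPhi_mul_simple, bruhatPhi_of_le hu] at this

theorem bruhatPhi_of_not_le (hu : BruhatLE cs u (u * cs.simple i)) {v : W}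
    (hv : BruhatLE cs v (u * cs.simple i)) (hvu : ¬ BruhatLE cs v u) :
    bruhatPhi cs i v = v * cs.simple i ∧ BruhatLE cs (v * cs.simple i) v := by
  rcases bruhatPhi_cases (cs := cs) v i with ⟨h, -⟩ | h
  · exact absurd (h ▸ bruhatPhi_le_of_le_mul_simple hu hv) hvu
  · exact h

/-- With `le_of_mem_bruhatW3` this matches, through right multiplication by `a`, the new elements of
the larger interval with `W₃`. -/
theorem mul_simple_mem_bruhatW3 (hu : BruhatLE cs u (u * cs.simple i)) {v : W}
    (hv : BruhatLE cs v (u * cs.simple i)) (hvu : ¬ BruhatLE cs v u) :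
    v * cs.simple i ∈ bruhatW3 cs u i :=
  ⟨(bruhatPhi_of_not_le hu hv hvu).2.trans hv, by simpa using hvu⟩

theorem le_of_mem_bruhatW3 (hu : BruhatLE cs u (u * cs.simple i)) {w : W}
    (hw : w ∈ bruhatW3 cs u i) :
    bruhatPhi cs i w = w ∧ BruhatLE cs w u ∧
      BruhatLE cs (w * cs.simple i) (u * cs.simple i) := by
  have h := bruhatPhi_le_of_le_mul_simple hu hw.1
  rcases bruhatPhi_cases (cs := cs) w i with ⟨h1, -⟩ | ⟨h1, -⟩
  · rw [h1] at h
    refine ⟨h1, h, ?_⟩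
    have := (bruhatPhi_mono i h).2
    rwa [h1, bruhatPhi_of_le hu] at this
  · exact absurd (h1 ▸ h) hw.2

theorem mem_bruhatW_of_le (hu : BruhatLE cs u (u * cs.simple i)) {w : W} (hw : BruhatLE cs w u) :
    w ∈ bruhatW1 cs u i ∪ bruhatW2 cs u i ∨ w ∈ bruhatW3 cs u i := by
  by_cases h : BruhatLE cs (w * cs.simple i) u
  · left
    rcases bruhatLE_mul_simple_or cs w i with h' | h'
    · exact Or.inr ⟨hw.trans hu, h', h⟩
    · exact Or.inl ⟨hw.trans hu, h', hw⟩
  · exact Or.inr ⟨hw.trans hu, h⟩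

/-- Monotonicity of the minimum of `{w, wa}` gives one direction, monotonicity of the maximum the
other. -/
theorem le_iff_bruhatPhi_le {v w : W} (hv : BruhatLE cs (v * cs.simple i) v) :
    BruhatLE cs w v ↔ BruhatLE cs (bruhatPhi cs i w) (v * cs.simple i) := by
  constructor
  · intro h
    have := (bruhatPhi_mono i h).1
    rwa [bruhatPhi_of_ge hv] at this
  · intro h
    have h1 := (bruhatPhi_mono i h).2
    have h2 : bruhatPhi cs i (bruhatPhi cs i w) = bruhatPhi cs i w := by
      rcases bruhatPhi_cases (cs := cs) w i with ⟨h, -⟩ | ⟨h, -⟩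
      · rw [h, h]
      · rw [h, bruhatPhi_mul_simple, h]
    rw [h2, bruhatPhi_mul_simple, bruhatPhi_of_ge hv,
      CoxeterSystem.simple_mul_simple_cancel_right] at h1
    exact (le_bruhatPhi_mul_simple w i).trans h1

end Interval

end BruhatLifting

/-! ### Coefficients and degrees in the Ore extension -/

namespace CauchonExtension

variable {k H R S : Type*} [Field k] [CommGroup H] [Ring R] [Algebra k R]
    [Ring S] [Algebra k S] [MulSemiringAction H R] [MulSemiringAction H S]
    (E : CauchonExtension k H R S)

/-- The additive equivalence between an Ore extension and the finitely supported sequences of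
left coefficients. -/
noncomputable def coeffs : S ≃+ (ℕ →₀ R) :=
  (AddEquiv.ofBijective (Finsupp.liftAddHom fun n =>
    (AddMonoidHom.mulRight (E.x ^ n)).comp (E.incl : R →+ S)) E.bijective_sum).symm

/-- The left coefficient of `x ^ n`. -/
noncomputable def coeff (n : ℕ) : S →+ R := (Finsupp.applyAddHom n).comp E.coeffs.toAddMonoidHom

theorem coeffs_symm_apply (p : ℕ →₀ R) :
    E.coeffs.symm p = p.sum fun n r => E.incl r * E.x ^ n := rfl

theorem coeffs_apply (s : S) (n : ℕ) : E.coeffs s n = E.coeff n s := rfl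

theorem coeffs_monomial (r : R) (n : ℕ) :
    E.coeffs (E.incl r * E.x ^ n) = Finsupp.single n r := by
  rw [← AddEquiv.eq_symm_apply, coeffs_symm_apply, Finsupp.sum_single_index (by simp)]

theorem coeff_monomial (r : R) (n m : ℕ) :
    E.coeff m (E.incl r * E.x ^ n) = if n = m then r else 0 := by
  rw [← coeffs_apply, coeffs_monomial, Finsupp.single_apply]

theorem coeff_incl (r : R) (m : ℕ) : E.coeff m (E.incl r) = if 0 = m then r else 0 := by
  simpa using E.coeff_monomial r 0 m

variable {E} in
theorem ext_coeff {s t : S} (h : ∀ n, E.coeff n s = E.coeff n t) : s = t :=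
  E.coeffs.injective (Finsupp.ext h)

theorem eq_sum_coeff {s : S} {n : ℕ} (h : ∀ i, n ≤ i → E.coeff i s = 0) :
    s = ∑ i ∈ Finset.range n, E.incl (E.coeff i s) * E.x ^ i := by
  refine ext_coeff (E := E) fun m => ?_
  simp only [map_sum, coeff_monomial, Finset.sum_ite_eq', Finset.mem_range]
  split_ifs with hm
  · rfl
  · exact h m (not_lt.1 hm)

theorem exists_coeff_eq_zero (s : S) : ∃ n, ∀ i, n ≤ i → E.coeff i s = 0 := by
  refine ⟨(E.coeffs s).support.sup id + 1, fun i hi => ?_⟩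
  by_contra h
  have := Finset.le_sup (f := id) (Finsupp.mem_support_iff.2 h : i ∈ (E.coeffs s).support)
  simp only [id] at this
  omega

@[elab_as_elim]
theorem monomial_induction {p : S → Prop} (s : S) (zero : p 0)
    (add : ∀ s t, p s → p t → p (s + t)) (monomial : ∀ r n, p (E.incl r * E.x ^ n)) : p s := by
  obtain ⟨n, hn⟩ := E.exists_coeff_eq_zero s
  rw [E.eq_sum_coeff hn]
  exact Finset.sum_induction _ p (fun a b => add a b) zero fun i _ => monomial _ _

@[elab_as_elim]
theorem generator_induction {p : S → Prop} (s : S) (incl : ∀ r, p (E.incl r)) (x : p E.x)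
    (add : ∀ s t, p s → p t → p (s + t)) (mul : ∀ s t, p s → p t → p (s * t)) : p s := by
  refine E.monomial_induction s (by simpa using incl 0) add fun r n => mul _ _ (incl r) ?_
  induction n with
  | zero => simpa using incl 1
  | succ n ih => rw [pow_succ]; exact mul _ _ ih x

theorem coeff_incl_mul (r : R) (s : S) (m : ℕ) :
    E.coeff m (E.incl r * s) = r * E.coeff m s := by
  refine E.monomial_induction s (by simp) (fun s t hs ht => ?_) fun r' n => ?_
  · rw [mul_add, map_add, map_add, hs, ht, mul_add]
  · rw [← mul_assoc, ← map_mul, coeff_monomial, coeff_monomial]; split_ifs <;> simp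

theorem coeff_mul_pow (s : S) (m n : ℕ) :
    E.coeff m (s * E.x ^ n) = if n ≤ m then E.coeff (m - n) s else 0 := by
  refine E.monomial_induction s (by simp) (fun s t hs ht => ?_) fun r' i => ?_
  · rw [add_mul, map_add, hs, ht, map_add]; split_ifs <;> simp
  · rw [mul_assoc, ← pow_add, coeff_monomial, coeff_monomial]
    split_ifs <;> first | rfl | omega

theorem coeff_x_mul_zero (s : S) : E.coeff 0 (E.x * s) = E.δ (E.coeff 0 s) := by
  refine E.monomial_induction s (by simp) (fun s t hs ht => ?_) fun r' i => ?_
  · rw [mul_add, map_add, hs, ht, map_add, map_add]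
  · rw [← mul_assoc, E.x_mul, add_mul, mul_assoc, ← pow_succ', map_add, coeff_monomial,
      coeff_monomial, coeff_monomial]
    split_ifs <;> first | contradiction | omega | simp

theorem coeff_x_mul_succ (s : S) (m : ℕ) :
    E.coeff (m + 1) (E.x * s) = E.τ (E.coeff m s) + E.δ (E.coeff (m + 1) s) := by
  refine E.monomial_induction s (by simp) (fun s t hs ht => ?_) fun r' i => ?_
  · rw [mul_add, map_add, hs, ht, map_add, map_add, map_add, map_add]; abel
  · rw [← mul_assoc, E.x_mul, add_mul, mul_assoc, ← pow_succ', map_add, coeff_monomial,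
      coeff_monomial, coeff_monomial, coeff_monomial]
    split_ifs <;> first | contradiction | omega | simp

theorem x_mul_cancel {s : S} (h : E.x * s = 0) : s = 0 := by
  obtain ⟨n, hn⟩ := E.exists_coeff_eq_zero s
  induction n with
  | zero => exact ext_coeff (E := E) fun m => by rw [hn m (Nat.zero_le _), map_zero]
  | succ n ih =>
    refine ih fun i hi => ?_
    rcases hi.eq_or_lt with rfl | hi
    · have := E.coeff_x_mul_succ s n
      rw [h, hn (n + 1) le_rfl, map_zero, map_zero, add_zero] at this
      exact (map_eq_zero_iff E.τ E.τ.injective).1 this.symm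
    · exact hn i hi

/-- The elements of degree less than `n`. -/
def degreeLT (n : ℕ) : AddSubgroup S where
  carrier := {s | ∀ i, n ≤ i → E.coeff i s = 0}
  zero_mem' := by simp
  add_mem' hs ht i hi := by rw [map_add, hs i hi, ht i hi, add_zero]
  neg_mem' hs i hi := by rw [map_neg, hs i hi, neg_zero]

theorem degreeLT_mono {m n : ℕ} (h : m ≤ n) : E.degreeLT m ≤ E.degreeLT n :=
  fun _ hs i hi => hs i (h.trans hi)

theorem monomial_mem_degreeLT (r : R) {m n : ℕ} (h : m < n) :
    E.incl r * E.x ^ m ∈ E.degreeLT n := fun i hi => by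
  rw [coeff_monomial, if_neg (by omega)]

theorem mul_pow_mem_degreeLT {s : S} {m : ℕ} (hs : s ∈ E.degreeLT m) (n : ℕ) :
    s * E.x ^ n ∈ E.degreeLT (m + n) := fun i hi => by
  rw [coeff_mul_pow, if_pos (by omega), hs _ (by omega)]

theorem incl_mul_mem_degreeLT {s : S} {m : ℕ} (r : R) (hs : s ∈ E.degreeLT m) :
    E.incl r * s ∈ E.degreeLT m := fun i hi => by
  rw [coeff_incl_mul, hs _ hi, mul_zero]

theorem x_mul_mem_degreeLT {s : S} {m : ℕ} (hs : s ∈ E.degreeLT m) :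
    E.x * s ∈ E.degreeLT (m + 1) := fun i hi => by
  obtain ⟨j, rfl⟩ : ∃ j, i = j + 1 := ⟨i - 1, by omega⟩
  rw [coeff_x_mul_succ, hs _ (by omega), hs _ (by omega), map_zero, map_zero, add_zero]

theorem mem_degreeLT_of_coeff_eq {s : S} {n : ℕ} {r : R} (hs : s ∈ E.degreeLT (n + 1))
    (h : E.coeff n s = r) : s - E.incl r * E.x ^ n ∈ E.degreeLT n := fun i hi => by
  rw [map_sub, coeff_monomial]
  rcases hi.eq_or_lt with rfl | hi
  · simp [h]
  · rw [hs i hi, if_neg (by omega), sub_zero]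

theorem pow_mul_incl_sub_mem (n : ℕ) (r : R) :
    E.x ^ n * E.incl r - E.incl (E.τ^[n] r) * E.x ^ n ∈ E.degreeLT n := by
  induction n with
  | zero => simp
  | succ n ih =>
    have : E.x ^ (n + 1) * E.incl r - E.incl (E.τ^[n + 1] r) * E.x ^ (n + 1) =
        E.x * (E.x ^ n * E.incl r - E.incl (E.τ^[n] r) * E.x ^ n) +
          E.incl (E.δ (E.τ^[n] r)) * E.x ^ n := by
      rw [mul_sub, ← mul_assoc, ← mul_assoc, ← pow_succ', E.x_mul, add_mul, mul_assoc _ E.x,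
        ← pow_succ', Function.iterate_succ_apply']
      abel
    rw [this]
    exact add_mem (E.x_mul_mem_degreeLT ih) (E.monomial_mem_degreeLT _ (Nat.lt_succ_self n))

theorem mul_incl_mem_degreeLT {s : S} {m : ℕ} (r : R) (hs : s ∈ E.degreeLT m) :
    s * E.incl r ∈ E.degreeLT m := by
  rw [E.eq_sum_coeff hs, Finset.sum_mul]
  refine sum_mem fun i hi => ?_
  rw [mul_assoc]
  refine E.incl_mul_mem_degreeLT _ ?_
  rw [← sub_add_cancel (E.x ^ i * E.incl r) (E.incl (E.τ^[i] r) * E.x ^ i)]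
  exact add_mem (E.degreeLT_mono (Finset.mem_range.1 hi).le (E.pow_mul_incl_sub_mem i r))
    (E.monomial_mem_degreeLT _ (Finset.mem_range.1 hi))

/-- Modulo lower degree `x ^ n` moves past `r` at the price of `τ ^ n`; this twist is harmless for
leading coefficients because `τ` is bijective. -/
theorem coeff_mul_incl_of_mem_degreeLT {s : S} {n : ℕ} (hs : s ∈ E.degreeLT (n + 1)) (r : R) :
    E.coeff n (s * E.incl r) = E.coeff n s * E.τ^[n] r := by
  have h := E.mem_degreeLT_of_coeff_eq hs rfl
  have e : s * E.incl r = (s - E.incl (E.coeff n s) * E.x ^ n) * E.incl r +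
      E.incl (E.coeff n s) * (E.x ^ n * E.incl r - E.incl (E.τ^[n] r) * E.x ^ n) +
        E.incl (E.coeff n s * E.τ^[n] r) * E.x ^ n := by
    rw [map_mul]; noncomm_ring
  conv_lhs => rw [e]
  rw [map_add, map_add, E.mul_incl_mem_degreeLT r h n le_rfl,
    E.incl_mul_mem_degreeLT _ (E.pow_mul_incl_sub_mem n r) n le_rfl, coeff_monomial, if_pos rfl,
    zero_add, zero_add]

/-- The leading coefficients of the elements of degree at most `n` of a right ideal `T` of the Ore
extension, as a left ideal of `Rᵐᵒᵖ`. -/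
def leadingIdeal (T : AddSubgroup S) (hT : ∀ s ∈ T, ∀ t, s * t ∈ T) (n : ℕ) : Ideal Rᵐᵒᵖ where
  carrier := {r | ∃ s ∈ T, s ∈ E.degreeLT (n + 1) ∧ E.coeff n s = r.unop}
  zero_mem' := ⟨0, zero_mem _, zero_mem _, by simp⟩
  add_mem' := by
    rintro a b ⟨s, hs, hs', hsa⟩ ⟨t, ht, ht', htb⟩
    exact ⟨s + t, add_mem hs ht, add_mem hs' ht', by rw [map_add, hsa, htb, MulOpposite.unop_add]⟩
  smul_mem' := by
    rintro c a ⟨s, hs, hs', hsa⟩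
    -- Right multiplication twists the leading coefficient by `τ ^ n`, so the multiplier is
    -- untwisted beforehand.
    set r := (E.τ.symm)^[n] c.unop
    have hr : E.τ^[n] r = c.unop :=
      (Function.LeftInverse.iterate E.τ.apply_symm_apply n) c.unop
    refine ⟨s * E.incl r, hT _ hs _, E.mul_incl_mem_degreeLT _ hs', ?_⟩
    rw [E.coeff_mul_incl_of_mem_degreeLT hs', hsa, hr]
    simp

theorem leadingIdeal_mono {T T' : AddSubgroup S} (hT hT') (h : T ≤ T') {m n : ℕ} (hmn : m ≤ n) :
    E.leadingIdeal T hT m ≤ E.leadingIdeal T' hT' n := by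
  rintro r ⟨s, hs, hs', hr⟩
  obtain ⟨d, rfl⟩ := Nat.exists_eq_add_of_le hmn
  refine ⟨s * E.x ^ d, hT' _ (h hs) _, ?_, ?_⟩
  · have := E.mul_pow_mem_degreeLT hs' d
    rwa [add_right_comm] at this
  · rw [coeff_mul_pow, if_pos (by omega), Nat.add_sub_cancel, hr]

/-- Subtracting an element of `T` with the same leading coefficient lowers the degree. -/
theorem le_of_leadingIdeal_le {T T' : AddSubgroup S} (hT hT') (hle : T ≤ T')
    (h : ∀ n, E.leadingIdeal T' hT' n ≤ E.leadingIdeal T hT n) : T' ≤ T := by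
  have key : ∀ n, ∀ s ∈ T', s ∈ E.degreeLT n → s ∈ T := by
    intro n
    induction n with
    | zero =>
      intro s _ hs'
      have : s = 0 := ext_coeff (E := E) fun m => by rw [hs' m (Nat.zero_le _), map_zero]
      rw [this]; exact zero_mem _
    | succ n ih =>
      intro s hs hs'
      obtain ⟨t, ht, ht', htr⟩ := h n (show MulOpposite.op (E.coeff n s) ∈ _ from ⟨s, hs, hs', rfl⟩)
      have := ih (s - t) (sub_mem hs (hle ht)) fun i hi => by
        rcases hi.eq_or_lt with rfl | hi
        · rw [map_sub, htr]; simp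
        · exact sub_mem hs' ht' i hi
      simpa using add_mem this ht
  intro s hs
  obtain ⟨n, hn⟩ := E.exists_coeff_eq_zero s
  exact key n s hs hn

/-- The Hilbert basis theorem for Ore extensions: ascending chains of right ideals stabilize. -/
theorem exists_stable_right_ideal (E : CauchonExtension k H R S) (T : ℕ → AddSubgroup S)
    (hT : ∀ n, ∀ s ∈ T n, ∀ t, s * t ∈ T n)
    (hmono : Monotone T) : ∃ N, ∀ n, T n ≤ T N := by
  have := E.noetherian_right
  have stab := fun f : ℕ →o Ideal Rᵐᵒᵖ =>
    (monotone_stabilizes_iff_noetherian (R := Rᵐᵒᵖ) (M := Rᵐᵒᵖ)).2 inferInstance f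
  -- The diagonal chain controls all degrees at least `N` at once; the finitely many smaller degrees
  -- `i` stabilize separately, at `f i`.
  obtain ⟨N, hN⟩ := stab ⟨fun n => E.leadingIdeal (T n) (hT n) n,
    fun m n h => E.leadingIdeal_mono _ _ (hmono h) h⟩
  choose f hf using fun i => stab ⟨fun n => E.leadingIdeal (T n) (hT n) i,
    fun m n h => E.leadingIdeal_mono _ _ (hmono h) le_rfl⟩
  refine ⟨max N ((Finset.range N).sup f), fun n => ?_⟩
  set K := max N ((Finset.range N).sup f)
  rcases le_total n K with h | h
  · exact hmono h
  refine E.le_of_leadingIdeal_le (hT K) (hT n) (hmono h) fun i => ?_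
  rcases lt_or_ge i N with hi | hi
  · have hK : f i ≤ K := (Finset.le_sup (Finset.mem_range.2 hi)).trans (le_max_right _ _)
    exact ((hf i n (hK.trans h)).symm.trans (hf i K hK)).le
  · set m := max i n
    have hNK : N ≤ K := le_max_left _ _
    calc E.leadingIdeal (T n) (hT n) i ≤ E.leadingIdeal (T m) (hT m) m :=
          E.leadingIdeal_mono _ _ (hmono (le_max_right _ _)) (le_max_left _ _)
      _ = E.leadingIdeal (T N) (hT N) N := (hN m (hi.trans (le_max_left _ _))).symm
      _ ≤ E.leadingIdeal (T K) (hT K) i := E.leadingIdeal_mono _ _ (hmono hNK) hi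

/-! ### The coefficients of the derivation-deleting map -/

/-- The coefficient `q_l δ^l τ^{-l}` of `x ^ (-l)` in the derivation-deleting map. -/
noncomputable def deletingCoeff (l : ℕ) : R →ₗ[k] R :=
  E.qCoeff l • (E.δ ^ l * (E.τ.symm.toLinearMap : R →ₗ[k] R) ^ l)

theorem deletingCoeff_apply (l : ℕ) (r : R) :
    E.deletingCoeff l r = E.qCoeff l • (E.δ^[l]) ((E.τ.symm^[l]) r) := by
  simp only [deletingCoeff, LinearMap.smul_apply, Module.End.mul_apply, Module.End.pow_apply]
  rfl

theorem iterate_δ_comm (n : ℕ) (r : R) : E.δ^[n] (E.τ r) = E.q ^ n • E.τ (E.δ^[n] r) := by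
  induction n with
  | zero => simp
  | succ n ih =>
    rw [Function.iterate_succ_apply', ih, map_smul, E.δ_τ, smul_smul,
      Function.iterate_succ_apply', pow_succ]

theorem q_sub_one_ne_zero : E.q - 1 ≠ 0 := by
  have := E.q_not_root 1 one_pos
  rw [pow_one] at this
  exact sub_ne_zero.2 this

theorem q_pow_sub_one_ne_zero (l : ℕ) : E.q ^ (l + 1) - 1 ≠ 0 :=
  sub_ne_zero.2 (E.q_not_root (l + 1) l.succ_pos)

theorem qCoeff_zero : E.qCoeff 0 = 1 := by simp [qCoeff]

theorem qCoeff_succ (l : ℕ) :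
    (E.q ^ (l + 1) - 1) * E.qCoeff (l + 1) = E.q ^ (l + 1) * E.qCoeff l := by
  have h : (∑ i ∈ Finset.range (l + 1), E.q ^ i) * (E.q - 1) = E.q ^ (l + 1) - 1 :=
    geom_sum_mul _ _
  have h1 := E.q_sub_one_ne_zero
  have h2 := E.q_pow_sub_one_ne_zero l
  have h3 : ∑ i ∈ Finset.range (l + 1), E.q ^ i ≠ 0 := fun h0 => h2 (by rw [← h, h0, zero_mul])
  have h4 : (l + 1) * (l + 1 + 1) / 2 = l * (l + 1) / 2 + (l + 1) := by
    rw [show (l + 1) * (l + 1 + 1) = l * (l + 1) + (l + 1) * 2 by ring,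
      Nat.add_mul_div_right _ _ two_pos]
  rw [qCoeff, qCoeff, Finset.prod_Icc_succ_top (by omega), h4, ← h, pow_succ (E.q - 1)⁻¹, pow_add]
  generalize ∏ j ∈ Finset.Icc 1 l, ∑ i ∈ Finset.range j, E.q ^ i = D
  generalize ∑ i ∈ Finset.range (l + 1), E.q ^ i = s at h3 ⊢
  generalize (E.q - 1)⁻¹ ^ l = t
  rw [div_eq_mul_inv, div_eq_mul_inv, mul_inv]
  field_simp

theorem deletingCoeff_zero (r : R) : E.deletingCoeff 0 r = r := by
  simp [deletingCoeff_apply, qCoeff_zero]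

theorem deletingCoeff_τ (l : ℕ) (r : R) :
    E.deletingCoeff l (E.τ r) = E.q ^ l • E.τ (E.deletingCoeff l r) := by
  rw [deletingCoeff_apply, deletingCoeff_apply, map_smul, smul_comm, ← iterate_δ_comm]
  congr 2
  exact (Function.Commute.iterate_left (f := E.τ.symm) (g := E.τ)
    (fun r => by simp) l) r

/-- Moving `τ` out of `δ^(l+1)` costs `q^(l+1)`, and the recursion `qCoeff_succ` absorbs this
factor. The commutation and product rules for `C` follow from this identity. -/
theorem δ_deletingCoeff (l : ℕ) (r : R) :
    E.δ (E.deletingCoeff l r) = (E.q ^ (l + 1) - 1) • E.τ (E.deletingCoeff (l + 1) r) := by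
  rw [deletingCoeff_apply, deletingCoeff_apply, map_smul, map_smul, smul_smul, qCoeff_succ,
    mul_comm, mul_smul, ← iterate_δ_comm, ← Function.iterate_succ_apply' E.δ]
  congr 2
  rw [Function.iterate_succ_apply' E.τ.symm, E.τ.apply_symm_apply]

/-- This compares the coefficients of `x^{-l}` in `x C(r)` and `C(τ r) x`. -/
theorem deletingCoeff_τ_eq (l : ℕ) (r : R) :
    E.deletingCoeff (l + 1) (E.τ r) =
      E.τ (E.deletingCoeff (l + 1) r) + E.δ (E.deletingCoeff l r) := by
  rw [deletingCoeff_τ, δ_deletingCoeff, sub_smul, one_smul]; abel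

/-- Coefficientwise form of `C(rs) = C(r) C(s)`. Applying `δ` to the rule in degree `n` gives the
rule in degree `n + 1` up to `τ` and the nonzero scalar `q^(n+1) - 1`. -/
theorem deletingCoeff_mul (n : ℕ) (r s : R) :
    E.deletingCoeff n (r * s) = ∑ p ∈ Finset.HasAntidiagonal.antidiagonal n,
      E.deletingCoeff p.1 r * E.deletingCoeff p.2 (E.τ.symm^[p.1] s) := by
  induction n with
  | zero => simp [deletingCoeff_zero]
  | succ n ih =>
    apply E.τ.injective
    apply (smul_right_injective R (E.q_pow_sub_one_ne_zero n))
    simp only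
    rw [← δ_deletingCoeff, ih, map_sum]
    have h1 : ∀ p ∈ Finset.HasAntidiagonal.antidiagonal n,
        E.δ (E.deletingCoeff p.1 r * E.deletingCoeff p.2 (E.τ.symm^[p.1] s)) =
          (E.q ^ (p.2 + 1) - 1) • E.τ (E.deletingCoeff p.1 r *
            E.deletingCoeff (p.2 + 1) (E.τ.symm^[p.1] s)) +
          (E.q ^ p.2 * (E.q ^ (p.1 + 1) - 1)) • E.τ (E.deletingCoeff (p.1 + 1) r *
            E.deletingCoeff p.2 (E.τ.symm^[p.1 + 1] s)) := by
      intro p _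
      have h2 : E.deletingCoeff p.2 (E.τ.symm^[p.1] s) =
          E.q ^ p.2 • E.τ (E.deletingCoeff p.2 (E.τ.symm^[p.1 + 1] s)) := by
        rw [← deletingCoeff_τ, Function.iterate_succ_apply' E.τ.symm, E.τ.apply_symm_apply]
      rw [E.δ_mul, δ_deletingCoeff, δ_deletingCoeff, h2, ← h2, map_mul, map_mul, mul_smul_comm, h2,
        smul_mul_smul_comm, mul_comm (E.q ^ p.2)]
    rw [Finset.sum_congr rfl h1, Finset.sum_add_distrib, map_sum, Finset.smul_sum]
    set F : ℕ × ℕ → R := fun p => E.τ (E.deletingCoeff p.1 r *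
      E.deletingCoeff p.2 (E.τ.symm^[p.1] s)) with hF
    -- The boundary terms have weight 0, so both sums extend to the antidiagonal of `n + 1`. There
    -- the weights add up: `(q^j - 1) + q^j (q^i - 1) = q^(i+j) - 1`.
    have e1 := Finset.Nat.sum_antidiagonal_succ' (n := n)
      (f := fun p : ℕ × ℕ => (E.q ^ p.2 - 1) • F p)
    have e2 := Finset.Nat.sum_antidiagonal_succ (n := n)
      (f := fun p : ℕ × ℕ => (E.q ^ p.2 * (E.q ^ p.1 - 1)) • F p)
    simp only [pow_zero, sub_self, zero_smul, mul_zero, zero_add] at e1 e2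
    rw [← e1, ← e2, ← Finset.sum_add_distrib]
    refine Finset.sum_congr rfl fun p hp => ?_
    rw [← add_smul, ← Finset.HasAntidiagonal.mem_antidiagonal.1 hp, pow_add]
    congr 1
    ring

theorem iterate_δ_τ_symm {n : ℕ} {r : R} (hn : E.δ^[n] r = 0) (j : ℕ) :
    E.δ^[n] (E.τ.symm^[j] r) = 0 := by
  induction j with
  | zero => exact hn
  | succ j ih =>
    have h := E.iterate_δ_comm n (E.τ.symm^[j + 1] r)
    rw [Function.iterate_succ_apply' E.τ.symm, E.τ.apply_symm_apply, ih] at h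
    have h2 := (smul_eq_zero.1 h.symm).resolve_left (pow_ne_zero _ E.q_ne_zero)
    rw [Function.iterate_succ_apply' E.τ.symm]
    exact (map_eq_zero_iff E.τ E.τ.injective).1 h2

/-- The bound is uniform in `j` because products involve the coefficients of all `τ^{-j}(r)`. -/
theorem exists_deletingCoeff_eq_zero (r : R) :
    ∃ n, ∀ m (j : ℕ), n ≤ m → E.deletingCoeff m (E.τ.symm^[j] r) = 0 := by
  obtain ⟨n, hn⟩ := E.δ_locally_nilpotent r
  refine ⟨n, fun m j hm => ?_⟩
  have key := E.iterate_δ_τ_symm hn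
  obtain ⟨d, rfl⟩ := Nat.exists_eq_add_of_le' hm
  rw [deletingCoeff_apply, Function.iterate_add_apply E.δ, ← Function.iterate_add_apply E.τ.symm,
    key]
  have h0 : E.δ^[d] (0 : R) = 0 := Function.iterate_fixed (map_zero E.δ) d
  rw [h0, smul_zero]

/-! ### The localization -/

theorem toLoc_injective : Function.Injective E.toLoc := by
  refine OreLocalization.numeratorHom_inj ?_
  rintro _ ⟨n, rfl⟩
  rw [mem_nonZeroDivisorsLeft_iff]
  intro s hs
  dsimp only at hs
  induction n with
  | zero => simpa using hs
  | succ n ih => rw [pow_succ', mul_assoc] at hs; exact ih (E.x_mul_cancel hs)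

/-- The Ore variable as a unit of the localization. -/
noncomputable def xUnit : (E.Loc)ˣ :=
  OreLocalization.numeratorUnit (⟨E.x, 1, pow_one _⟩ : Submonoid.powers E.x)

theorem coe_xUnit : (E.xUnit : E.Loc) = E.toLoc E.x := rfl

theorem coe_xUnit_inv : ((E.xUnit⁻¹ : (E.Loc)ˣ) : E.Loc) = E.xInv := rfl

theorem coe_xUnit_zpow_natCast (n : ℕ) :
    ((E.xUnit ^ (n : ℤ) : (E.Loc)ˣ) : E.Loc) = E.toLoc (E.x ^ n) := by
  rw [zpow_natCast, Units.val_pow_eq_pow_val, coe_xUnit, map_pow]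

theorem exists_pow_mul_eq_toLoc (y : E.Loc) :
    ∃ (n : ℕ) (s : S), ((E.xUnit ^ n : (E.Loc)ˣ) : E.Loc) * y = E.toLoc s := by
  induction y using OreLocalization.ind with
  | _ r s =>
    obtain ⟨_, n, rfl⟩ := s
    refine ⟨n, r, ?_⟩
    rw [Units.val_pow_eq_pow_val, coe_xUnit, ← map_pow]
    exact OreLocalization.mul_cancel

theorem x_mul_toLoc (r : R) : (E.xUnit : E.Loc) * E.toLoc (E.incl r) =
    E.toLoc (E.incl (E.τ r)) * E.xUnit + E.toLoc (E.incl (E.δ r)) := by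
  rw [coe_xUnit, ← map_mul, E.x_mul, map_add, map_mul]

theorem derivationDeleting_eq_sum {r : R} {n : ℕ} (h : ∀ m, n ≤ m → E.deletingCoeff m r = 0) :
    E.derivationDeleting r = ∑ l ∈ Finset.range n,
      E.toLoc (E.incl (E.deletingCoeff l r)) * ((E.xUnit ^ (-(l : ℤ)) : (E.Loc)ˣ) : E.Loc) := by
  rw [derivationDeleting]
  simp only [← deletingCoeff_apply]
  rw [finsum_eq_sum_of_support_subset (s := Finset.range n)]
  · refine Finset.sum_congr rfl fun l _ => ?_
    rw [zpow_neg, zpow_natCast, ← inv_pow, Units.val_pow_eq_pow_val, coe_xUnit_inv]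
  · intro l hl
    by_contra h'
    apply hl
    simp only [Finset.coe_range, Set.mem_Iio, not_lt] at h'
    simp only
    rw [h l h', map_zero, map_zero, zero_mul]

theorem derivationDeleting_add (r s : R) :
    E.derivationDeleting (r + s) = E.derivationDeleting r + E.derivationDeleting s := by
  obtain ⟨n, hn⟩ := E.exists_deletingCoeff_eq_zero r
  obtain ⟨m, hm⟩ := E.exists_deletingCoeff_eq_zero s
  have hn' : ∀ i, max n m ≤ i → E.deletingCoeff i r = 0 :=
    fun i hi => hn i 0 ((le_max_left _ _).trans hi)
  have hm' : ∀ i, max n m ≤ i → E.deletingCoeff i s = 0 :=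
    fun i hi => hm i 0 ((le_max_right _ _).trans hi)
  rw [E.derivationDeleting_eq_sum hn', E.derivationDeleting_eq_sum hm',
    E.derivationDeleting_eq_sum (n := max n m)
      fun i hi => by rw [map_add, hn' i hi, hm' i hi, add_zero], ← Finset.sum_add_distrib]
  exact Finset.sum_congr rfl fun l _ => by rw [map_add, map_add, map_add, add_mul]

/-- The derivation disappears here: on the image of `C`, the variable acts through `τ` alone. -/
theorem xUnit_mul_derivationDeleting (r : R) :
    (E.xUnit : E.Loc) * E.derivationDeleting r = E.derivationDeleting (E.τ r) * E.xUnit := by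
  obtain ⟨n, hn⟩ := E.exists_deletingCoeff_eq_zero r
  have hn' : ∀ i, n ≤ i → E.deletingCoeff i r = 0 := fun i hi => hn i 0 hi
  have hτ : ∀ i, n + 1 ≤ i → E.deletingCoeff i (E.τ r) = 0 := fun i hi => by
    rw [deletingCoeff_τ, hn' i (by omega), map_zero, smul_zero]
  rw [E.derivationDeleting_eq_sum hn', E.derivationDeleting_eq_sum hτ, Finset.mul_sum,
    Finset.sum_mul, Finset.sum_range_succ']
  have h1 : ∀ l ∈ Finset.range n, (E.xUnit : E.Loc) * (E.toLoc (E.incl (E.deletingCoeff l r)) *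
      ((E.xUnit ^ (-(l : ℤ)) : (E.Loc)ˣ) : E.Loc)) =
      E.toLoc (E.incl (E.τ (E.deletingCoeff l r))) *
        ((E.xUnit ^ (1 - (l : ℤ)) : (E.Loc)ˣ) : E.Loc) +
      E.toLoc (E.incl (E.δ (E.deletingCoeff l r))) *
        ((E.xUnit ^ (-(l : ℤ)) : (E.Loc)ˣ) : E.Loc) := by
    intro l _
    rw [← mul_assoc, x_mul_toLoc, add_mul, mul_assoc, ← Units.val_mul, sub_eq_add_neg, zpow_one_add]
  have h2 : ∀ l ∈ Finset.range n, E.toLoc (E.incl (E.deletingCoeff (l + 1) (E.τ r))) *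
      ((E.xUnit ^ (-((l + 1 : ℕ) : ℤ)) : (E.Loc)ˣ) : E.Loc) * (E.xUnit : E.Loc) =
      E.toLoc (E.incl (E.τ (E.deletingCoeff (l + 1) r))) *
        ((E.xUnit ^ (1 - ((l + 1 : ℕ) : ℤ)) : (E.Loc)ˣ) : E.Loc) +
      E.toLoc (E.incl (E.δ (E.deletingCoeff l r))) *
        ((E.xUnit ^ (-(l : ℤ)) : (E.Loc)ˣ) : E.Loc) := by
    intro l _
    rw [mul_assoc, ← Units.val_mul, ← zpow_add_one, deletingCoeff_τ_eq, map_add, map_add, add_mul]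
    push_cast
    congr 4
    ring
  rw [Finset.sum_congr rfl h1, Finset.sum_congr rfl h2, Finset.sum_add_distrib,
    Finset.sum_add_distrib, add_right_comm]
  congr 1
  have h3 := Finset.sum_range_succ' (fun l : ℕ => E.toLoc (E.incl (E.τ (E.deletingCoeff l r))) *
    ((E.xUnit ^ (1 - (l : ℤ)) : (E.Loc)ˣ) : E.Loc)) n
  rw [Finset.sum_range_succ, hn' n le_rfl] at h3
  simp only [map_zero, zero_mul, add_zero] at h3
  rw [h3]
  congr 1
  simp [deletingCoeff_zero]

theorem xUnit_pow_mul_derivationDeleting (n : ℕ) (r : R) :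
    ((E.xUnit ^ n : (E.Loc)ˣ) : E.Loc) * E.derivationDeleting r =
      E.derivationDeleting (E.τ^[n] r) * ((E.xUnit ^ n : (E.Loc)ˣ) : E.Loc) := by
  induction n with
  | zero => simp
  | succ n ih =>
    rw [pow_succ', Units.val_mul, mul_assoc, ih, ← mul_assoc, xUnit_mul_derivationDeleting,
      mul_assoc, Function.iterate_succ_apply']

theorem xUnit_zpow_mul_derivationDeleting (n : ℤ) (r : R) :
    ((E.xUnit ^ n : (E.Loc)ˣ) : E.Loc) * E.derivationDeleting r =
      E.derivationDeleting ((E.τ ^ n) r) * ((E.xUnit ^ n : (E.Loc)ˣ) : E.Loc) := by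
  have hpow : ∀ (n : ℕ) (r : R), (E.τ ^ n) r = E.τ^[n] r := fun n r => by
    induction n with
    | zero => rfl
    | succ n ih => rw [pow_succ', Function.iterate_succ_apply', ← ih]; rfl
  obtain ⟨m, rfl | rfl⟩ := n.eq_nat_or_neg
  · rw [zpow_natCast, zpow_natCast, xUnit_pow_mul_derivationDeleting, hpow]
  · rw [zpow_neg, zpow_neg, zpow_natCast, zpow_natCast]
    rw [Units.inv_mul_eq_iff_eq_mul, ← mul_assoc, xUnit_pow_mul_derivationDeleting, mul_assoc,
      Units.mul_inv, mul_one, ← hpow]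
    congr 1
    exact (AlgEquiv.apply_symm_apply (E.τ ^ m) r).symm

theorem derivationDeleting_mul (r s : R) :
    E.derivationDeleting (r * s) = E.derivationDeleting r * E.derivationDeleting s := by
  obtain ⟨n, hn⟩ := E.exists_deletingCoeff_eq_zero r
  obtain ⟨m, hm⟩ := E.exists_deletingCoeff_eq_zero s
  have hn0 : ∀ i, n ≤ i → E.deletingCoeff i r = 0 := fun i hi => hn i 0 hi
  have hs : ∀ l : ℕ, ((E.xUnit ^ (-(l : ℤ)) : (E.Loc)ˣ) : E.Loc) * E.derivationDeleting s =
      E.derivationDeleting (E.τ.symm^[l] s) * ((E.xUnit ^ (-(l : ℤ)) : (E.Loc)ˣ) : E.Loc) := by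
    intro l
    rw [zpow_neg, zpow_natCast, Units.inv_mul_eq_iff_eq_mul, ← mul_assoc,
      xUnit_pow_mul_derivationDeleting, mul_assoc, Units.mul_inv, mul_one,
      Function.LeftInverse.iterate E.τ.apply_symm_apply l]
  have hrs : ∀ i, n + m ≤ i → E.deletingCoeff i (r * s) = 0 := fun i hi => by
    rw [deletingCoeff_mul]
    refine Finset.sum_eq_zero fun p hp => ?_
    have := Finset.HasAntidiagonal.mem_antidiagonal.1 hp
    rcases le_or_gt n p.1 with h | h
    · rw [hn0 p.1 h, zero_mul]
    · rw [hm p.2 _ (by omega), mul_zero]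
  rw [E.derivationDeleting_eq_sum hrs,
    E.derivationDeleting_eq_sum hn0,
    Finset.sum_mul]
  have h1 : ∀ l ∈ Finset.range n, E.toLoc (E.incl (E.deletingCoeff l r)) *
      ((E.xUnit ^ (-(l : ℤ)) : (E.Loc)ˣ) : E.Loc) * E.derivationDeleting s =
      ∑ j ∈ Finset.range m, E.toLoc (E.incl (E.deletingCoeff l r *
        E.deletingCoeff j (E.τ.symm^[l] s))) *
        ((E.xUnit ^ (-((l + j : ℕ) : ℤ)) : (E.Loc)ˣ) : E.Loc) := by
    intro l _
    rw [mul_assoc, hs, E.derivationDeleting_eq_sum (fun i hi => hm i l hi), Finset.sum_mul,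
      Finset.mul_sum]
    refine Finset.sum_congr rfl fun j _ => ?_
    rw [mul_assoc, ← Units.val_mul, ← zpow_add, ← mul_assoc, ← map_mul, ← map_mul]
    push_cast
    congr 4; ring
  rw [Finset.sum_congr rfl h1, ← Finset.sum_product']
  have h2 : ∀ i ∈ Finset.range (n + m), E.toLoc (E.incl (E.deletingCoeff i (r * s))) *
      ((E.xUnit ^ (-(i : ℤ)) : (E.Loc)ˣ) : E.Loc) =
      ∑ p ∈ (Finset.range n ×ˢ Finset.range m) with p.1 + p.2 = i,
        E.toLoc (E.incl (E.deletingCoeff p.1 r * E.deletingCoeff p.2 (E.τ.symm^[p.1] s))) *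
        ((E.xUnit ^ (-((p.1 + p.2 : ℕ) : ℤ)) : (E.Loc)ˣ) : E.Loc) := by
    intro i _
    rw [deletingCoeff_mul, map_sum, map_sum, Finset.sum_mul]
    symm
    refine Finset.sum_subset_zero_on_sdiff ?_ ?_ ?_
    · intro p hp
      exact Finset.HasAntidiagonal.mem_antidiagonal.2 (Finset.mem_filter.1 hp).2
    · intro p hp
      rw [Finset.mem_sdiff, Finset.mem_filter, Finset.mem_product,
          Finset.HasAntidiagonal.mem_antidiagonal,
        Finset.mem_range, Finset.mem_range] at hp
      rcases le_or_gt n p.1 with h | h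
      · rw [hn0 p.1 h, zero_mul, map_zero, map_zero, zero_mul]
      · rw [hm p.2 _ (not_lt.1 fun h' => hp.2 ⟨⟨h, h'⟩, hp.1⟩), mul_zero, map_zero, map_zero,
          zero_mul]
    · intro p hp
      rw [(Finset.mem_filter.1 hp).2]
  rw [Finset.sum_congr rfl h2]
  refine Finset.sum_fiberwise_of_maps_to (fun p hp => ?_) _
  rw [Finset.mem_product, Finset.mem_range, Finset.mem_range] at hp
  exact Finset.mem_range.2 (by omega)

theorem deletingCoeff_one_succ (l : ℕ) : E.deletingCoeff (l + 1) 1 = 0 := by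
  have h1 : E.δ 1 = 0 := by simpa using E.δ_mul 1 1
  have h2 : E.τ.symm^[l + 1] 1 = 1 := Function.iterate_fixed (map_one E.τ.symm) _
  have h3 : E.δ^[l] (0 : R) = 0 := Function.iterate_fixed (map_zero E.δ) l
  rw [deletingCoeff_apply, h2, Function.iterate_succ_apply, h1, h3, smul_zero]

theorem derivationDeleting_one : E.derivationDeleting 1 = 1 := by
  rw [E.derivationDeleting_eq_sum (n := 1) fun m hm => by
    obtain ⟨l, rfl⟩ := Nat.exists_eq_add_of_le' hm
    exact E.deletingCoeff_one_succ l]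
  simp [deletingCoeff_zero]

/-- The derivation-deleting map as a ring homomorphism. -/
noncomputable def deletingHom : R →+* E.Loc where
  toFun := E.derivationDeleting
  map_one' := E.derivationDeleting_one
  map_mul' := E.derivationDeleting_mul
  map_zero' := by simpa using E.derivationDeleting_add 0 0
  map_add' := E.derivationDeleting_add

theorem deletingHom_apply (r : R) : E.deletingHom r = E.derivationDeleting r := rfl

theorem xUnit_zpow_mul_deletingHom (n : ℤ) (r : R) :
    ((E.xUnit ^ n : (E.Loc)ˣ) : E.Loc) * E.deletingHom r =
      E.deletingHom ((E.τ ^ n) r) * ((E.xUnit ^ n : (E.Loc)ˣ) : E.Loc) :=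
  E.xUnit_zpow_mul_derivationDeleting n r

/-- The element `∑ C(p_i) x^i` of the localization attached to a finitely supported family `p`. -/
noncomputable def laurent : (ℤ →₀ R) →+ E.Loc :=
  Finsupp.liftAddHom fun i => (AddMonoidHom.mulRight ((E.xUnit ^ i : (E.Loc)ˣ) : E.Loc)).comp
    (E.deletingHom : R →+ E.Loc)

theorem laurent_apply (p : ℤ →₀ R) : E.laurent p =
    ∑ i ∈ p.support, E.deletingHom (p i) * ((E.xUnit ^ i : (E.Loc)ˣ) : E.Loc) := rfl

theorem laurent_single (i : ℤ) (r : R) : E.laurent (Finsupp.single i r) =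
    E.deletingHom r * ((E.xUnit ^ i : (E.Loc)ˣ) : E.Loc) := by
  simp [laurent]

theorem deletingHom_mul_zpow_mul (r s : R) (i j : ℤ) :
    E.deletingHom r * ((E.xUnit ^ i : (E.Loc)ˣ) : E.Loc) *
      (E.deletingHom s * ((E.xUnit ^ j : (E.Loc)ˣ) : E.Loc)) =
      E.deletingHom (r * (E.τ ^ i) s) * ((E.xUnit ^ (i + j) : (E.Loc)ˣ) : E.Loc) := by
  rw [mul_assoc, ← mul_assoc _ (E.deletingHom s), xUnit_zpow_mul_deletingHom, mul_assoc _ _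
    ((E.xUnit ^ j : (E.Loc)ˣ) : E.Loc), ← Units.val_mul, ← zpow_add, ← mul_assoc, map_mul]

/-- The polynomial `C(r) x^m`, truncated so as to lie in the Ore extension. -/
noncomputable def deletingPoly (r : R) (m : ℕ) : S :=
  ∑ l ∈ Finset.range (m + 1), E.incl (E.deletingCoeff l r) * E.x ^ (m - l)

theorem coeff_deletingPoly (r : R) (m j : ℕ) : E.coeff j (E.deletingPoly r m) =
    if j ≤ m then E.deletingCoeff (m - j) r else 0 := by
  rw [deletingPoly, map_sum]
  simp only [coeff_monomial]
  split_ifs with h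
  · rw [Finset.sum_eq_single (m - j)]
    · rw [if_pos (by omega)]
    · intro b hb hne
      rw [if_neg]
      rw [Finset.mem_range] at hb
      omega
    · intro hb
      exact absurd (Finset.mem_range.2 (by omega)) hb
  · refine Finset.sum_eq_zero fun l _ => if_neg (by omega)

theorem toLoc_deletingPoly {r : R} {m : ℕ} (h : ∀ l, m < l → E.deletingCoeff l r = 0) :
    E.toLoc (E.deletingPoly r m) =
      E.deletingHom r * ((E.xUnit ^ (m : ℤ) : (E.Loc)ˣ) : E.Loc) := by
  rw [deletingHom_apply, E.derivationDeleting_eq_sum (n := m + 1) fun l hl => h l (by omega),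
    Finset.sum_mul, deletingPoly, map_sum]
  refine Finset.sum_congr rfl fun l hl => ?_
  rw [map_mul, mul_assoc, ← Units.val_mul, ← zpow_add, ← coe_xUnit_zpow_natCast]
  rw [Finset.mem_range] at hl
  congr 4
  omega

/-- Right multiplication by `x ^ M` clears all denominators of the finitely many terms `C(p i) x^i`.
-/
theorem exists_deletingPoly (p : ℤ →₀ R) : ∃ M : ℕ, ∀ i ∈ p.support, 0 ≤ i + M ∧
    ∀ l : ℕ, i + M < l → E.deletingCoeff l (p i) = 0 := by
  choose n hn using E.exists_deletingCoeff_eq_zero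
  refine ⟨∑ i ∈ p.support, (n (p i) + i.natAbs), fun i hi => ?_⟩
  have h := Finset.single_le_sum (f := fun i => n (p i) + i.natAbs) (fun _ _ => Nat.zero_le _) hi
  exact ⟨by omega, fun l hl => hn (p i) l 0 (by omega)⟩

theorem laurent_mul_pow {p : ℤ →₀ R} {M : ℕ} (hM : ∀ i ∈ p.support, 0 ≤ i + M ∧
    ∀ l : ℕ, i + M < l → E.deletingCoeff l (p i) = 0) :
    E.laurent p * E.toLoc (E.x ^ M) =
      E.toLoc (∑ i ∈ p.support, E.deletingPoly (p i) (i + M).toNat) := by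
  rw [laurent_apply, Finset.sum_mul, map_sum]
  refine Finset.sum_congr rfl fun i hi => ?_
  obtain ⟨h0, h⟩ := hM i hi
  rw [E.toLoc_deletingPoly fun l hl => h l (by omega), Int.toNat_of_nonneg h0,
    ← coe_xUnit_zpow_natCast, mul_assoc, ← Units.val_mul, ← zpow_add]

/-- Since `C(r)` is `r` plus terms in negative powers of `x`, the top coefficient of `p` survives as
the leading coefficient once denominators are cleared. -/
theorem laurent_injective : Function.Injective E.laurent := by
  rw [injective_iff_map_eq_zero]
  intro p hp
  by_contra hne
  have hs := Finsupp.support_nonempty_iff.2 hne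
  obtain ⟨M, hM⟩ := E.exists_deletingPoly p
  have h1 := E.laurent_mul_pow hM
  rw [hp, zero_mul] at h1
  have h2 := E.toLoc_injective (h1.symm.trans (map_zero E.toLoc).symm)
  set n := p.support.max' hs
  have hn : n ∈ p.support := Finset.max'_mem _ _
  have h3 := congrArg (E.coeff (n + M).toNat) h2
  rw [map_sum, map_zero, Finset.sum_eq_single n] at h3
  · rw [coeff_deletingPoly, if_pos le_rfl, Nat.sub_self, deletingCoeff_zero] at h3
    exact Finsupp.mem_support_iff.1 hn h3
  · intro i hi hne'
    have := lt_of_le_of_ne (Finset.le_max' _ _ hi) hne'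
    rw [coeff_deletingPoly, if_neg]
    have := (hM i hi).1
    have := (hM n hn).1
    omega
  · exact fun h => absurd hn h

theorem iterate_δ_smul (n : ℕ) (c : k) (r : R) : E.δ^[n] (c • r) = c • E.δ^[n] r := by
  induction n with
  | zero => rfl
  | succ n ih => rw [Function.iterate_succ_apply', ih, map_smul, Function.iterate_succ_apply']

theorem iterate_δ_deletingCoeff {n l : ℕ} {r : R} (hr : E.δ^[n + 1] r = 0) :
    E.δ^[n] (E.deletingCoeff (l + 1) r) = 0 := by
  rw [deletingCoeff_apply, iterate_δ_smul, ← Function.iterate_add_apply,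
    show n + (l + 1) = l + (n + 1) by ring, Function.iterate_add_apply,
    E.iterate_δ_τ_symm hr, Function.iterate_fixed (map_zero E.δ), smul_zero]

/-- If an additive subgroup of the localization contains `C(r) x^i` for all `r` in a set which is
stable under the coefficients of `C`, then it contains `r x^i` for these `r`. -/
theorem toLoc_incl_mul_zpow_mem {Q : Set R} (hQ : ∀ l, ∀ r ∈ Q, E.deletingCoeff l r ∈ Q)
    {A : AddSubgroup E.Loc}
    (hA : ∀ r ∈ Q, ∀ i : ℤ, E.deletingHom r * ((E.xUnit ^ i : (E.Loc)ˣ) : E.Loc) ∈ A)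
    {r : R} (hr : r ∈ Q) (i : ℤ) :
    E.toLoc (E.incl r) * ((E.xUnit ^ i : (E.Loc)ˣ) : E.Loc) ∈ A := by
  -- Induction on the nilpotency index: `r x^i` differs from `C(r) x^i` by terms whose coefficients
  -- are killed by a smaller power of `δ`.
  obtain ⟨n, hn⟩ := E.δ_locally_nilpotent r
  induction n generalizing r i with
  | zero =>
    have : r = 0 := hn
    simp [this]
  | succ n ih =>
    obtain ⟨m, hm⟩ := E.exists_deletingCoeff_eq_zero r
    have hm' : ∀ l, m + 1 ≤ l → E.deletingCoeff l r = 0 := fun l hl => hm l 0 (by omega)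
    have h := hA r hr i
    rw [deletingHom_apply, E.derivationDeleting_eq_sum hm', Finset.sum_range_succ',
      add_mul, Finset.sum_mul] at h
    have h2 : ∑ l ∈ Finset.range m, E.toLoc (E.incl (E.deletingCoeff (l + 1) r)) *
        ((E.xUnit ^ (-((l + 1 : ℕ) : ℤ)) : (E.Loc)ˣ) : E.Loc) *
        ((E.xUnit ^ i : (E.Loc)ˣ) : E.Loc) ∈ A := by
      refine sum_mem fun l _ => ?_
      rw [mul_assoc, ← Units.val_mul, ← zpow_add]
      exact ih (hQ _ _ hr) _ (E.iterate_δ_deletingCoeff hn)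
    have h3 := (add_mem_cancel_left h2).1 h
    simpa [deletingCoeff_zero] using h3

theorem deletingHom_mul_zpow_mem_range (r : R) (i : ℤ) :
    E.deletingHom r * ((E.xUnit ^ i : (E.Loc)ˣ) : E.Loc) ∈ E.laurent.range :=
  ⟨_, E.laurent_single i r⟩

theorem toLoc_mem_range (s : S) : E.toLoc s ∈ E.laurent.range := by
  refine E.monomial_induction s (by simp) (fun s t hs ht => ?_) fun r n => ?_
  · rw [map_add]; exact add_mem hs ht
  · rw [map_mul, ← coe_xUnit_zpow_natCast]
    exact E.toLoc_incl_mul_zpow_mem (Q := Set.univ) (fun _ _ _ => trivial)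
      (fun r _ i => E.deletingHom_mul_zpow_mem_range r i) trivial _

theorem zpow_mul_deletingHom_mul_zpow (n i : ℤ) (r : R) :
    ((E.xUnit ^ n : (E.Loc)ˣ) : E.Loc) *
      (E.deletingHom r * ((E.xUnit ^ i : (E.Loc)ˣ) : E.Loc)) =
      E.deletingHom ((E.τ ^ n) r) * ((E.xUnit ^ (n + i) : (E.Loc)ˣ) : E.Loc) := by
  have := E.deletingHom_mul_zpow_mul 1 r n i
  rwa [map_one, one_mul, one_mul] at this

theorem laurent_surjective (y : E.Loc) : ∃ p, E.laurent p = y := by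
  obtain ⟨n, s, h⟩ := E.exists_pow_mul_eq_toLoc y
  obtain ⟨p, hp⟩ := E.toLoc_mem_range s
  have : y = ((E.xUnit ^ (-(n : ℤ)) : (E.Loc)ˣ) : E.Loc) * E.laurent p := by
    rw [hp, ← h, zpow_neg, zpow_natCast, Units.inv_mul_cancel_left]
  rw [this, laurent_apply, Finset.mul_sum]
  refine sum_mem (S := E.laurent.range) fun i _ => ?_
  rw [zpow_mul_deletingHom_mul_zpow]
  exact E.deletingHom_mul_zpow_mem_range _ _

/-- The coefficients with respect to the elements `C(r) x^i`. -/
noncomputable def laurentCoeffs : E.Loc ≃+ (ℤ →₀ R) :=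
  (AddEquiv.ofBijective E.laurent ⟨E.laurent_injective, E.laurent_surjective⟩).symm

theorem laurent_laurentCoeffs (y : E.Loc) : E.laurent (E.laurentCoeffs y) = y :=
  E.laurentCoeffs.symm_apply_apply y

theorem laurentCoeffs_laurent (p : ℤ →₀ R) : E.laurentCoeffs (E.laurent p) = p :=
  E.laurentCoeffs.apply_symm_apply p

theorem laurentCoeffs_monomial (r : R) (i : ℤ) :
    E.laurentCoeffs (E.deletingHom r * ((E.xUnit ^ i : (E.Loc)ˣ) : E.Loc)) =
      Finsupp.single i r := by
  rw [← laurent_single, laurentCoeffs_laurent]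

@[elab_as_elim]
theorem laurent_induction {p : E.Loc → Prop} (y : E.Loc) (zero : p 0)
    (add : ∀ y z, p y → p z → p (y + z))
    (monomial : ∀ r (i : ℤ), p (E.deletingHom r * ((E.xUnit ^ i : (E.Loc)ˣ) : E.Loc))) : p y := by
  rw [← E.laurent_laurentCoeffs y, laurent_apply]
  exact Finset.sum_induction _ p (fun a b => add a b) zero fun i _ => monomial _ _

/-! ### Graded ideals of the localization -/

/-- The powers of `h₀` realize those of `τ`, so `H`-stable ideals are stable under `τ` and its
inverse. -/
theorem exists_smul_eq_pow_τ (n : ℤ) : ∃ h : H, ∀ r : R, (E.τ ^ n) r = h • r := by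
  obtain ⟨h₀, h, -⟩ := E.exists_h₀
  have key : ∀ (n : ℕ) (r : R), (E.τ ^ n) r = h₀ ^ n • r := fun n => by
    induction n with
    | zero => intro r; simp
    | succ n ih => intro r; rw [pow_succ, pow_succ, mul_smul, h, ← ih]; rfl
  obtain ⟨m, rfl | rfl⟩ := n.eq_nat_or_neg
  · exact ⟨h₀ ^ m, fun r => by rw [zpow_natCast, key]⟩
  · refine ⟨(h₀ ^ m)⁻¹, fun r => ?_⟩
    rw [eq_inv_smul_iff, ← key, zpow_neg, zpow_natCast]
    exact AlgEquiv.apply_symm_apply (E.τ ^ m) r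

theorem pow_τ_mem {Q : TwoSidedIdeal R} (hQ : IsHStable H Q) (n : ℤ) {r : R} (hr : r ∈ Q) :
    (E.τ ^ n) r ∈ Q := by
  obtain ⟨h, hh⟩ := E.exists_smul_eq_pow_τ n
  rw [hh]
  exact hQ _ _ hr

theorem τ_mem {Q : TwoSidedIdeal R} (hQ : IsHStable H Q) {r : R} (hr : r ∈ Q) : E.τ r ∈ Q := by
  simpa using E.pow_τ_mem hQ 1 hr

theorem pow_τ_mem_iff {Q : TwoSidedIdeal R} (hQ : IsHStable H Q) (n : ℤ) {r : R} :
    (E.τ ^ n) r ∈ Q ↔ r ∈ Q := by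
  refine ⟨fun h => ?_, E.pow_τ_mem hQ n⟩
  have := E.pow_τ_mem hQ (-n) h
  rwa [← AlgEquiv.mul_apply, ← zpow_add, neg_add_cancel, zpow_zero, AlgEquiv.one_apply] at this

/-- The elements of the localization all of whose coefficients lie in an `H`-stable ideal. -/
noncomputable def laurentIdeal (Q : TwoSidedIdeal R) (hQ : IsHStable H Q) :
    TwoSidedIdeal E.Loc :=
  TwoSidedIdeal.mk' {y | ∀ i, E.laurentCoeffs y i ∈ Q}
    (fun i => by rw [map_zero]; exact Q.zero_mem)
    (fun {y z} hy hz i => by rw [map_add]; exact Q.add_mem (hy i) (hz i))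
    (fun {y} hy i => by rw [map_neg]; exact Q.neg_mem (hy i))
    (fun {y z} hz => by
      rw [← E.laurent_laurentCoeffs z, laurent_apply]
      refine E.laurent_induction y (fun i => ?_) (fun y y' hy hy' i => ?_) fun r j i => ?_
      · rw [zero_mul, map_zero]; exact Q.zero_mem
      · rw [add_mul, map_add]; exact Q.add_mem (hy i) (hy' i)
      · rw [Finset.mul_sum, map_sum, Finsupp.finsetSum_apply]
        refine sum_mem fun l _ => ?_
        rw [deletingHom_mul_zpow_mul, laurentCoeffs_monomial, Finsupp.single_apply]
        split_ifs
        · exact Q.mul_mem_left _ _ (E.pow_τ_mem hQ _ (hz l))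
        · exact Q.zero_mem)
    (fun {z y} hz => by
      rw [← E.laurent_laurentCoeffs z, laurent_apply]
      refine E.laurent_induction y (fun i => ?_) (fun y y' hy hy' i => ?_) fun r j i => ?_
      · rw [mul_zero, map_zero]; exact Q.zero_mem
      · rw [mul_add, map_add]; exact Q.add_mem (hy i) (hy' i)
      · rw [Finset.sum_mul, map_sum, Finsupp.finsetSum_apply]
        refine sum_mem fun l _ => ?_
        rw [deletingHom_mul_zpow_mul, laurentCoeffs_monomial, Finsupp.single_apply]
        split_ifs
        · exact Q.mul_mem_right _ _ (hz l)
        · exact Q.zero_mem)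

theorem mem_laurentIdeal {Q : TwoSidedIdeal R} (hQ : IsHStable H Q) {y : E.Loc} :
    y ∈ E.laurentIdeal Q hQ ↔ ∀ i, E.laurentCoeffs y i ∈ Q := by
  rw [laurentIdeal, TwoSidedIdeal.mem_mk']; rfl

theorem monomial_mem_laurentIdeal_iff {Q : TwoSidedIdeal R} (hQ : IsHStable H Q) {r : R} {i : ℤ} :
    E.deletingHom r * ((E.xUnit ^ i : (E.Loc)ˣ) : E.Loc) ∈ E.laurentIdeal Q hQ ↔ r ∈ Q := by
  rw [mem_laurentIdeal, laurentCoeffs_monomial]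
  constructor
  · intro h; simpa using h i
  · intro h j
    rw [Finsupp.single_apply]
    split_ifs
    · exact h
    · exact Q.zero_mem

theorem mem_of_laurentCoeffs_mem {Q : TwoSidedIdeal R} {A : AddSubgroup E.Loc}
    (hA : ∀ r ∈ Q, ∀ i : ℤ, E.deletingHom r * ((E.xUnit ^ i : (E.Loc)ˣ) : E.Loc) ∈ A)
    {y : E.Loc} (hy : ∀ i, E.laurentCoeffs y i ∈ Q) : y ∈ A := by
  rw [← E.laurent_laurentCoeffs y, laurent_apply]
  exact sum_mem fun i _ => hA _ (hy i) i

/-- As `Q` is `τ`-stable, the sum of the `C(Q) x^i` is already a two-sided ideal. -/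
theorem span_derivationDeleting (Q : TwoSidedIdeal R) (hQ : IsHStable H Q) :
    TwoSidedIdeal.span (E.derivationDeleting '' (Q : Set R)) = E.laurentIdeal Q hQ := by
  apply le_antisymm
  · rw [TwoSidedIdeal.span_le]
    rintro _ ⟨r, hr, rfl⟩
    have := (E.monomial_mem_laurentIdeal_iff hQ (i := 0)).2 hr
    rwa [zpow_zero, Units.val_one, mul_one] at this
  · intro y hy
    refine E.mem_of_laurentCoeffs_mem (A := (TwoSidedIdeal.span
      (E.derivationDeleting '' (Q : Set R))).asIdeal.toAddSubgroup) (fun r hr i => ?_)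
      ((E.mem_laurentIdeal hQ).1 hy)
    exact TwoSidedIdeal.mul_mem_right _ _ _ (TwoSidedIdeal.subset_span ⟨r, hr, rfl⟩)

theorem mem_tildeC {Q : TwoSidedIdeal R} (hQ : IsHStable H Q) {s : S} :
    s ∈ E.tildeC Q ↔ E.toLoc s ∈ E.laurentIdeal Q hQ := by
  rw [tildeC, TwoSidedIdeal.mem_comap, span_derivationDeleting]

theorem deletingPoly_mem_tildeC_iff {Q : TwoSidedIdeal R} (hQ : IsHStable H Q) {r : R} {m : ℕ}
    (h : ∀ l, m < l → E.deletingCoeff l r = 0) : E.deletingPoly r m ∈ E.tildeC Q ↔ r ∈ Q := by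
  rw [mem_tildeC E hQ, E.toLoc_deletingPoly h, monomial_mem_laurentIdeal_iff]

/-- For large `m` the element `C(r) x^m` lies in `S`, and it tests whether `r` lies in the ideal. -/
theorem tildeC_le_tildeC_iff {Q Q' : TwoSidedIdeal R} (hQ : IsHStable H Q)
    (hQ' : IsHStable H Q') : E.tildeC Q ≤ E.tildeC Q' ↔ Q ≤ Q' := by
  constructor
  · intro h r hr
    obtain ⟨n, hn⟩ := E.exists_deletingCoeff_eq_zero r
    have hn' : ∀ l, n < l → E.deletingCoeff l r = 0 := fun l hl => hn l 0 hl.le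
    exact (E.deletingPoly_mem_tildeC_iff hQ' hn').1
      (h ((E.deletingPoly_mem_tildeC_iff hQ hn').2 hr))
  · intro h s hs
    rw [E.mem_tildeC hQ, mem_laurentIdeal] at hs
    rw [E.mem_tildeC hQ', mem_laurentIdeal]
    exact fun i => h (hs i)

theorem x_not_mem_tildeC {Q : TwoSidedIdeal R} (hQ : IsHStable H Q) (hne : Q ≠ ⊤) :
    E.x ∉ E.tildeC Q := by
  intro h
  rw [E.mem_tildeC hQ] at h
  have e : E.toLoc E.x = E.deletingHom 1 * ((E.xUnit ^ (1 : ℤ) : (E.Loc)ˣ) : E.Loc) := by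
    rw [map_one, one_mul, zpow_one, coe_xUnit]
  rw [e, monomial_mem_laurentIdeal_iff] at h
  exact hne ((TwoSidedIdeal.one_mem_iff Q).1 h)

theorem exists_max_not_mem {Q : TwoSidedIdeal R} (p : ℤ →₀ R) (hp : ¬ ∀ i, p i ∈ Q) :
    ∃ n, p n ∉ Q ∧ ∀ i, n < i → p i ∈ Q := by
  classical
  push Not at hp
  obtain ⟨j, hj⟩ := hp
  have hs : (p.support.filter fun i => p i ∉ Q).Nonempty := ⟨j, by
    rw [Finset.mem_filter, Finsupp.mem_support_iff]
    exact ⟨fun h => hj (h ▸ Q.zero_mem), hj⟩⟩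
  refine ⟨_, (Finset.mem_filter.1 (Finset.max'_mem _ hs)).2, fun i hi => ?_⟩
  by_contra h
  refine absurd (Finset.le_max' _ i ?_) (not_le.2 hi)
  rw [Finset.mem_filter, Finsupp.mem_support_iff]
  exact ⟨fun h' => h (h' ▸ Q.zero_mem), h⟩

/-- Let `n` and `m` be the highest degrees with coefficients `a`, `b` outside `Q`. Modulo `Q` the
product has coefficient `a τ^n(b)` in degree `n + m`, which is not in `Q`. -/
theorem laurentIdeal_mem_or_mem {Q : TwoSidedIdeal R} (hQ : IsHStable H Q)
    (hc : IsCompletelyPrimeIdeal Q) {y z : E.Loc} (h : y * z ∈ E.laurentIdeal Q hQ) :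
    y ∈ E.laurentIdeal Q hQ ∨ z ∈ E.laurentIdeal Q hQ := by
  by_contra hcon
  rw [not_or, mem_laurentIdeal, mem_laurentIdeal] at hcon
  obtain ⟨n, hn, hn'⟩ := exists_max_not_mem _ hcon.1
  obtain ⟨m, hm, hm'⟩ := exists_max_not_mem _ hcon.2
  rw [mem_laurentIdeal] at h
  have h1 := h (n + m)
  set p := E.laurentCoeffs y
  set p' := E.laurentCoeffs z
  rw [← E.laurent_laurentCoeffs y, ← E.laurent_laurentCoeffs z, laurent_apply, laurent_apply,
    Finset.sum_mul_sum, ← Finset.sum_product', map_sum, Finsupp.finsetSum_apply] at h1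
  simp only [deletingHom_mul_zpow_mul, laurentCoeffs_monomial, Finsupp.single_apply] at h1
  have hmem : (n, m) ∈ p.support ×ˢ p'.support := by
    rw [Finset.mem_product, Finsupp.mem_support_iff, Finsupp.mem_support_iff]
    exact ⟨fun h => hn (h ▸ Q.zero_mem), fun h => hm (h ▸ Q.zero_mem)⟩
  rw [← Finset.add_sum_erase _ _ hmem, if_pos rfl] at h1
  have h2 : ∑ x ∈ (p.support ×ˢ p'.support).erase (n, m),
      (if x.1 + x.2 = n + m then p x.1 * (E.τ ^ x.1) (p' x.2) else 0) ∈ Q := by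
    refine sum_mem fun x hx => ?_
    split_ifs with hx'
    · rcases lt_trichotomy n x.1 with h' | h' | h'
      · exact Q.mul_mem_right _ _ (hn' _ h')
      · exact absurd (Prod.ext h'.symm (by simp only; omega)) (Finset.ne_of_mem_erase hx)
      · exact Q.mul_mem_left _ _ (E.pow_τ_mem hQ _ (hm' _ (by omega)))
    · exact Q.zero_mem
  rcases hc.2 _ _ ((add_mem_cancel_right h2).1 h1) with h3 | h3
  · exact hn h3
  · exact hm ((E.pow_τ_mem_iff hQ n).1 h3)

theorem isCompletelyPrimeIdeal_tildeC {Q : TwoSidedIdeal R} (hQ : IsHStable H Q)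
    (hc : IsCompletelyPrimeIdeal Q) : IsCompletelyPrimeIdeal (E.tildeC Q) := by
  refine ⟨fun h => E.x_not_mem_tildeC hQ hc.1 (h ▸ trivial), fun a b hab => ?_⟩
  rw [E.mem_tildeC hQ, map_mul] at hab
  rw [E.mem_tildeC hQ, E.mem_tildeC hQ]
  exact E.laurentIdeal_mem_or_mem hQ hc hab

end CauchonExtension

theorem IsCompletelyPrimeIdeal.isHPrime {H A : Type*} [Group H] [Ring A] [MulSemiringAction H A]
    {P : TwoSidedIdeal A} (hc : IsCompletelyPrimeIdeal P) (hs : IsHStable H P) : IsHPrime H P where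
  ne_top := hc.1
  stable := hs
  le_or_le I J _ _ h := by
    by_contra hcon
    rw [not_or, SetLike.not_le_iff_exists, SetLike.not_le_iff_exists] at hcon
    obtain ⟨⟨a, ha, ha'⟩, b, hb, hb'⟩ := hcon
    exact (hc.2 a b (h a ha b hb)).elim ha' hb'

/-- A sum of eigenvectors with distinct eigenvalues lies in an invariant subspace only if
each of them does. -/
theorem Submodule.mem_of_sum_eigenvectors_mem {k V ι : Type*} [Field k] [AddCommGroup V]
    [Module k V] {K : Submodule k V} {T : V →ₗ[k] V}
    (hK : ∀ v ∈ K, T v ∈ K) {a : ι → k} (ha : Function.Injective a) {v : ι → V}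
    (hv : ∀ i, T (v i) = a i • v i) (F : Finset ι) (h : ∑ i ∈ F, v i ∈ K) :
    ∀ i ∈ F, v i ∈ K := by
  classical
  induction F using Finset.induction_on generalizing v with
  | empty => simp
  | insert j F hj ih =>
    have h1 : ∑ i ∈ F, (a i - a j) • v i ∈ K := by
      have := K.sub_mem (hK _ h) (K.smul_mem (a j) h)
      rw [map_sum, Finset.sum_congr rfl fun i _ => hv i, Finset.sum_insert hj,
        Finset.sum_insert hj, smul_add, add_sub_add_left_eq_sub,
        Finset.smul_sum, ← Finset.sum_sub_distrib] at this
      simpa only [sub_smul] using this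
    have hTsmul : ∀ i, T ((a i - a j) • v i) = a i • ((a i - a j) • v i) := fun i => by
      rw [map_smul, hv, smul_comm]
    have h2 : ∀ i ∈ F, v i ∈ K := fun i hi => by
      have := ih hTsmul h1 i hi
      refine (K.smul_mem_iff (sub_ne_zero.2 fun e => hj ?_)).1 this
      rw [← ha e]; exact hi
    intro i hi
    rcases Finset.mem_insert.1 hi with rfl | hi
    · rw [Finset.sum_insert hj] at h
      exact (K.add_mem_iff_left (sum_mem h2)).1 h
    · exact h2 i hi

/-! ### The action of `H` on the localization -/

namespace CauchonExtension

variable {k H R S : Type*} [Field k] [CommGroup H] [Ring R] [Algebra k R]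
    [Ring S] [Algebra k S] [MulSemiringAction H R] [MulSemiringAction H S]
    (E : CauchonExtension k H R S)

theorem exists_eigenvalue (h : H) : ∃ c : k, c ≠ 0 ∧ h • E.x = c • E.x := by
  obtain ⟨c, hc⟩ := E.x_eigen h
  by_cases h0 : c = 0
  -- A zero eigenvalue forces `x = 0`, and then every scalar is an eigenvalue.
  · rw [h0, zero_smul, smul_eq_zero_iff_eq] at hc
    exact ⟨1, one_ne_zero, by rw [hc, smul_zero, smul_zero]⟩
  · exact ⟨c, h0, hc⟩

theorem incl_injective : Function.Injective E.incl := fun r s h => by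
  have := congrArg (E.coeff 0) h
  simpa [coeff_incl] using this

theorem coeff_x (n : ℕ) : E.coeff n E.x = if 1 = n then 1 else 0 := by
  simpa using E.coeff_monomial 1 1 n

theorem smul_smul_comm_base (E : CauchonExtension k H R S) (h : H) (c : k) (r : R) :
    h • (c • r) = c • (h • r) := by
  apply E.incl_injective
  rw [E.incl_smul, map_smul, E.smul_algebra, map_smul, E.incl_smul]

/-- On `R`, `τ` is the action of `h₀`, and `H` is commutative. -/
theorem τ_smul (h : H) (r : R) : E.τ (h • r) = h • E.τ r := by
  obtain ⟨h₀, hh, -⟩ := E.exists_h₀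
  rw [← hh, ← hh, smul_smul, smul_smul, mul_comm]

theorem δ_smul {h : H} {c : k} (hc : h • E.x = c • E.x) (r : R) :
    c • E.δ (h • r) = h • E.δ r := by
  have h1 := congrArg (h • ·) (E.x_mul r)
  simp only [smul_mul', smul_add, hc, ← E.incl_smul, ← E.τ_smul] at h1
  rw [smul_mul_assoc, E.x_mul, mul_smul_comm, smul_add, add_right_inj, ← map_smul] at h1
  exact E.incl_injective h1

/-- The factor `c ^ l` compensates for the action of `h` on `x^{-l}`; this makes `C` equivariant
(`locMap_deletingHom`). -/
theorem deletingCoeff_smul {h : H} {c : k} (hc : h • E.x = c • E.x) (l : ℕ) (r : R) :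
    c ^ l • E.deletingCoeff l (h • r) = h • E.deletingCoeff l r := by
  induction l with
  | zero => simp [deletingCoeff_zero]
  | succ l ih =>
    apply E.τ.injective
    apply (smul_right_injective R (E.q_pow_sub_one_ne_zero l))
    simp only
    calc (E.q ^ (l + 1) - 1) • E.τ (c ^ (l + 1) • E.deletingCoeff (l + 1) (h • r))
        = c ^ (l + 1) • E.δ (E.deletingCoeff l (h • r)) := by
          rw [map_smul, smul_comm, δ_deletingCoeff]
      _ = c • E.δ (h • E.deletingCoeff l r) := by
          rw [← ih, map_smul E.δ, smul_smul, pow_succ']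
      _ = (E.q ^ (l + 1) - 1) • E.τ (h • E.deletingCoeff (l + 1) r) := by
          rw [E.δ_smul hc, δ_deletingCoeff, E.smul_smul_comm_base, E.τ_smul]

/-- The automorphism of the localization induced by an element of `H`. -/
noncomputable def locMap (h : H) : E.Loc →+* E.Loc :=
  OreLocalization.universalHom (E.toLoc.comp (MulSemiringAction.toRingHom H S h))
    (IsUnit.liftRight (((E.toLoc.comp (MulSemiringAction.toRingHom H S h)) : S →* E.Loc).comp
      (Submonoid.powers E.x).subtype) (by
        rintro ⟨_, n, rfl⟩
        obtain ⟨c, hc, hx⟩ := E.exists_eigenvalue h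
        simp only [MonoidHom.coe_comp, Submonoid.coe_subtype, Function.comp_apply,
          map_pow]
        refine IsUnit.pow n ?_
        change IsUnit (E.toLoc (h • E.x))
        rw [hx, Algebra.smul_def, map_mul]
        exact ((IsUnit.mk0 c hc).map (E.toLoc.comp (algebraMap k S))).mul E.xUnit.isUnit))
    fun _ => rfl

theorem locMap_toLoc (h : H) (s : S) : E.locMap h (E.toLoc s) = E.toLoc (h • s) :=
  OreLocalization.universalHom_commutes _ _ _

theorem toLoc_smul (c : k) (s : S) : E.toLoc (c • s) = c • E.toLoc s := by
  rw [Algebra.smul_def, Algebra.smul_def, map_mul]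
  rfl

theorem locMap_smul (h : H) (c : k) (y : E.Loc) : E.locMap h (c • y) = c • E.locMap h y := by
  rw [Algebra.smul_def, map_mul, Algebra.smul_def]
  congr 1
  have e : algebraMap k E.Loc c = E.toLoc (algebraMap k S c) := rfl
  rw [e, locMap_toLoc, Algebra.algebraMap_eq_smul_one, E.smul_algebra, smul_one]

theorem locMap_zpow {h : H} {c : k} (hc0 : c ≠ 0) (hc : h • E.x = c • E.x) (i : ℤ) :
    E.locMap h ((E.xUnit ^ i : (E.Loc)ˣ) : E.Loc) =
      c ^ i • ((E.xUnit ^ i : (E.Loc)ˣ) : E.Loc) := by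
  have hnat : ∀ n : ℕ, E.locMap h ((E.xUnit ^ n : (E.Loc)ˣ) : E.Loc) =
      c ^ n • ((E.xUnit ^ n : (E.Loc)ˣ) : E.Loc) := fun n => by
    rw [Units.val_pow_eq_pow_val, map_pow, coe_xUnit, locMap_toLoc, hc, toLoc_smul, smul_pow]
  obtain ⟨n, rfl | rfl⟩ := i.eq_nat_or_neg
  · rw [zpow_natCast, zpow_natCast, hnat]
  · rw [zpow_neg, zpow_neg, zpow_natCast, zpow_natCast]
    have h1 : E.locMap h ((E.xUnit ^ n : (E.Loc)ˣ) : E.Loc) *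
        E.locMap h (((E.xUnit ^ n)⁻¹ : (E.Loc)ˣ) : E.Loc) = 1 := by
      rw [← map_mul, Units.mul_inv, map_one]
    rw [hnat, smul_mul_assoc] at h1
    rw [eq_inv_smul_iff₀ (pow_ne_zero n hc0), ← mul_one (((E.xUnit ^ n)⁻¹ : (E.Loc)ˣ) : E.Loc),
      ← Units.mul_right_inj (E.xUnit ^ n), mul_smul_comm, mul_one, h1, Units.mul_inv]

theorem locMap_deletingHom (h : H) (r : R) :
    E.locMap h (E.deletingHom r) = E.deletingHom (h • r) := by
  obtain ⟨c, hc0, hc⟩ := E.exists_eigenvalue h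
  obtain ⟨n, hn⟩ := E.exists_deletingCoeff_eq_zero r
  have hn0 : ∀ i, n ≤ i → E.deletingCoeff i r = 0 := fun i hi => hn i 0 hi
  have hn1 : ∀ i, n ≤ i → E.deletingCoeff i (h • r) = 0 := fun i hi => by
    have := E.deletingCoeff_smul hc i r
    rw [hn0 i hi, smul_zero] at this
    exact (smul_eq_zero.1 this).resolve_left (pow_ne_zero _ hc0)
  rw [deletingHom_apply, deletingHom_apply, E.derivationDeleting_eq_sum hn0,
    E.derivationDeleting_eq_sum hn1, map_sum]
  refine Finset.sum_congr rfl fun l _ => ?_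
  rw [map_mul, E.locMap_zpow hc0 hc, locMap_toLoc, ← E.incl_smul, ← E.deletingCoeff_smul hc,
    map_smul, toLoc_smul, smul_mul_smul_comm, zpow_neg, zpow_natCast,
    mul_inv_cancel₀ (pow_ne_zero _ hc0), one_smul]

theorem locMap_monomial {h : H} {c : k} (hc0 : c ≠ 0) (hc : h • E.x = c • E.x) (r : R) (i : ℤ) :
    E.locMap h (E.deletingHom r * ((E.xUnit ^ i : (E.Loc)ˣ) : E.Loc)) =
      c ^ i • (E.deletingHom (h • r) * ((E.xUnit ^ i : (E.Loc)ˣ) : E.Loc)) := by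
  rw [map_mul, locMap_deletingHom, E.locMap_zpow hc0 hc, mul_smul_comm]

theorem isHStable_tildeC {Q : TwoSidedIdeal R} (hQ : IsHStable H Q) :
    IsHStable H (E.tildeC Q) := by
  intro h s hs
  rw [E.mem_tildeC hQ] at hs ⊢
  obtain ⟨c, hc0, hc⟩ := E.exists_eigenvalue h
  rw [← locMap_toLoc]
  refine E.mem_of_laurentCoeffs_mem
    (A := (E.laurentIdeal Q hQ).asIdeal.toAddSubgroup.comap (E.locMap h : E.Loc →+ E.Loc))
    (fun r hr i => ?_) ((E.mem_laurentIdeal hQ).1 hs)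
  change E.locMap h _ ∈ E.laurentIdeal Q hQ
  rw [E.locMap_monomial hc0 hc, Algebra.smul_def]
  exact TwoSidedIdeal.mul_mem_left _ _ _ ((E.monomial_mem_laurentIdeal_iff hQ).2 (hQ _ _ hr))

theorem isHPrime_tildeC {Q : TwoSidedIdeal R} (hQ : IsHPrime H Q) : IsHPrime H (E.tildeC Q) :=
  (E.isCompletelyPrimeIdeal_tildeC hQ.stable (E.completelyPrime Q hQ)).isHPrime
    (E.isHStable_tildeC hQ.stable)

theorem mul_mem_tildeC {I J Q : TwoSidedIdeal R} (hI : IsHStable H I) (hJ : IsHStable H J)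
    (hQ : IsHStable H Q) (h : ∀ a ∈ I, ∀ b ∈ J, a * b ∈ Q) {s t : S} (hs : s ∈ E.tildeC I)
    (ht : t ∈ E.tildeC J) : s * t ∈ E.tildeC Q := by
  rw [E.mem_tildeC hI, mem_laurentIdeal] at hs
  rw [E.mem_tildeC hJ, mem_laurentIdeal] at ht
  rw [E.mem_tildeC hQ, map_mul, ← E.laurent_laurentCoeffs (E.toLoc s),
    ← E.laurent_laurentCoeffs (E.toLoc t), laurent_apply, laurent_apply, Finset.sum_mul_sum]
  refine sum_mem fun i _ => sum_mem fun j _ => ?_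
  rw [deletingHom_mul_zpow_mul, monomial_mem_laurentIdeal_iff]
  exact h _ (hs i) _ (E.pow_τ_mem hJ _ (ht j))

/-! ### Extension of ideals to the localization -/

section Extension

variable (P : TwoSidedIdeal S)

/-- The left ideal of the localization generated by an ideal of the Ore extension. -/
def extension : AddSubgroup E.Loc where
  carrier := {y | ∃ n : ℕ, ∃ s ∈ P, ((E.xUnit ^ n : (E.Loc)ˣ) : E.Loc) * y = E.toLoc s}
  zero_mem' := ⟨0, 0, P.zero_mem, by simp⟩
  add_mem' := by
    rintro y z ⟨n, s, hs, h⟩ ⟨m, t, ht, h'⟩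
    refine ⟨n + m, E.x ^ m * s + E.x ^ n * t,
      P.add_mem (P.mul_mem_left _ _ hs) (P.mul_mem_left _ _ ht), ?_⟩
    have e : ∀ n : ℕ, E.toLoc (E.x ^ n) = ((E.xUnit ^ n : (E.Loc)ˣ) : E.Loc) := fun n => by
      rw [← coe_xUnit_zpow_natCast, zpow_natCast]
    rw [map_add, map_mul, map_mul, ← h, ← h', e, e, ← mul_assoc, ← mul_assoc, ← Units.val_mul,
      ← Units.val_mul, ← pow_add, ← pow_add, add_comm m n, mul_add]
  neg_mem' := by
    rintro y ⟨n, s, hs, h⟩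
    exact ⟨n, -s, P.neg_mem hs, by rw [mul_neg, h, map_neg]⟩

theorem toLoc_pow (n : ℕ) : E.toLoc (E.x ^ n) = ((E.xUnit ^ n : (E.Loc)ˣ) : E.Loc) := by
  rw [← coe_xUnit_zpow_natCast, zpow_natCast]

variable {P}

/-- The Ore condition `x^N s = g x^n` moves the denominator of `l` past that of `y`. -/
theorem mul_mem_extension (l : E.Loc) {y : E.Loc} (hy : y ∈ E.extension P) :
    l * y ∈ E.extension P := by
  obtain ⟨n, p, hp, h⟩ := hy
  obtain ⟨m, s, hs⟩ := E.exists_pow_mul_eq_toLoc l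
  obtain ⟨N, g, hg⟩ := E.exists_pow_mul s n
  refine ⟨N + m, g * p, P.mul_mem_left _ _ hp, ?_⟩
  rw [pow_add, Units.val_mul, mul_assoc, ← mul_assoc _ l, hs, ← mul_assoc, ← toLoc_pow, ← map_mul,
    hg, map_mul, mul_assoc, toLoc_pow, h, ← map_mul]

theorem mul_toLoc_mem_extension {y : E.Loc} (hy : y ∈ E.extension P) (s : S) :
    y * E.toLoc s ∈ E.extension P := by
  obtain ⟨n, p, hp, h⟩ := hy
  exact ⟨n, p * s, P.mul_mem_right _ _ hp, by rw [← mul_assoc, h, map_mul]⟩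

theorem unit_mul_mem_extension_iff (v : (E.Loc)ˣ) {y : E.Loc} :
    (v : E.Loc) * y ∈ E.extension P ↔ y ∈ E.extension P := by
  refine ⟨fun h => ?_, fun h => E.mul_mem_extension _ h⟩
  simpa using E.mul_mem_extension (v⁻¹ : (E.Loc)ˣ) h

theorem locMap_mem_extension (hs : IsHStable H P) (h : H) {y : E.Loc} (hy : y ∈ E.extension P) :
    E.locMap h y ∈ E.extension P := by
  obtain ⟨n, p, hp, e⟩ := hy
  obtain ⟨c, hc0, hc⟩ := E.exists_eigenvalue h
  have h1 := congrArg (E.locMap h) e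
  have h2 := E.locMap_zpow hc0 hc n
  rw [zpow_natCast, zpow_natCast] at h2
  rw [map_mul, locMap_toLoc, h2, smul_mul_assoc, ← mul_smul_comm] at h1
  have h3 : c ^ n • E.locMap h y ∈ E.extension P := ⟨n, h • p, hs h p hp, h1⟩
  have h4 := E.mul_mem_extension (algebraMap k E.Loc (c ^ n)⁻¹) h3
  rwa [← Algebra.smul_def, smul_smul, inv_mul_cancel₀ (pow_ne_zero _ hc0), one_smul] at h4

theorem toLoc_mem_extension_iff (hx : ∀ s, E.x * s ∈ P → s ∈ P) {s : S} :
    E.toLoc s ∈ E.extension P ↔ s ∈ P := by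
  constructor
  · rintro ⟨n, p, hp, h⟩
    rw [← toLoc_pow, ← map_mul] at h
    rw [← E.toLoc_injective h] at hp
    clear h
    induction n with
    | zero => simpa using hp
    | succ n ih => rw [pow_succ', mul_assoc] at hp; exact ih (hx _ hp)
  · intro h; exact ⟨0, s, h, by simp⟩

theorem deletingHom_smul_mem_extension_iff (hs : IsHStable H P) (h : H) {r : R} :
    E.deletingHom (h • r) ∈ E.extension P ↔ E.deletingHom r ∈ E.extension P := by
  constructor
  · intro hr
    have := E.locMap_mem_extension hs h⁻¹ hr
    rwa [locMap_deletingHom, inv_smul_smul] at this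
  · intro hr
    rw [← locMap_deletingHom]
    exact E.locMap_mem_extension hs h hr

/-- Stability under right multiplication by `x⁻¹` is not available. Instead left multiplication by
`x^{-i}` turns `C(r) x^i` into `C(τ^{-i} r)`, and `τ^{-i}` is the action of an element of `H`. -/
theorem monomial_mem_extension_iff (hs : IsHStable H P) {r : R} {i : ℤ} :
    E.deletingHom r * ((E.xUnit ^ i : (E.Loc)ˣ) : E.Loc) ∈ E.extension P ↔
      E.deletingHom r ∈ E.extension P := by
  obtain ⟨h, hh⟩ := E.exists_smul_eq_pow_τ (-i)
  rw [← E.unit_mul_mem_extension_iff (E.xUnit ^ (-i)), zpow_mul_deletingHom_mul_zpow,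
    neg_add_cancel, zpow_zero, Units.val_one, mul_one, hh, E.deletingHom_smul_mem_extension_iff hs]

/-- The extension is graded: it is stable under `y ↦ x⁻¹ h₀(y) x`, which is the scalar `μ^i` on
`C(R) x^i`, and these scalars are distinct. -/
theorem monomial_laurentCoeffs_mem_extension [Nontrivial S] (hs : IsHStable H P) {y : E.Loc}
    (hy : y ∈ E.extension P) (i : ℤ) : E.deletingHom (E.laurentCoeffs y i) ∈ E.extension P := by
  obtain ⟨h₀, hh, μ, hμ, hroot⟩ := E.exists_h₀
  have hμ0 : μ ≠ 0 := by
    rintro rfl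
    rw [zero_smul, smul_eq_zero_iff_eq] at hμ
    have h1 := E.coeff_x 1
    rw [hμ, map_zero, if_pos rfl] at h1
    have h2 := congrArg E.incl h1
    rw [map_zero, map_one] at h2
    exact zero_ne_one h2
  have hinj : Function.Injective fun i : ℤ => μ ^ i := by
    intro i j hij
    have h1 : μ ^ (i - j) = 1 := by
      rw [zpow_sub₀ hμ0, div_eq_one_iff_eq (zpow_ne_zero _ hμ0)]
      exact hij
    by_contra hne
    refine hroot (i - j).natAbs (by omega) ?_
    rcases Int.natAbs_eq (i - j) with h | h <;> rw [h] at h1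
    · rwa [zpow_natCast] at h1
    · rwa [zpow_neg, inv_eq_one, zpow_natCast] at h1
  let K : Submodule k E.Loc :=
    { E.extension P with
      smul_mem' := fun c y hy => by
        rw [Algebra.smul_def]
        exact E.mul_mem_extension _ hy }
  have h1 := Submodule.mem_of_sum_eigenvectors_mem (K := K)
    (T := { toFun := fun y => ((E.xUnit⁻¹ : (E.Loc)ˣ) : E.Loc) * (E.locMap h₀ y * E.toLoc E.x)
            map_add' := fun v w => by rw [map_add, add_mul, mul_add]
            map_smul' := fun c v => by
              rw [locMap_smul, smul_mul_assoc, mul_smul_comm, RingHom.id_apply] })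
    (fun v hv => E.mul_mem_extension _
      (E.mul_toLoc_mem_extension (E.locMap_mem_extension hs h₀ hv) _)) hinj
    (v := fun i => E.deletingHom (E.laurentCoeffs y i) * ((E.xUnit ^ i : (E.Loc)ˣ) : E.Loc))
    (fun i => by
      simp only [LinearMap.coe_mk, AddHom.coe_mk]
      rw [E.locMap_monomial hμ0 hμ, hh, smul_mul_assoc, mul_smul_comm, mul_assoc, ← coe_xUnit,
        ← Units.val_mul, ← zpow_add_one, ← zpow_neg_one, zpow_mul_deletingHom_mul_zpow,
        ← AlgEquiv.mul_apply, ← zpow_add_one, neg_add_cancel, zpow_zero, AlgEquiv.one_apply]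
      congr 4
      ring) (E.laurentCoeffs y).support (by
        rw [← laurent_apply, laurent_laurentCoeffs]
        exact hy)
  by_cases hi : i ∈ (E.laurentCoeffs y).support
  · exact (E.monomial_mem_extension_iff hs).1 (h1 i hi)
  · rw [Finsupp.notMem_support_iff.1 hi, map_zero]
    exact zero_mem _

/-- The ideal of `R` whose image under `C` is the degree zero part of the extension of `P`. -/
noncomputable def deletingContract (P : TwoSidedIdeal S) (hs : IsHStable H P) :
    TwoSidedIdeal R :=
  TwoSidedIdeal.mk' {r | E.deletingHom r ∈ E.extension P}
    (by simp [zero_mem])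
    (fun {a b} ha hb => by
      simp only [Set.mem_ofPred_eq, map_add] at *
      exact add_mem ha hb)
    (fun {a} ha => by
      simp only [Set.mem_ofPred_eq, map_neg] at *
      exact neg_mem ha)
    (fun {a b} hb => by
      simp only [Set.mem_ofPred_eq, map_mul] at *
      exact E.mul_mem_extension _ hb)
    (fun {a b} ha => by
      -- Right multiplication is only allowed by elements of `S`, so `C(b) x^m` replaces `C(b)` and
      -- the power of `x` is removed afterwards.
      obtain ⟨m, hm⟩ := E.exists_deletingCoeff_eq_zero b
      have hm' : ∀ l, m < l → E.deletingCoeff l b = 0 := fun l hl => hm l 0 hl.le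
      have h := E.mul_toLoc_mem_extension ha (E.deletingPoly b m)
      rwa [E.toLoc_deletingPoly hm', ← mul_assoc, ← map_mul,
        E.monomial_mem_extension_iff hs] at h)

theorem mem_deletingContract (hs : IsHStable H P) {r : R} :
    r ∈ E.deletingContract P hs ↔ E.deletingHom r ∈ E.extension P := by
  rw [deletingContract, TwoSidedIdeal.mem_mk']; rfl

theorem isHStable_deletingContract (hs : IsHStable H P) :
    IsHStable H (E.deletingContract P hs) := fun h r hr => by
  rw [mem_deletingContract] at hr ⊢
  exact (E.deletingHom_smul_mem_extension_iff hs h).2 hr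

theorem tildeC_deletingContract [Nontrivial S] (hs : IsHStable H P)
    (hx : ∀ s, E.x * s ∈ P → s ∈ P) : E.tildeC (E.deletingContract P hs) = P := by
  ext s
  rw [E.mem_tildeC (E.isHStable_deletingContract hs), ← E.toLoc_mem_extension_iff hx]
  constructor
  · intro h
    refine E.mem_of_laurentCoeffs_mem (fun r hr i => ?_) ((E.mem_laurentIdeal _).1 h)
    rw [E.monomial_mem_extension_iff hs]
    exact (E.mem_deletingContract hs).1 hr
  · intro h
    rw [mem_laurentIdeal]
    intro i
    rw [mem_deletingContract]
    exact E.monomial_laurentCoeffs_mem_extension hs h i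

/-- `tildeC` reflects inclusions and is compatible with products of ideals, so primeness is
inherited from `P`. -/
theorem isHPrime_deletingContract [Nontrivial S] (hP : IsHPrime H P)
    (hx : ∀ s, E.x * s ∈ P → s ∈ P) : IsHPrime H (E.deletingContract P hP.stable) where
  ne_top h := hP.ne_top ((TwoSidedIdeal.one_mem_iff P).1 (by
    have := (E.mem_deletingContract hP.stable).1 ((TwoSidedIdeal.one_mem_iff _).2 h)
    rwa [map_one, ← map_one E.toLoc, E.toLoc_mem_extension_iff hx] at this))
  stable := E.isHStable_deletingContract hP.stable
  le_or_le I J hI hJ h := by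
    have hQ := E.isHStable_deletingContract hP.stable
    rw [← E.tildeC_le_tildeC_iff hI hQ, ← E.tildeC_le_tildeC_iff hJ hQ,
      E.tildeC_deletingContract hP.stable hx]
    refine hP.le_or_le _ _ (E.isHStable_tildeC hI) (E.isHStable_tildeC hJ) fun a ha b hb => ?_
    have := E.mul_mem_tildeC hI hJ hQ h ha hb
    rwa [E.tildeC_deletingContract hP.stable hx] at this

end Extension

end CauchonExtension

/-! ### Generalities on two-sided and `H`-stable ideals -/

theorem TwoSidedIdeal.algebra_smul_mem {k A : Type*} [CommSemiring k] [Ring A] [Algebra k A]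
    (I : TwoSidedIdeal A) (c : k) {a : A} (ha : a ∈ I) : c • a ∈ I := by
  rw [Algebra.smul_def]
  exact I.mul_mem_left _ _ ha

theorem TwoSidedIdeal.algebra_smul_mem_iff {k A : Type*} [Field k] [Ring A] [Algebra k A]
    (I : TwoSidedIdeal A) {c : k} (hc : c ≠ 0) {a : A} : c • a ∈ I ↔ a ∈ I := by
  refine ⟨fun h => ?_, I.algebra_smul_mem c⟩
  simpa [smul_smul, inv_mul_cancel₀ hc] using I.algebra_smul_mem c⁻¹ h

theorem TwoSidedIdeal.wellFoundedGT {A : Type*} [Ring A] [IsNoetherianRing A] :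
    WellFoundedGT (TwoSidedIdeal A) := by
  have : StrictMono (TwoSidedIdeal.asIdeal : TwoSidedIdeal A →o Ideal A) :=
    TwoSidedIdeal.asIdeal.monotone.strictMono_of_injective fun I J h => by
      ext a
      rw [← TwoSidedIdeal.mem_asIdeal, ← TwoSidedIdeal.mem_asIdeal, h]
  exact this.wellFoundedGT

section HStable

variable {H A : Type*} [Group H] [Ring A] [MulSemiringAction H A]

theorem IsHStable.sup {I J : TwoSidedIdeal A} (hI : IsHStable H I) (hJ : IsHStable H J) :
    IsHStable H (I ⊔ J) := by
  intro h a ha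
  obtain ⟨b, hb, c, hc, rfl⟩ := TwoSidedIdeal.mem_sup.1 ha
  rw [smul_add]
  exact TwoSidedIdeal.mem_sup.2 ⟨_, hI h b hb, _, hJ h c hc, rfl⟩

/-- The left annihilator of a left-stable set modulo a two-sided ideal. -/
def TwoSidedIdeal.leftAnnihilator (P : TwoSidedIdeal A) (T : Set A)
    (hT : ∀ a, ∀ t ∈ T, a * t ∈ T) : TwoSidedIdeal A :=
  TwoSidedIdeal.mk' {a | ∀ t ∈ T, a * t ∈ P}
    (fun t _ => by rw [zero_mul]; exact P.zero_mem)
    (fun ha hb t ht => by rw [add_mul]; exact P.add_mem (ha t ht) (hb t ht))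
    (fun ha t ht => by rw [neg_mul]; exact P.neg_mem (ha t ht))
    (fun hb t ht => by rw [mul_assoc]; exact P.mul_mem_left _ _ (hb t ht))
    (fun ha t ht => by rw [mul_assoc]; exact ha _ (hT _ t ht))

theorem TwoSidedIdeal.mem_leftAnnihilator {P : TwoSidedIdeal A} {T : Set A}
    (hT : ∀ a, ∀ t ∈ T, a * t ∈ T) {a : A} :
    a ∈ P.leftAnnihilator T hT ↔ ∀ t ∈ T, a * t ∈ P := by
  rw [leftAnnihilator, TwoSidedIdeal.mem_mk']; rfl

/-- If a set `Z` annihilates an `H`-stable ideal modulo an `H`-prime ideal, then `Z` or the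
`H`-stable ideal is contained in the `H`-prime ideal. -/
theorem IsHPrime.mem_or_le {P : TwoSidedIdeal A} (hP : IsHPrime H P) {T : TwoSidedIdeal A}
    (hT : IsHStable H T) {Z : Set A} (h : ∀ z ∈ Z, ∀ t ∈ T, z * t ∈ P) : Z ⊆ P ∨ T ≤ P := by
  have hT' : ∀ a, ∀ t ∈ (T : Set A), a * t ∈ (T : Set A) := fun a t ht => T.mul_mem_left a t ht
  refine (hP.le_or_le (P.leftAnnihilator T hT') T (fun g a ha => ?_) hT fun a ha b hb => ?_).imp_left
    fun hle z hz => hle ((TwoSidedIdeal.mem_leftAnnihilator hT').2 fun t ht => h z hz t ht)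
  · rw [TwoSidedIdeal.mem_leftAnnihilator] at ha ⊢
    intro t ht
    have := hP.stable g _ (ha (g⁻¹ • t) (hT _ _ ht))
    rwa [smul_mul', smul_inv_smul] at this
  · exact (TwoSidedIdeal.mem_leftAnnihilator hT').1 ha b hb

end HStable

/-! ### Powers of `δ` modulo an `H`-stable ideal -/

namespace CauchonExtension

variable {k H R S : Type*} [Field k] [CommGroup H] [Ring R] [Algebra k R]
    [Ring S] [Algebra k S] [MulSemiringAction H R] [MulSemiringAction H S]
    (E : CauchonExtension k H R S)

theorem qCoeff_ne_zero (l : ℕ) : E.qCoeff l ≠ 0 := by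
  induction l with
  | zero => rw [qCoeff_zero]; exact one_ne_zero
  | succ l ih =>
    intro h
    have := E.qCoeff_succ l
    rw [h, mul_zero] at this
    exact mul_ne_zero (pow_ne_zero _ E.q_ne_zero) ih this.symm

section Ideal

variable {I : TwoSidedIdeal R} (hI : IsHStable H I)

theorem τ_mem_iff {r : R} (hI : IsHStable H I) : E.τ r ∈ I ↔ r ∈ I := by
  simpa using E.pow_τ_mem_iff hI 1 (r := r)

theorem iterate_δ_τ_symm_mem_iff (n j : ℕ) (hI : IsHStable H I) {r : R} :
    E.δ^[n] (E.τ.symm^[j] r) ∈ I ↔ E.δ^[n] r ∈ I := by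
  induction j with
  | zero => rfl
  | succ j ih =>
    rw [← ih, Function.iterate_succ_apply' E.τ.symm]
    generalize E.τ.symm^[j] r = s
    conv_rhs => rw [← E.τ.apply_symm_apply s, iterate_δ_comm,
      I.algebra_smul_mem_iff (pow_ne_zero _ E.q_ne_zero), E.τ_mem_iff hI]

/-- The two elements differ by a nonzero scalar and a power of `τ`. Thus `deletingCoeff_mul` serves
as a Leibniz rule for `δ^n` modulo `I`. -/
theorem deletingCoeff_mem_iff (n j : ℕ) (hI : IsHStable H I) {r : R} :
    E.deletingCoeff n (E.τ.symm^[j] r) ∈ I ↔ E.δ^[n] r ∈ I := by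
  rw [deletingCoeff_apply, I.algebra_smul_mem_iff (E.qCoeff_ne_zero n),
    ← Function.iterate_add_apply, E.iterate_δ_τ_symm_mem_iff _ _ hI]

theorem iterate_δ_smul_mem (n : ℕ) (hI : IsHStable H I) (h : H) {r : R} (hr : E.δ^[n] r ∈ I) :
    E.δ^[n] (h • r) ∈ I := by
  obtain ⟨c, hc0, hc⟩ := E.exists_eigenvalue h
  rw [← E.deletingCoeff_mem_iff n 0 hI, Function.iterate_zero_apply] at hr ⊢
  rw [← I.algebra_smul_mem_iff (pow_ne_zero n hc0), E.deletingCoeff_smul hc]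
  exact hI _ _ hr

theorem iterate_δ_mul_mem {A B : TwoSidedIdeal R} (hA : IsHStable H A) (hB : IsHStable H B)
    (hI : IsHStable H I) (hAB : ∀ a ∈ A, ∀ b ∈ B, a * b ∈ I) {r s : R}
    (hr : ∀ n, E.δ^[n] r ∈ A) (hs : ∀ n, E.δ^[n] s ∈ B) (n : ℕ) : E.δ^[n] (r * s) ∈ I := by
  rw [← E.deletingCoeff_mem_iff n 0 hI, Function.iterate_zero_apply, deletingCoeff_mul]
  exact sum_mem fun p _ => hAB _ ((E.deletingCoeff_mem_iff p.1 0 hA).2 (hr p.1)) _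
    ((E.deletingCoeff_mem_iff _ _ hB).2 (hs p.2))

/-- The largest `δ`-stable ideal contained in an `H`-stable ideal. -/
def core (I : TwoSidedIdeal R) (hI : IsHStable H I) : TwoSidedIdeal R :=
  TwoSidedIdeal.mk' {r | ∀ n, E.δ^[n] r ∈ I}
    (fun n => by rw [Function.iterate_fixed (map_zero E.δ)]; exact I.zero_mem)
    (fun {a b} ha hb n => by rw [iterate_map_add]; exact I.add_mem (ha n) (hb n))
    (fun {a} ha n => by rw [iterate_map_neg]; exact I.neg_mem (ha n))
    (fun {a b} hb => E.iterate_δ_mul_mem (A := ⊤) (fun _ _ _ => trivial) hI hI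
      (fun a _ b hb => I.mul_mem_left a b hb) (fun _ => trivial) hb)
    (fun {a b} ha => E.iterate_δ_mul_mem (B := ⊤) hI (fun _ _ _ => trivial) hI
      (fun a ha b _ => I.mul_mem_right a b ha) ha fun _ => trivial)

theorem mem_core {r : R} : r ∈ E.core I hI ↔ ∀ n, E.δ^[n] r ∈ I := by
  rw [core, TwoSidedIdeal.mem_mk']; rfl

theorem core_le : E.core I hI ≤ I := fun _ hr => (E.mem_core hI).1 hr 0

theorem isHStable_core : IsHStable H (E.core I hI) := fun h r hr => by
  rw [mem_core] at hr ⊢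
  exact fun n => E.iterate_δ_smul_mem n hI h (hr n)

theorem δ_mem_core {r : R} (hr : r ∈ E.core I hI) : E.δ r ∈ E.core I hI := by
  rw [mem_core] at hr ⊢
  exact fun n => hr (n + 1)

theorem exists_max_iterate_δ {r : R} {n : ℕ} (h : E.δ^[n] r ∉ I) :
    ∃ m, n ≤ m ∧ E.δ^[m] r ∉ I ∧ ∀ l, m < l → E.δ^[l] r ∈ I := by
  classical
  obtain ⟨N, hN⟩ := E.δ_locally_nilpotent r
  have hN' : ∀ l, N ≤ l → E.δ^[l] r = 0 := fun l hl => by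
    obtain ⟨d, rfl⟩ := Nat.exists_eq_add_of_le' hl
    rw [Function.iterate_add_apply, hN, Function.iterate_fixed (map_zero E.δ)]
  have hnN : n ≤ N := by
    by_contra hlt
    exact h (by rw [hN' n (by omega)]; exact I.zero_mem)
  refine ⟨Nat.findGreatest (fun m => E.δ^[m] r ∉ I) N, Nat.le_findGreatest hnN h,
    Nat.findGreatest_spec (P := fun m => E.δ^[m] r ∉ I) hnN h, fun l hl => ?_⟩
  by_contra hl'
  rcases le_or_gt l N with h1 | h1
  · exact absurd (Nat.le_findGreatest h1 hl') (not_le.2 hl)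
  · exact hl' (by rw [hN' l h1.le]; exact I.zero_mem)

/-- The last power of `δ` that keeps an element outside `I` behaves like a degree. In the Leibniz
rule for `δ^(n+m)` only the term `(n, m)` lies outside `I`, so degrees add. -/
theorem iterate_δ_mul_not_mem (hI : IsHStable H I) (hc : IsCompletelyPrimeIdeal I) {r s : R}
    {n m : ℕ} (hn : E.δ^[n] r ∉ I) (hn' : ∀ l, n < l → E.δ^[l] r ∈ I)
    (hm : E.δ^[m] s ∉ I) (hm' : ∀ l, m < l → E.δ^[l] s ∈ I) :
    E.δ^[n + m] (r * s) ∉ I ∧ ∀ l, n + m < l → E.δ^[l] (r * s) ∈ I := by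
  have hterm : ∀ l j : ℕ, (n < l ∨ m < j) →
      E.deletingCoeff l r * E.deletingCoeff j (E.τ.symm^[l] s) ∈ I := by
    rintro l j (h | h)
    · exact I.mul_mem_right _ _ ((E.deletingCoeff_mem_iff l 0 hI).2 (hn' l h))
    · exact I.mul_mem_left _ _ ((E.deletingCoeff_mem_iff _ _ hI).2 (hm' j h))
  constructor
  · rw [← E.deletingCoeff_mem_iff (n + m) 0 hI, Function.iterate_zero_apply, deletingCoeff_mul]
    intro h
    have hmem : (n, m) ∈ Finset.HasAntidiagonal.antidiagonal (n + m) :=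
      Finset.HasAntidiagonal.mem_antidiagonal.2 rfl
    rw [← Finset.add_sum_erase _ _ hmem, add_mem_cancel_right] at h
    · rcases hc.2 _ _ h with h | h
      · exact hn ((E.deletingCoeff_mem_iff n 0 hI).1 h)
      · exact hm ((E.deletingCoeff_mem_iff _ _ hI).1 h)
    · refine sum_mem fun p hp => hterm _ _ ?_
      have h1 := Finset.HasAntidiagonal.mem_antidiagonal.1 (Finset.mem_of_mem_erase hp)
      have h2 := Finset.ne_of_mem_erase hp
      by_contra h3
      exact h2 (Prod.ext (by simp only; omega) (by simp only; omega))
  · intro l hl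
    rw [← E.deletingCoeff_mem_iff l 0 hI, Function.iterate_zero_apply, deletingCoeff_mul]
    refine sum_mem fun p hp => hterm _ _ ?_
    have h1 := Finset.HasAntidiagonal.mem_antidiagonal.1 hp
    omega

theorem isCompletelyPrimeIdeal_core (hc : IsCompletelyPrimeIdeal I) :
    IsCompletelyPrimeIdeal (E.core I hI) := by
  refine ⟨fun h => hc.1 (top_le_iff.1 (h ▸ E.core_le hI)), fun a b hab => ?_⟩
  by_contra hcon
  rw [not_or, mem_core, mem_core, not_forall, not_forall] at hcon
  obtain ⟨⟨n₀, hn₀⟩, m₀, hm₀⟩ := hcon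
  obtain ⟨n, -, hn, hn'⟩ := E.exists_max_iterate_δ hn₀
  obtain ⟨m, -, hm, hm'⟩ := E.exists_max_iterate_δ hm₀
  exact (E.iterate_δ_mul_not_mem hI hc hn hn' hm hm').1 ((E.mem_core hI).1 hab _)

/-- A locally nilpotent skew derivation which is nilpotent modulo a completely prime ideal
vanishes modulo this ideal. -/
theorem δ_mem_of_iterate_mem (hI : IsHStable H I) (hc : IsCompletelyPrimeIdeal I) {N : ℕ}
    (h : ∀ r, E.δ^[N] r ∈ I) (hδ : ∀ r ∈ I, E.δ r ∈ I) (r : R) : E.δ r ∈ I := by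
  by_contra hr
  obtain ⟨n, hn1, hn, hn'⟩ := E.exists_max_iterate_δ (n := 1) hr
  -- If `r` has degree `n ≥ 1`, its powers have unbounded degree, against the nilpotency of `δ`
  -- modulo `I`.
  have key : ∀ j : ℕ, E.δ^[(j + 1) * n] (r ^ (j + 1)) ∉ I ∧
      ∀ l, (j + 1) * n < l → E.δ^[l] (r ^ (j + 1)) ∈ I := by
    intro j
    induction j with
    | zero => simpa using ⟨hn, hn'⟩
    | succ j ih =>
      rw [pow_succ, add_mul _ 1 n, one_mul]
      exact E.iterate_δ_mul_not_mem hI hc ih.1 ih.2 hn hn'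
  refine (key N).1 ?_
  have hle : N ≤ (N + 1) * n := by nlinarith
  obtain ⟨d, hd⟩ := Nat.exists_eq_add_of_le' hle
  rw [hd, Function.iterate_add_apply]
  have hs : E.δ^[N] (r ^ (N + 1)) ∈ I := h _
  generalize E.δ^[N] (r ^ (N + 1)) = s at hs ⊢
  clear hd
  induction d generalizing s with
  | zero => exact hs
  | succ d ih => exact ih _ (hδ _ hs)

end Ideal

/-! ### Contraction of `H`-prime ideals -/

section Contract

variable {P : TwoSidedIdeal S}

theorem mem_contract {r : R} : r ∈ E.contract P ↔ E.incl r ∈ P := by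
  rw [contract, TwoSidedIdeal.mem_comap]

theorem isHStable_contract (hP : IsHStable H P) : IsHStable H (E.contract P) := fun h r hr => by
  rw [mem_contract] at hr ⊢
  rw [E.incl_smul]
  exact hP _ _ hr

theorem incl_δ (r : R) : E.incl (E.δ r) = E.x * E.incl r - E.incl (E.τ r) * E.x := by
  rw [E.x_mul]; abel

theorem δ_mem_contract (hP : IsHStable H P) {r : R} (hr : r ∈ E.contract P) :
    E.δ r ∈ E.contract P := by
  have h := E.τ_mem (E.isHStable_contract hP) hr
  rw [mem_contract] at hr h ⊢
  rw [incl_δ]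
  exact P.sub_mem (P.mul_mem_left _ _ hr) (P.mul_mem_right _ _ h)

/-- As `A` is stable under `δ` and `τ⁻¹`, the relation `a x = x τ⁻¹(a) - δ(τ⁻¹(a))` makes `{s | A s
⊆ P}` a two-sided ideal of `S`. It contains `B`, and `H`-primeness applies to it. -/
theorem le_contract_or_le (hP : IsHPrime H P) {A B : TwoSidedIdeal R} (hA : IsHStable H A)
    (hA' : ∀ a ∈ A, E.δ a ∈ A)
    (h : ∀ a ∈ A, ∀ b ∈ B, a * b ∈ E.contract P) : A ≤ E.contract P ∨ B ≤ E.contract P := by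
  have hleft : ∀ s t : S, (∀ a ∈ A, E.incl a * t ∈ P) → ∀ a ∈ A, E.incl a * (s * t) ∈ P := by
    intro s
    refine E.generator_induction s (fun r t ht a ha => ?_) (fun t ht a ha => ?_)
      (fun s s' hs hs' t ht a ha => ?_) (fun s s' hs hs' t ht => ?_)
    · rw [← mul_assoc, ← map_mul]
      exact ht _ (A.mul_mem_right _ _ ha)
    · have ha' : E.τ.symm a ∈ A := (E.τ_mem_iff hA).1 (by rwa [E.τ.apply_symm_apply])
      have e : E.incl a * (E.x * t) =
          E.x * (E.incl (E.τ.symm a) * t) - E.incl (E.δ (E.τ.symm a)) * t := by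
        rw [incl_δ, E.τ.apply_symm_apply]; noncomm_ring
      rw [e]
      exact P.sub_mem (P.mul_mem_left _ _ (ht _ ha')) (ht _ (hA' _ ha'))
    · rw [add_mul, mul_add]
      exact P.add_mem (hs t ht a ha) (hs' t ht a ha)
    · rw [mul_assoc]
      exact hs _ (hs' t ht)
  let T : TwoSidedIdeal S := TwoSidedIdeal.mk' {s | ∀ a ∈ A, E.incl a * s ∈ P}
    (fun a _ => by rw [mul_zero]; exact P.zero_mem)
    (fun hs ht a ha => by rw [mul_add]; exact P.add_mem (hs a ha) (ht a ha))
    (fun hs a ha => by rw [mul_neg]; exact P.neg_mem (hs a ha))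
    (fun {s t} ht => hleft s t ht)
    (fun hs a ha => by rw [← mul_assoc]; exact P.mul_mem_right _ _ (hs a ha))
  have hT : ∀ s, s ∈ T ↔ ∀ a ∈ A, E.incl a * s ∈ P := fun s => by
    rw [TwoSidedIdeal.mem_mk']; rfl
  have hTs : IsHStable H T := fun g s hs => by
    rw [hT] at hs ⊢
    intro a ha
    have := hP.stable g _ (hs (g⁻¹ • a) (hA _ _ ha))
    rwa [smul_mul', ← E.incl_smul, smul_inv_smul] at this
  rcases hP.mem_or_le hTs (Z := E.incl '' A) (by
    rintro _ ⟨a, ha, rfl⟩ t ht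
    exact (hT t).1 ht a ha) with h1 | h1
  · exact Or.inl fun a ha => E.mem_contract.2 (h1 ⟨a, ha, rfl⟩)
  · refine Or.inr fun b hb => E.mem_contract.2 (h1 ((hT _).2 fun a ha => ?_))
    rw [← map_mul]
    exact E.mem_contract.1 (h a ha b hb)

/-- Among the `H`-stable ideals containing `J = P ∩ R` whose largest `δ`-stable subideal lies in
`J`, take a maximal `I`. Maximality and `le_contract_or_le` make `I` an `H`-prime, hence completely
prime, and `J = core I` inherits this. -/
theorem isHPrime_contract (hP : IsHPrime H P) : IsHPrime H (E.contract P) := by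
  have := E.noetherian_left
  have := TwoSidedIdeal.wellFoundedGT (A := R)
  set J := E.contract P with hJdef
  have hJ : IsHStable H J := E.isHStable_contract hP.stable
  have hJcore : ∀ {I} (hI : IsHStable H I), J ≤ I → J ≤ E.core I hI := fun hI hle r hr => by
    rw [mem_core]
    intro n
    refine hle ?_
    induction n generalizing r with
    | zero => exact hr
    | succ n ih => exact ih _ (E.δ_mem_contract hP.stable hr)
  obtain ⟨I, ⟨hI, hJI, hcore⟩, hmax⟩ := wellFounded_gt.has_min
    {I : TwoSidedIdeal R | ∃ hI : IsHStable H I, J ≤ I ∧ E.core I hI ≤ J}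
    ⟨J, hJ, le_rfl, E.core_le hJ⟩
  have hIP : IsHPrime H I := by
    refine ⟨fun htop => ?_, hI, fun A B hA hB hAB => ?_⟩
    · have h1 : (1 : R) ∈ J := hcore ((E.mem_core hI).2 fun n => htop ▸ trivial)
      rw [mem_contract, map_one] at h1
      exact hP.ne_top ((TwoSidedIdeal.one_mem_iff P).1 h1)
    · by_contra hcon
      rw [not_or] at hcon
      have hnot : ∀ {A : TwoSidedIdeal R} (hA : IsHStable H A), ¬ A ≤ I →
          ¬ E.core (A ⊔ I) (hA.sup hI) ≤ J := fun {A} hA hAI h =>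
        hmax (A ⊔ I) ⟨hA.sup hI, hJI.trans le_sup_right, h⟩
          (lt_of_le_of_ne le_sup_right fun e => hAI (e ▸ le_sup_left))
      refine (E.le_contract_or_le hP (E.isHStable_core (hA.sup hI))
        (B := E.core (B ⊔ I) (hB.sup hI)) (fun a ha => E.δ_mem_core _ ha) fun a ha b hb => ?_).elim
        (hnot hA hcon.1) (hnot hB hcon.2)
      refine hcore ((E.mem_core hI).2 (E.iterate_δ_mul_mem (hA.sup hI) (hB.sup hI) hI ?_
        ((E.mem_core _).1 ha) ((E.mem_core _).1 hb)))
      intro a ha b hb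
      obtain ⟨a₁, ha₁, a₂, ha₂, rfl⟩ := TwoSidedIdeal.mem_sup.1 ha
      obtain ⟨b₁, hb₁, b₂, hb₂, rfl⟩ := TwoSidedIdeal.mem_sup.1 hb
      rw [add_mul, mul_add]
      exact I.add_mem (I.add_mem (hAB _ ha₁ _ hb₁) (I.mul_mem_left _ _ hb₂))
        (I.mul_mem_right _ _ ha₂)
  have hJI' : J = E.core I hI := le_antisymm (hJcore hI hJI) hcore
  rw [hJI']
  exact (E.isCompletelyPrimeIdeal_core hI (E.completelyPrime I hIP)).isHPrime
    (E.isHStable_core hI)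

/-! ### Torsion modulo an `H`-prime ideal -/

/-- Expanding `δ(r) = x r - τ(r) x` trades each `δ` for an `x` on the left or right. With `2N` of
them in all, one side carries at least `N`. -/
theorem iterate_δ_mem_of_pow_mem {N : ℕ} (hN : E.x ^ N ∈ P) (M : ℕ) :
    ∀ (a b : ℕ) (r : R), 2 * N ≤ a + b + M →
      E.x ^ a * E.incl (E.δ^[M] r) * E.x ^ b ∈ P := by
  have hpow : ∀ a, N ≤ a → E.x ^ a ∈ P := fun a ha => by
    obtain ⟨d, rfl⟩ := Nat.exists_eq_add_of_le ha
    rw [pow_add]; exact P.mul_mem_right _ _ hN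
  induction M with
  | zero =>
    intro a b r h
    rcases le_or_gt N a with ha | ha
    · exact P.mul_mem_right _ _ (P.mul_mem_right _ _ (hpow a ha))
    · exact P.mul_mem_left _ _ (hpow b (by omega))
  | succ M ih =>
    intro a b r h
    have hτ : E.τ (E.δ^[M] r) = (E.q ^ M)⁻¹ • E.δ^[M] (E.τ r) := by
      rw [iterate_δ_comm, inv_smul_smul₀ (pow_ne_zero _ E.q_ne_zero)]
    have e : E.x ^ a * E.incl (E.δ^[M + 1] r) * E.x ^ b =
        E.x ^ (a + 1) * E.incl (E.δ^[M] r) * E.x ^ b -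
          (E.q ^ M)⁻¹ • (E.x ^ a * E.incl (E.δ^[M] (E.τ r)) * E.x ^ (b + 1)) := by
      rw [Function.iterate_succ_apply', incl_δ, hτ, map_smul, pow_succ, pow_succ']
      rw [mul_sub, sub_mul, smul_mul_assoc, mul_smul_comm, smul_mul_assoc]
      simp only [mul_assoc]
    rw [e]
    exact P.sub_mem (ih _ _ _ (by omega)) (P.algebra_smul_mem _ (ih _ _ _ (by omega)))

theorem exists_mul_x_sub_mem (h : ∀ r, E.δ r ∈ E.contract P) (s : S) :
    ∃ t, E.x * s - t * E.x ∈ P := by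
  refine E.generator_induction s (fun r => ⟨E.incl (E.τ r), ?_⟩) ⟨E.x, ?_⟩ ?_ ?_
  · rw [← incl_δ]; exact E.mem_contract.1 (h r)
  · rw [sub_self]; exact P.zero_mem
  · rintro s s' ⟨t, ht⟩ ⟨t', ht'⟩
    refine ⟨t + t', ?_⟩
    rw [mul_add, add_mul, add_sub_add_comm]
    exact P.add_mem ht ht'
  · rintro s s' ⟨t, ht⟩ ⟨t', ht'⟩
    refine ⟨t * t', ?_⟩
    have e : E.x * (s * s') - t * t' * E.x =
        (E.x * s - t * E.x) * s' + t * (E.x * s' - t' * E.x) := by noncomm_ring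
    rw [e]
    exact P.add_mem (P.mul_mem_right _ _ ht) (P.mul_mem_left _ _ ht')

/-- `δ` is nilpotent modulo the completely prime ideal `P ∩ R`, hence zero modulo it. Then `x S ⊆ S
x + P`, so `{s | x s ∈ P}` is a two-sided ideal; were it inside `P`, descending from `x ^ N` would
give `1 ∈ P`. -/
theorem x_mem_of_pow_mem (hP : IsHPrime H P) {N : ℕ} (hN : E.x ^ N ∈ P) : E.x ∈ P := by
  have hc := E.completelyPrime _ (E.isHPrime_contract hP)
  have hδ : ∀ r, E.δ r ∈ E.contract P :=
    E.δ_mem_of_iterate_mem (N := 2 * N) (E.isHStable_contract hP.stable) hc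
      (fun r => by
        have := E.iterate_δ_mem_of_pow_mem hN (2 * N) 0 0 r (by omega)
        rw [mem_contract]
        simpa using this)
      fun r hr => E.δ_mem_contract hP.stable hr
  let T : TwoSidedIdeal S := TwoSidedIdeal.mk' {s | E.x * s ∈ P}
    (by simp [P.zero_mem])
    (fun hs ht => by
      simp only [Set.mem_ofPred_eq, mul_add] at *
      exact P.add_mem hs ht)
    (fun hs => by
      simp only [Set.mem_ofPred_eq, mul_neg] at *
      exact P.neg_mem hs)
    (fun {s t} ht => by
      obtain ⟨s', hs'⟩ := E.exists_mul_x_sub_mem hδ s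
      have e : E.x * (s * t) = (E.x * s - s' * E.x) * t + s' * (E.x * t) := by noncomm_ring
      simp only [Set.mem_ofPred_eq] at *
      rw [e]
      exact P.add_mem (P.mul_mem_right _ _ hs') (P.mul_mem_left _ _ ht))
    (fun {s t} hs => by
      simp only [Set.mem_ofPred_eq, ← mul_assoc] at *
      exact P.mul_mem_right _ _ hs)
  have hT : ∀ s, s ∈ T ↔ E.x * s ∈ P := fun s => by rw [TwoSidedIdeal.mem_mk']; rfl
  have hTs : IsHStable H T := fun g s hs => by
    rw [hT] at hs ⊢
    obtain ⟨c, hc0, hc⟩ := E.exists_eigenvalue g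
    have := hP.stable g _ hs
    rwa [smul_mul', hc, smul_mul_assoc, P.algebra_smul_mem_iff hc0] at this
  rcases hP.mem_or_le hTs (Z := {E.x}) (by
    rintro _ rfl t ht
    exact (hT t).1 ht) with h1 | h1
  · exact h1 rfl
  · exfalso
    have h0 : ∀ n, E.x ^ n ∈ P → (1 : S) ∈ P := fun n => by
      induction n with
      | zero => intro h; simpa using h
      | succ n ih => intro h; exact ih (h1 ((hT _).2 (by rwa [← pow_succ'])))
    exact hP.ne_top ((TwoSidedIdeal.one_mem_iff P).1 (h0 N hN))

/-- The right ideals `{s | x^n s ∈ P}` stabilize, and by the Ore condition the stable one is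
two-sided. It is annihilated modulo `P` by `x ^ N`, which is not in `P`, so it lies in `P`. -/
theorem mem_of_x_mul_mem (hP : IsHPrime H P) (hx : E.x ∉ P) {s : S} (hs : E.x * s ∈ P) :
    s ∈ P := by
  let T₀ : ℕ → AddSubgroup S := fun n =>
    P.asIdeal.toAddSubgroup.comap (AddMonoidHom.mulLeft (E.x ^ n))
  have hT₀ : ∀ n s, s ∈ T₀ n ↔ E.x ^ n * s ∈ P := fun n s => Iff.rfl
  have hmono : Monotone T₀ := fun m n h s hs => by
    obtain ⟨d, rfl⟩ := Nat.exists_eq_add_of_le' h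
    rw [hT₀] at hs ⊢
    rw [pow_add, mul_assoc]
    exact P.mul_mem_left _ _ hs
  obtain ⟨N, hN⟩ := E.exists_stable_right_ideal T₀ (fun n s hs t => by
    rw [hT₀] at hs ⊢
    rw [← mul_assoc]
    exact P.mul_mem_right _ _ hs) hmono
  let T : TwoSidedIdeal S := TwoSidedIdeal.mk' {s | E.x ^ N * s ∈ P}
    (by exact (T₀ N).zero_mem) (by exact fun hs ht => (T₀ N).add_mem hs ht)
    (by exact fun hs => (T₀ N).neg_mem hs)
    (fun {s t} ht => by
      obtain ⟨M, g, hg⟩ := E.exists_pow_mul s N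
      refine hN M ((hT₀ _ _).2 ?_)
      rw [← mul_assoc, hg, mul_assoc]
      exact P.mul_mem_left _ _ ht)
    (fun {s t} hs => by
      simp only [Set.mem_ofPred_eq, ← mul_assoc] at *
      exact P.mul_mem_right _ _ hs)
  have hT : ∀ s, s ∈ T ↔ E.x ^ N * s ∈ P := TwoSidedIdeal.mem_mk' _ _ _ _ _ _
  have hTs : IsHStable H T := fun g s hs => by
    rw [hT] at hs ⊢
    obtain ⟨c, hc0, hc⟩ := E.exists_eigenvalue g
    have := hP.stable g _ hs
    rwa [smul_mul', smul_pow', hc, smul_pow, smul_mul_assoc,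
      P.algebra_smul_mem_iff (pow_ne_zero _ hc0)] at this
  rcases hP.mem_or_le hTs (Z := {E.x ^ N}) (by
    rintro _ rfl t ht
    exact (hT t).1 ht) with h1 | h1
  · exact absurd (E.x_mem_of_pow_mem hP (h1 rfl)) hx
  · exact h1 ((hT s).2 (hN 1 ((hT₀ _ _).2 (by rwa [pow_one]))))

theorem exists_tildeC_eq (hP : IsHPrime H P) (hx : E.x ∉ P) :
    ∃ Q, IsHPrime H Q ∧ E.tildeC Q = P := by
  have : Nontrivial S := ⟨E.x, 0, fun h => hx (h ▸ P.zero_mem)⟩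
  have h : ∀ s, E.x * s ∈ P → s ∈ P := fun s => E.mem_of_x_mul_mem hP hx
  exact ⟨_, E.isHPrime_deletingContract hP h, E.tildeC_deletingContract hP.stable h⟩

end Contract

/-! ### Ideals containing `x` -/

theorem exists_sub_incl_coeff_eq (s : S) : ∃ t, s - E.incl (E.coeff 0 s) = t * E.x := by
  refine E.monomial_induction s ⟨0, by simp⟩ ?_ fun r n => ?_
  · rintro s s' ⟨t, ht⟩ ⟨t', ht'⟩
    exact ⟨t + t', by rw [add_mul, ← ht, ← ht', map_add, map_add]; abel⟩
  · cases n with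
    | zero => exact ⟨0, by simp [coeff_incl]⟩
    | succ n =>
      exact ⟨E.incl r * E.x ^ n, by
        rw [coeff_monomial, if_neg (by omega), map_zero, sub_zero, mul_assoc, pow_succ]⟩

theorem coeff_zero_smul (h : H) (s : S) : E.coeff 0 (h • s) = h • E.coeff 0 s := by
  obtain ⟨c, -, hc⟩ := E.exists_eigenvalue h
  refine E.monomial_induction s (by simp) (fun s t hs ht => ?_) fun r n => ?_
  · rw [smul_add, map_add, map_add, hs, ht, smul_add]
  · rw [smul_mul', smul_pow', hc, smul_pow, mul_smul_comm, ← E.incl_smul, ← smul_mul_assoc,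
      ← map_smul, coeff_monomial, coeff_monomial]
    split_ifs with hn
    · rw [hn, pow_zero, one_smul]
    · rw [smul_zero]

section

variable {Q : TwoSidedIdeal R}

/-- Left multiplication by `x` contributes only values of `δ` to the constant term. So the constant
term induces a ring map from `S` to `R/Q`, whose kernel is `Q_x` (`mem_adjoinX`). -/
theorem coeff_zero_mul_sub_mem (hδ : ∀ r, E.δ r ∈ Q) (s : S) :
    ∀ t, E.coeff 0 (s * t) - E.coeff 0 s * E.coeff 0 t ∈ Q := by
  refine E.generator_induction s (fun r t => ?_) (fun t => ?_) (fun s s' hs hs' t => ?_)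
    fun s s' hs hs' t => ?_
  · rw [coeff_incl_mul, coeff_incl, if_pos rfl, sub_self]
    exact Q.zero_mem
  · rw [coeff_x_mul_zero, coeff_x, if_neg one_ne_zero, zero_mul, sub_zero]
    exact hδ _
  · rw [add_mul, map_add, map_add, add_mul, add_sub_add_comm]
    exact Q.add_mem (hs t) (hs' t)
  · have e : E.coeff 0 (s * s' * t) - E.coeff 0 (s * s') * E.coeff 0 t =
        (E.coeff 0 (s * (s' * t)) - E.coeff 0 s * E.coeff 0 (s' * t)) +
        E.coeff 0 s * (E.coeff 0 (s' * t) - E.coeff 0 s' * E.coeff 0 t) -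
        (E.coeff 0 (s * s') - E.coeff 0 s * E.coeff 0 s') * E.coeff 0 t := by
      rw [mul_assoc s s' t]; noncomm_ring
    rw [e]
    exact Q.sub_mem (Q.add_mem (hs _) (Q.mul_mem_left _ _ (hs' t))) (Q.mul_mem_right _ _ (hs s'))

theorem coeff_zero_mul_mem_iff (hδ : ∀ r, E.δ r ∈ Q) (s t : S) :
    E.coeff 0 (s * t) ∈ Q ↔ E.coeff 0 s * E.coeff 0 t ∈ Q := by
  rw [← sub_add_cancel (E.coeff 0 (s * t)) (E.coeff 0 s * E.coeff 0 t)]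
  exact add_mem_cancel_left (E.coeff_zero_mul_sub_mem hδ s t)

theorem mem_adjoinX (hδ : ∀ r, E.δ r ∈ Q) {s : S} : s ∈ E.adjoinX Q ↔ E.coeff 0 s ∈ Q := by
  constructor
  · intro hs
    have hle : E.adjoinX Q ≤ TwoSidedIdeal.mk' {s | E.coeff 0 s ∈ Q}
        (by rw [Set.mem_ofPred_eq, map_zero]; exact Q.zero_mem)
        (fun hs ht => by rw [Set.mem_ofPred_eq, map_add]; exact Q.add_mem hs ht)
        (fun hs => by rw [Set.mem_ofPred_eq, map_neg]; exact Q.neg_mem hs)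
        (fun ht => (E.coeff_zero_mul_mem_iff hδ _ _).2 (Q.mul_mem_left _ _ ht))
        (fun hs => (E.coeff_zero_mul_mem_iff hδ _ _).2 (Q.mul_mem_right _ _ hs)) := by
      rw [adjoinX, TwoSidedIdeal.span_le]
      rintro _ (⟨r, hr, rfl⟩ | rfl)
      · refine (TwoSidedIdeal.mem_mk' _ _ _ _ _ _ _).2 ?_
        rw [Set.mem_ofPred_eq, coeff_incl, if_pos rfl]
        exact hr
      · refine (TwoSidedIdeal.mem_mk' _ _ _ _ _ _ _).2 ?_
        rw [Set.mem_ofPred_eq, coeff_x, if_neg one_ne_zero]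
        exact Q.zero_mem
    have h := hle hs
    rw [TwoSidedIdeal.mem_mk'] at h
    exact h
  · intro hs
    obtain ⟨t, ht⟩ := E.exists_sub_incl_coeff_eq s
    rw [← sub_add_cancel s (E.incl (E.coeff 0 s)), ht]
    exact TwoSidedIdeal.add_mem _
      (TwoSidedIdeal.mul_mem_left _ _ _ (TwoSidedIdeal.subset_span (Or.inr rfl)))
      (TwoSidedIdeal.subset_span (Or.inl ⟨_, hs, rfl⟩))

theorem isHPrime_adjoinX (hQ : IsHPrime H Q) (hδ : ∀ r, E.δ r ∈ Q) :
    IsHPrime H (E.adjoinX Q) := by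
  have hc := E.completelyPrime Q hQ
  refine IsCompletelyPrimeIdeal.isHPrime ⟨fun h => hc.1 ?_, fun a b hab => ?_⟩ fun h s hs => ?_
  · have h1 : (1 : S) ∈ E.adjoinX Q := h ▸ trivial
    rw [E.mem_adjoinX hδ, ← map_one E.incl, coeff_incl, if_pos rfl] at h1
    exact (TwoSidedIdeal.one_mem_iff Q).1 h1
  · rw [E.mem_adjoinX hδ, E.coeff_zero_mul_mem_iff hδ] at hab
    rw [E.mem_adjoinX hδ, E.mem_adjoinX hδ]
    exact hc.2 _ _ hab
  · rw [E.mem_adjoinX hδ] at hs ⊢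
    rw [coeff_zero_smul]
    exact hQ.stable _ _ hs

theorem x_mem_adjoinX (Q : TwoSidedIdeal R) : E.x ∈ E.adjoinX Q :=
  TwoSidedIdeal.subset_span (Or.inr rfl)

theorem adjoinX_le_adjoinX_iff {Q' : TwoSidedIdeal R} (hδ : ∀ r, E.δ r ∈ Q)
    (hδ' : ∀ r, E.δ r ∈ Q') : E.adjoinX Q ≤ E.adjoinX Q' ↔ Q ≤ Q' := by
  constructor
  · intro h r hr
    have := h ((E.mem_adjoinX hδ (s := E.incl r)).2 (by rwa [coeff_incl, if_pos rfl]))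
    rwa [E.mem_adjoinX hδ', coeff_incl, if_pos rfl] at this
  · intro h s hs
    rw [E.mem_adjoinX hδ] at hs
    exact (E.mem_adjoinX hδ').2 (h hs)

theorem δ_mem_contract_of_x_mem {P : TwoSidedIdeal S} (hx : E.x ∈ P) (r : R) :
    E.δ r ∈ E.contract P := by
  rw [mem_contract, incl_δ]
  exact P.sub_mem (P.mul_mem_right _ _ hx) (P.mul_mem_left _ _ hx)

theorem adjoinX_contract {P : TwoSidedIdeal S} (hx : E.x ∈ P) :
    E.adjoinX (E.contract P) = P := by
  ext s
  rw [E.mem_adjoinX (E.δ_mem_contract_of_x_mem hx), mem_contract]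
  obtain ⟨t, ht⟩ := E.exists_sub_incl_coeff_eq s
  rw [← sub_add_cancel s (E.incl (E.coeff 0 s)), ht]
  simp only [map_add]
  rw [show E.coeff 0 (t * E.x) = 0 by simpa using E.coeff_mul_pow t 0 1, coeff_incl, if_pos rfl,
    map_zero, zero_add]
  exact (add_mem_cancel_left (P.mul_mem_left _ _ hx)).symm

/-! ### Comparison of `tildeC` with coefficients and with `adjoinX` -/

/-- The ideal of the elements all of whose coefficients lie in a given ideal. -/
def coeffIdeal (Q : TwoSidedIdeal R) (hQ : IsHStable H Q) (hδ : ∀ r ∈ Q, E.δ r ∈ Q) :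
    TwoSidedIdeal S :=
  TwoSidedIdeal.mk' {s | ∀ i, E.coeff i s ∈ Q}
    (fun i => by rw [map_zero]; exact Q.zero_mem)
    (fun hs ht i => by rw [map_add]; exact Q.add_mem (hs i) (ht i))
    (fun hs i => by rw [map_neg]; exact Q.neg_mem (hs i))
    (fun {s t} ht => by
      refine E.generator_induction s (p := fun s => ∀ t : S, (∀ i, E.coeff i t ∈ Q) →
        ∀ i, E.coeff i (s * t) ∈ Q) (fun r t ht i => ?_) (fun t ht i => ?_)
        (fun s s' hs hs' t ht i => ?_) (fun s s' hs hs' t ht => ?_) t ht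
      · rw [coeff_incl_mul]; exact Q.mul_mem_left _ _ (ht i)
      · cases i with
        | zero => rw [coeff_x_mul_zero]; exact hδ _ (ht 0)
        | succ i =>
          rw [coeff_x_mul_succ]
          exact Q.add_mem (E.τ_mem hQ (ht i)) (hδ _ (ht _))
      · rw [add_mul, map_add]; exact Q.add_mem (hs t ht i) (hs' t ht i)
      · rw [mul_assoc]; exact hs _ (hs' t ht))
    (fun {s t} hs i => by
      obtain ⟨n, hn⟩ := E.exists_coeff_eq_zero s
      rw [E.eq_sum_coeff hn, Finset.sum_mul, map_sum]
      refine sum_mem fun j _ => ?_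
      rw [mul_assoc, coeff_incl_mul]
      exact Q.mul_mem_right _ _ (hs j))

theorem mem_coeffIdeal (hQ : IsHStable H Q) (hδ : ∀ r ∈ Q, E.δ r ∈ Q) {s : S} :
    s ∈ E.coeffIdeal Q hQ hδ ↔ ∀ i, E.coeff i s ∈ Q := by
  rw [coeffIdeal, TwoSidedIdeal.mem_mk']; rfl

theorem deletingCoeff_mem (hQ : IsHStable H Q) (hδ : ∀ r ∈ Q, E.δ r ∈ Q) (l : ℕ) {r : R}
    (hr : r ∈ Q) : E.deletingCoeff l r ∈ Q := by
  refine (E.deletingCoeff_mem_iff l 0 hQ).2 ?_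
  induction l generalizing r with
  | zero => exact hr
  | succ l ih => exact ih (hδ r hr)

/-- For `r ∈ Q` all coefficients of `C(r)` lie in the `δ`-stable ideal `Q`, and right multiplication
by `x ^ M` only shifts coefficients. -/
theorem tildeC_le_coeffIdeal (hQ : IsHStable H Q) (hδ : ∀ r ∈ Q, E.δ r ∈ Q) :
    E.tildeC Q ≤ E.coeffIdeal Q hQ hδ := by
  let A : AddSubgroup E.Loc :=
    { carrier := {y | ∃ M : ℕ, ∃ s ∈ E.coeffIdeal Q hQ hδ, y * E.toLoc (E.x ^ M) = E.toLoc s}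
      zero_mem' := ⟨0, 0, TwoSidedIdeal.zero_mem _, by simp⟩
      add_mem' := by
        rintro y z ⟨n, s, hs, h⟩ ⟨m, t, ht, h'⟩
        refine ⟨n + m, s * E.x ^ m + t * E.x ^ n, TwoSidedIdeal.add_mem _
          (TwoSidedIdeal.mul_mem_right _ _ _ hs) (TwoSidedIdeal.mul_mem_right _ _ _ ht), ?_⟩
        rw [map_add, map_mul, map_mul, ← h, ← h', add_mul, mul_assoc, mul_assoc, ← map_mul,
          ← map_mul, ← pow_add, ← pow_add, add_comm m n]
      neg_mem' := by
        rintro y ⟨n, s, hs, h⟩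
        exact ⟨n, -s, TwoSidedIdeal.neg_mem _ hs, by rw [neg_mul, h, map_neg]⟩ }
  intro p hp
  have hA : E.toLoc p ∈ A := by
    refine E.mem_of_laurentCoeffs_mem (fun r hr i => ?_)
      ((E.mem_laurentIdeal hQ).1 ((E.mem_tildeC hQ).1 hp))
    obtain ⟨n, hn⟩ := E.exists_deletingCoeff_eq_zero r
    have hn' : ∀ l, (i + (n + i.natAbs : ℕ)).toNat < l → E.deletingCoeff l r = 0 :=
      fun l hl => hn l 0 (by omega)
    refine ⟨n + i.natAbs, E.deletingPoly r (i + (n + i.natAbs : ℕ)).toNat, ?_, ?_⟩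
    · rw [mem_coeffIdeal]
      intro j
      rw [coeff_deletingPoly]
      split_ifs
      · exact E.deletingCoeff_mem hQ hδ _ hr
      · exact Q.zero_mem
    · rw [E.toLoc_deletingPoly hn', Int.toNat_of_nonneg (by omega),
        ← coe_xUnit_zpow_natCast, mul_assoc, ← Units.val_mul, ← zpow_add]
  obtain ⟨M, s, hs, h⟩ := hA
  rw [← map_mul] at h
  have h2 := E.toLoc_injective h
  rw [mem_coeffIdeal] at hs ⊢
  intro i
  have h3 := hs (i + M)
  rwa [← h2, coeff_mul_pow, if_pos (by omega), Nat.add_sub_cancel] at h3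

theorem contract_tildeC (hQ : IsHStable H Q) (hδ : ∀ r ∈ Q, E.δ r ∈ Q) :
    E.contract (E.tildeC Q) = Q := by
  apply le_antisymm
  · intro r hr
    have := (E.mem_coeffIdeal hQ hδ).1 (E.tildeC_le_coeffIdeal hQ hδ (E.mem_contract.1 hr)) 0
    rwa [coeff_incl, if_pos rfl] at this
  · intro r hr
    rw [mem_contract, E.mem_tildeC hQ]
    have := E.toLoc_incl_mul_zpow_mem (Q := (Q : Set R))
      (A := (E.laurentIdeal Q hQ).asIdeal.toAddSubgroup)
      (fun l r hr => E.deletingCoeff_mem hQ hδ l hr)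
      (fun r hr i => (E.monomial_mem_laurentIdeal_iff hQ).2 hr) hr 0
    rwa [zpow_zero, Units.val_one, mul_one] at this

theorem pow_mul_incl_sub_mem_coeffIdeal (hQ : IsHStable H Q) (hδ : ∀ r, E.δ r ∈ Q) (n : ℕ)
    (r : R) : E.x ^ n * E.incl r - E.incl (E.τ^[n] r) * E.x ^ n ∈
      E.coeffIdeal Q hQ fun r _ => hδ r := by
  induction n with
  | zero => simp
  | succ n ih =>
    have e : E.x ^ (n + 1) * E.incl r - E.incl (E.τ^[n + 1] r) * E.x ^ (n + 1) =
        E.x * (E.x ^ n * E.incl r - E.incl (E.τ^[n] r) * E.x ^ n) +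
          E.incl (E.δ (E.τ^[n] r)) * E.x ^ n := by
      rw [mul_sub, ← mul_assoc, ← mul_assoc, ← pow_succ', E.x_mul, add_mul, mul_assoc _ E.x,
        ← pow_succ', Function.iterate_succ_apply']
      abel
    rw [e]
    refine TwoSidedIdeal.add_mem _ (TwoSidedIdeal.mul_mem_left _ _ _ ih)
      ((E.mem_coeffIdeal hQ _).2 fun i => ?_)
    rw [coeff_monomial]
    split_ifs
    · exact hδ _
    · exact Q.zero_mem

/-- If the leading coefficient of `f` is its only coefficient outside `Q`, then subtracting
multiples of `f` from multiples of `g` lowers the degree of `g` without altering, up to a factor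
outside `Q`, the coefficients of `g` modulo `Q` in degrees smaller than that of `f`. -/
theorem exists_mem_degreeLT_of_mem {P : TwoSidedIdeal S} (hQ : IsHStable H Q)
    (hc : IsCompletelyPrimeIdeal Q) (hδ : ∀ r, E.δ r ∈ Q) {m : ℕ} {f : S} (hf : f ∈ P)
    (hfd : f ∈ E.degreeLT (m + 2)) (hfl : ∀ i ≤ m, E.coeff i f ∈ Q)
    (hft : E.coeff (m + 1) f ∉ Q) (n : ℕ) : ∀ g ∈ P, g ∈ E.degreeLT (m + 1 + n) →
      (∀ i < m, E.coeff i g ∈ Q) → E.coeff m g ∉ Q →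
      ∃ g' ∈ P, g' ∈ E.degreeLT (m + 1) ∧ (∀ i < m, E.coeff i g' ∈ Q) ∧ E.coeff m g' ∉ Q := by
  induction n with
  | zero => exact fun g hg hgd hgl hgm => ⟨g, hg, hgd, hgl, hgm⟩
  | succ n ih =>
    intro g hg hgd hgl hgm
    set d := E.coeff (m + 1) f with hd
    set b := E.coeff (m + 1 + n) g with hb
    -- With this `r`, both `d g` and `f r x^n` have coefficient `d b` in degree `m + 1 + n`, so
    -- their difference has smaller degree.
    set r := E.τ.symm^[m + 1] b with hr
    have hτr : E.τ^[m + 1] r = b :=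
      Function.LeftInverse.iterate E.τ.apply_symm_apply (m + 1) b
    set N := E.coeffIdeal Q hQ fun r _ => hδ r with hN
    have hfN : f - E.incl d * E.x ^ (m + 1) ∈ N := by
      rw [hN, mem_coeffIdeal]
      intro i
      rw [map_sub, coeff_monomial]
      rcases lt_trichotomy i (m + 1) with h | h | h
      · rw [if_neg (by omega), sub_zero]; exact hfl i (by omega)
      · rw [h, if_pos rfl, ← hd, sub_self]; exact Q.zero_mem
      · rw [if_neg (by omega), sub_zero, hfd i (by omega)]; exact Q.zero_mem
    have hprod : f * E.incl r * E.x ^ n - E.incl (d * b) * E.x ^ (m + 1 + n) ∈ N := by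
      have e : f * E.incl r * E.x ^ n - E.incl (d * b) * E.x ^ (m + 1 + n) =
          (f - E.incl d * E.x ^ (m + 1)) * (E.incl r * E.x ^ n) +
          E.incl d * ((E.x ^ (m + 1) * E.incl r - E.incl (E.τ^[m + 1] r) * E.x ^ (m + 1)) *
            E.x ^ n) := by
        rw [hτr, map_mul, pow_add _ (m + 1) n]
        generalize E.x ^ (m + 1) = z
        noncomm_ring
      rw [e]
      exact N.add_mem (N.mul_mem_right _ _ hfN) (N.mul_mem_left _ _ (N.mul_mem_right _ _
        (E.pow_mul_incl_sub_mem_coeffIdeal hQ hδ _ _)))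
    have hlow : ∀ i ≤ m, E.coeff i (f * E.incl r * E.x ^ n) ∈ Q := fun i hi => by
      have := (E.mem_coeffIdeal hQ _).1 hprod i
      rwa [map_sub, coeff_monomial, if_neg (by omega), sub_zero] at this
    have hfr : f * E.incl r * E.x ^ n ∈ E.degreeLT (m + 2 + n) :=
      E.mul_pow_mem_degreeLT (E.mul_incl_mem_degreeLT _ hfd) n
    have htop : E.coeff (m + 1 + n) (f * E.incl r * E.x ^ n) = d * b := by
      rw [coeff_mul_pow, if_pos (by omega), Nat.add_sub_cancel,
        E.coeff_mul_incl_of_mem_degreeLT hfd, hτr]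
    refine ih (E.incl d * g - f * E.incl r * E.x ^ n)
      (P.sub_mem (P.mul_mem_left _ _ hg) (P.mul_mem_right _ _ (P.mul_mem_right _ _ hf)))
      (fun i hi => ?_) (fun i hi => ?_) fun h => ?_
    · rw [map_sub, coeff_incl_mul]
      rcases hi.eq_or_lt with rfl | hi
      · rw [htop, ← hb, sub_self]
      · rw [hgd i (by omega), hfr i (by omega), mul_zero, sub_zero]
    · rw [map_sub, coeff_incl_mul]
      exact Q.sub_mem (Q.mul_mem_left _ _ (hgl i hi)) (hlow i hi.le)
    · rw [map_sub, coeff_incl_mul, sub_eq_add_neg,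
        add_mem_cancel_right (Q.neg_mem (hlow m le_rfl))] at h
      exact (hc.2 _ _ h).elim hft hgm

/-- Descent on the degree of `f`, whose only coefficient outside `Q` is the leading one. A `p ∈ P`
with constant term outside `Q` would, after reducing a power-of-`x` multiple by `f`, yield such an
element of degree one less; in degree 0 it lies in `P ∩ R ⊆ Q`. -/
theorem coeff_zero_mem_of_contract_le {P : TwoSidedIdeal S} (hQ : IsHStable H Q)
    (hc : IsCompletelyPrimeIdeal Q) (hδ : ∀ r, E.δ r ∈ Q) (hP : E.contract P ≤ Q) (m : ℕ) :
    ∀ f ∈ P, f ∈ E.degreeLT (m + 1) → (∀ i < m, E.coeff i f ∈ Q) → E.coeff m f ∉ Q →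
      ∀ p ∈ P, E.coeff 0 p ∈ Q := by
  induction m with
  | zero =>
    intro f hf hfd _ hft
    refine absurd (hP (E.mem_contract.2 ?_)) hft
    have := E.eq_sum_coeff hfd
    rw [zero_add, Finset.sum_range_one, pow_zero, mul_one] at this
    rwa [← this]
  | succ m ih =>
    intro f hf hfd hfl hft p hp
    by_contra hp0
    obtain ⟨n, hn⟩ := E.exists_coeff_eq_zero p
    -- The factor `x ^ m` moves the constant term of `p` to degree `m`, just below the degree `m +
    -- 1` of `f`.
    obtain ⟨g, hg, hgd, hgl, hgt⟩ := E.exists_mem_degreeLT_of_mem hQ hc hδ hf hfd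
      (fun i hi => hfl i (by omega)) hft n (p * E.x ^ m) (P.mul_mem_right _ _ hp)
      (E.degreeLT_mono (by omega) (E.mul_pow_mem_degreeLT hn m))
      (fun i hi => by rw [coeff_mul_pow, if_neg (by omega)]; exact Q.zero_mem)
      (by rwa [coeff_mul_pow, if_pos le_rfl, Nat.sub_self])
    exact hp0 (ih g hg hgd hgl hgt p hp)

/-- If `I ⊆ Q`, all coefficients of `C̃(I)` lie in `Q`. Otherwise choose `d ∈ I` outside `Q`: `C(d)
x^m` has leading coefficient `d` and its other coefficients in `Q` because `δ(R) ⊆ Q`, so it starts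
the descent. -/
theorem tildeC_le_adjoinX_iff {I : TwoSidedIdeal R} (hI : IsHStable H I) (hQ : IsHPrime H Q)
    (hδ : ∀ r, E.δ r ∈ Q) : E.tildeC I ≤ E.adjoinX Q ↔ E.contract (E.tildeC I) ≤ Q := by
  constructor
  · intro h r hr
    have := (E.mem_adjoinX hδ).1 (h (E.mem_contract.1 hr))
    rwa [coeff_incl, if_pos rfl] at this
  intro h p hp
  rw [E.mem_adjoinX hδ]
  by_cases hle : I ≤ Q
  · exact (E.mem_coeffIdeal hQ.stable _).1 (E.tildeC_le_coeffIdeal hQ.stable (fun r _ => hδ r)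
      ((E.tildeC_le_tildeC_iff hI hQ.stable).2 hle hp)) 0
  · obtain ⟨d, hd, hdQ⟩ := SetLike.not_le_iff_exists.1 hle
    obtain ⟨m, hm⟩ := E.exists_deletingCoeff_eq_zero d
    refine E.coeff_zero_mem_of_contract_le hQ.stable (E.completelyPrime Q hQ) hδ h m
      (E.deletingPoly d m)
      ((E.deletingPoly_mem_tildeC_iff hI fun l hl => hm l 0 hl.le).2 hd)
      (fun i hi => by rw [coeff_deletingPoly, if_neg (by omega)]) (fun i hi => ?_) ?_ p hp
    · rw [coeff_deletingPoly, if_pos hi.le]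
      obtain ⟨l, hl⟩ : ∃ l, m - i = l + 1 := ⟨m - i - 1, by omega⟩
      rw [hl]
      refine (E.deletingCoeff_mem_iff (l + 1) 0 hQ.stable).2 ?_
      rw [Function.iterate_succ_apply']
      exact hδ _
    · rwa [coeff_deletingPoly, if_pos le_rfl, Nat.sub_self, deletingCoeff_zero]

end

end CauchonExtension

/-! ### Assembling the isomorphism -/

section MainTheorem

variable {k H R S : Type*} [Field k] [CommGroup H] [Ring R] [Algebra k R]
    [Ring S] [Algebra k S] [MulSemiringAction H R] [MulSemiringAction H S]
    (E : CauchonExtension k H R S)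
    {B W : Type*} [Group W] {M : CoxeterMatrix B} {cs : CoxeterSystem M W} {i : B} {u : W}
    (nabla : BruhatInterval cs u ≃o HSpec H R)

theorem δ_mem_nabla_of_mem_bruhatW3
    (H1 : nabla '' {w | w.val ∈ bruhatW3 cs u i} = {P | ∀ r : R, E.δ r ∈ P.val})
    {w : W} (hw : w ∈ bruhatW3 cs u i) (h : BruhatLE cs w u) (r : R) :
    E.δ r ∈ (nabla ⟨w, h⟩).val := by
  have : nabla ⟨w, h⟩ ∈ {P : HSpec H R | ∀ r : R, E.δ r ∈ P.val} := H1 ▸ ⟨⟨w, h⟩, hw, rfl⟩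
  exact this r

/-- (H2) persists on `W₃`: there `∇(w)` contains `δ(R)`, so it is its own contraction, and `Φ(w) =
w`. -/
theorem contract_tildeC_nabla (hu : BruhatLE cs u (u * cs.simple i))
    (H1 : nabla '' {w | w.val ∈ bruhatW3 cs u i} = {P | ∀ r : R, E.δ r ∈ P.val})
    (H2 : ∀ (w : W) (hw : w ∈ bruhatW1 cs u i ∪ bruhatW2 cs u i),
      E.contract (E.tildeC (nabla ⟨w, bruhatLE_of_mem hw⟩).val) =
        (nabla ⟨bruhatPhi cs i w, bruhatPhi_le_of_mem hw⟩).val)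
    {w : W} (h : BruhatLE cs w u) :
    E.contract (E.tildeC (nabla ⟨w, h⟩).val) =
      (nabla ⟨bruhatPhi cs i w, (bruhatPhi_le w i).trans h⟩).val := by
  rcases mem_bruhatW_of_le hu h with hw | hw
  · exact H2 w hw
  · rw [E.contract_tildeC (nabla ⟨w, h⟩).2.stable
      fun r _ => δ_mem_nabla_of_mem_bruhatW3 E nabla H1 hw h r]
    congr 2
    exact BruhatInterval.ext (le_of_mem_bruhatW3 hu hw).1.symm

end MainTheorem

theorem mainTheorem2 {k H R S : Type*} [Field k] [CommGroup H] [Ring R] [Algebra k R]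
    [Ring S] [Algebra k S] [MulSemiringAction H R] [MulSemiringAction H S]
    (E : CauchonExtension k H R S) (hτ : E.TauDiagonalizable)
    {B W : Type*} [Group W] {M : CoxeterMatrix B} (cs : CoxeterSystem M W)
    (i : B) (u : W) (hu : BruhatLE cs u (u * cs.simple i))
    (nabla : BruhatInterval cs u ≃o HSpec H R)
    (H1 : nabla '' {w | w.val ∈ bruhatW3 cs u i} = {P | ∀ r : R, E.δ r ∈ P.val})
    (H2 : ∀ (w : W) (hw : w ∈ bruhatW1 cs u i ∪ bruhatW2 cs u i),
      E.contract (E.tildeC (nabla ⟨w, bruhatLE_of_mem hw⟩).val) =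
        (nabla ⟨bruhatPhi cs i w, bruhatPhi_le_of_mem hw⟩).val) :
    ∃ nablaTilde : BruhatInterval cs (u * cs.simple i) ≃o HSpec H S,
      ∀ w : BruhatInterval cs (u * cs.simple i),
        (∀ h : BruhatLE cs w.val u, (nablaTilde w).val = E.tildeC (nabla ⟨w.val, h⟩).val) ∧
        (¬ BruhatLE cs w.val u → ∃ h : BruhatLE cs (w.val * cs.simple i) u,
          (nablaTilde w).val = E.adjoinX (nabla ⟨w.val * cs.simple i, h⟩).val) := by
  classical
  have hwa : ∀ {w : W}, BruhatLE cs w (u * cs.simple i) → ¬ BruhatLE cs w u →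
      BruhatLE cs (w * cs.simple i) u := fun hw hwu =>
    (le_of_mem_bruhatW3 hu (mul_simple_mem_bruhatW3 hu hw hwu)).2.1
  have hδ : ∀ {w : W} (hw : BruhatLE cs w (u * cs.simple i)) (hwu : ¬ BruhatLE cs w u) (r : R),
      E.δ r ∈ (nabla ⟨w * cs.simple i, hwa hw hwu⟩).val := fun hw hwu =>
    δ_mem_nabla_of_mem_bruhatW3 E nabla H1 (mul_simple_mem_bruhatW3 hu hw hwu) _
  let f : BruhatInterval cs (u * cs.simple i) → HSpec H S := fun w =>
    if h : BruhatLE cs w.val u then ⟨E.tildeC (nabla ⟨w.val, h⟩).val,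
      E.isHPrime_tildeC (nabla ⟨w.val, h⟩).2⟩
    else ⟨E.adjoinX (nabla ⟨w.val * cs.simple i, hwa w.le h⟩).val,
      E.isHPrime_adjoinX (nabla ⟨w.val * cs.simple i, hwa w.le h⟩).2 (hδ w.le h)⟩
  have hf₁ : ∀ w (h : BruhatLE cs w.val u), (f w).val = E.tildeC (nabla ⟨w.val, h⟩).val :=
    fun w h => by simp only [f, dif_pos h]
  have hf₂ : ∀ w (h : ¬ BruhatLE cs w.val u),
      (f w).val = E.adjoinX (nabla ⟨w.val * cs.simple i, hwa w.le h⟩).val :=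
    fun w h => by simp only [f, dif_neg h]
  have hle : ∀ w v, f w ≤ f v ↔ w ≤ v := by
    intro w v
    rw [← Subtype.coe_le_coe]
    change _ ↔ BruhatLE cs w.val v.val
    by_cases hw : BruhatLE cs w.val u <;> by_cases hv : BruhatLE cs v.val u
    · rw [hf₁ w hw, hf₁ v hv, E.tildeC_le_tildeC_iff (nabla _).2.stable (nabla _).2.stable,
        Subtype.coe_le_coe, nabla.le_iff_le]
      rfl
    -- The mixed case: both sides become `Φ(w) ≤ va`.
    · rw [hf₁ w hw, hf₂ v hv, E.tildeC_le_adjoinX_iff (nabla _).2.stable (nabla _).2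
        (hδ v.le hv), contract_tildeC_nabla E nabla hu H1 H2 hw, Subtype.coe_le_coe,
        nabla.le_iff_le, le_iff_bruhatPhi_le (bruhatPhi_of_not_le hu v.le hv).2]
      rfl
    · rw [hf₂ w hw, hf₁ v hv]
      exact iff_of_false
        (fun h => E.x_not_mem_tildeC (nabla _).2.stable (nabla _).2.ne_top
          (h (E.x_mem_adjoinX _)))
        fun h => hw (h.trans hv)
    · rw [hf₂ w hw, hf₂ v hv, E.adjoinX_le_adjoinX_iff (hδ w.le hw) (hδ v.le hv),
        Subtype.coe_le_coe, nabla.le_iff_le,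
        le_iff_bruhatPhi_le (bruhatPhi_of_not_le hu v.le hv).2,
        (bruhatPhi_of_not_le hu w.le hw).1]
      rfl
  have hsurj : Function.Surjective (OrderEmbedding.ofMapLEIff f hle) := by
    rintro ⟨P, hP⟩
    -- If `x ∈ P`, (H1) finds `P ∩ R` at some `w ∈ W₃`, and `P` is the image of `wa`; if not, `P =
    -- C̃(Q)` and `w` is the element with `∇(w) = Q`.
    by_cases hx : E.x ∈ P
    · have hmem : (⟨E.contract P, E.isHPrime_contract hP⟩ : HSpec H R) ∈
          {P : HSpec H R | ∀ r : R, E.δ r ∈ P.val} := E.δ_mem_contract_of_x_mem hx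
      rw [← H1] at hmem
      obtain ⟨w, hw, hwP⟩ := hmem
      refine ⟨⟨w.val * cs.simple i, (le_of_mem_bruhatW3 hu hw).2.2⟩, Subtype.ext ?_⟩
      refine (hf₂ _ hw.2).trans ?_
      have e : (⟨w.val * cs.simple i * cs.simple i, hwa (le_of_mem_bruhatW3 hu hw).2.2 hw.2⟩ :
          BruhatInterval cs u) = w := BruhatInterval.ext (by simp)
      simp only [e, hwP]
      exact E.adjoinX_contract hx
    · obtain ⟨Q, hQ, rfl⟩ := E.exists_tildeC_eq hP hx
      obtain ⟨w, hw⟩ := nabla.surjective ⟨Q, hQ⟩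
      refine ⟨⟨w.val, w.le.trans hu⟩, Subtype.ext ((hf₁ _ w.le).trans ?_)⟩
      rw [show (⟨w.val, w.le⟩ : BruhatInterval cs u) = w from rfl, hw]
  exact ⟨RelIso.ofSurjective (OrderEmbedding.ofMapLEIff f hle) hsurj, fun w =>
    ⟨fun h => hf₁ w h, fun h => ⟨hwa w.le h, hf₂ w h⟩⟩⟩
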